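/- Let $T=T[1]\dots T[n]$ be a string over an ordered alphabet of size $\sigma$ (encoded in order as the integers $0,\dots,\sigma-1$) whose last symbol is strictly smaller than all its other symbols. Write $T_i=T[i]\dots T[n]$. The suffix array $\mathsf{SA}[1,n]$ of $T$ satisfies $T_{\mathsf{SA}[1]}<\dots<T_{\mathsf{SA}[n]}$ lexicographically. The Lyndon array $\mathsf{LA}[1,n]$ of $T$ is given by $\mathsf{LA}[i]=\max\{\ell : i+\ell-1\le n,\ T[i]\dots T[i+\ell-1]\text{ is a Lyndon word}\}$, where a Lyndon word is a primitive word that is lexicographically least among its rotations. A suffix $T_i$ is S-type if $i=n$ or $T_i<T_{i+1}$, and L-type otherwise. For a symbol $c$, the $c$-bucket is the set of positions of the suffix array that hold the suffixes beginning with $c$. The computation model is a word RAM with a read-only text, two output arrays of $n$ words, and a working memory. A word holds an integer in $[0,k(n+\sigma))$ for a constant $k$, and each instruction (arithmetic, memory access, jump) costs one step. Working space is the number of words of working memory plus the number of registers. Step 4 of SACA-K with pointer arrays is the following procedure. It starts with any array $\mathsf{SA}$ in which $n$ and all $i$ with $T_i$ L-type are at their final positions, with $\mathsf{C}[c]$ equal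 to the last position of the $c$-bucket, and with $\mathsf{LA}[i]=0$, $\mathsf{NEXT}[i]=i+1$, $\mathsf{PREV}[i]=i-1$ for $1\le i\le n$. For $i=n,n-1,\dots,1$ it reads $j=\mathsf{SA}[i]$ and sets $\mathsf{LA}[j]=\mathsf{NEXT}[j]-j$; it sets $\mathsf{NEXT}[\mathsf{PREV}[j]]=\mathsf{NEXT}[j]$ if $\mathsf{PREV}[j]>0$, and $\mathsf{PREV}[\mathsf{NEXT}[j]]=\mathsf{PREV}[j]$ if $\mathsf{NEXT}[j]<n+1$; and if $j>1$ and $T_{j-1}$ is S-type, then with $c=T[j-1]$ it sets $\mathsf{SA}[\mathsf{C}[c]]=j-1$ and decreases $\mathsf{C}[c]$ by one. **Theorem.** 1. There are a program and constants such that, for all $\sigma$ and all such strings $T$ of length $n$, the program computes both the suffix array and the Lyndon array of $T$ in one run, in at most $c\cdot\max(n,\sigma)$ steps (that is, in $O(n)$ time for a fixed alphabet, and more generally for alphabets of size $\sigma=O(n)$), using $2n+\sigma+O(1)$ words of working space. The run contains an execution of Step 4 as above, in which $\mathsf{NEXT}$ and $\mathsf{PREV}$ occupy two disjoint blocks of $n$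 words of working space and each iteration takes $O(1)$ time. 2. In Step 4, before and after every iteration, the arrays $\mathsf{NEXT}$ and $\mathsf{PREV}$ form a doubly linked list of the zero entries of $\mathsf{LA}$: for every $i$ with $\mathsf{LA}[i]=0$, $\mathsf{NEXT}[i]$ is the least $\ell>i$ with $\mathsf{LA}[\ell]=0$, or $n+1$ if there is none, and $\mathsf{PREV}[i]$ is the $\ell$ with $\mathsf{LA}[\ell]=0$ and $\mathsf{NEXT}[\ell]=i$, or $0$ if there is none. In iteration $i$, the entry $j=\mathsf{SA}[i]$ that is read is already at its final position, $\mathsf{LA}[j]$ is still $0$, and $\mathsf{NEXT}[j]-j$ is the correct value of $\mathsf{LA}[j]$. At the end, $\mathsf{SA}$ and $\mathsf{LA}$ are the suffix array and the Lyndon array of $T$. -/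

import Mathlib

/-! Strings over the ordered alphabet `Fin σ` are lists; positions are numbered from `1` to
`n = T.length`, and `<`, `≤` on lists are the lexicographic order.  Arrays indexed by `1, …, n` are
functions `ℕ → ℕ` of which only the values at `1, …, n` matter. -/

/-- The suffix of `T` starting at position `i` (numbered from `1`). -/
def suffixAt {σ : ℕ} (T : List (Fin σ)) (i : ℕ) : List (Fin σ) := T.drop (i - 1)

/-- The symbol at position `i` (numbered from `1`) as a number; `0` outside the string. -/
def symbolAt {σ : ℕ} (T : List (Fin σ)) (i : ℕ) : ℕ :=
  match T[i - 1]? with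
  | some x => x.val
  | none => 0

/-- The last symbol of `T` is an end-marker: it is strictly smaller than all the other symbols of
`T` (in particular it occurs only once, and `T` is not empty). -/
def EndsWithSentinel {σ : ℕ} (T : List (Fin σ)) : Prop :=
  ∃ (U : List (Fin σ)) (e : Fin σ), T = U ++ [e] ∧ ∀ x ∈ U, e < x

/-- `w` is primitive: it is not a power `S ^ k` with `k > 1`. -/
def IsPrimitiveWord {σ : ℕ} (w : List (Fin σ)) : Prop :=
  ¬ ∃ (S : List (Fin σ)) (k : ℕ), 1 < k ∧ w = (List.replicate k S).flatten

/-- A Lyndon word: primitive, and lexicographically least among its rotations. -/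
def IsLyndonWord {σ : ℕ} (w : List (Fin σ)) : Prop :=
  IsPrimitiveWord w ∧ ∀ k : ℕ, w ≤ w.rotate k

/-- `A` is the suffix array of `T`. -/
def IsSuffixArray {σ : ℕ} (T : List (Fin σ)) (A : ℕ → ℕ) : Prop :=
  (∀ i, 1 ≤ i → i ≤ T.length → 1 ≤ A i ∧ A i ≤ T.length) ∧
  ∀ i j, 1 ≤ i → i < j → j ≤ T.length → suffixAt T (A i) < suffixAt T (A j)

/-- The lengths of the Lyndon factors of `T` that start at position `i`. -/
def lyndonLengths {σ : ℕ} (T : List (Fin σ)) (i : ℕ) : Set ℕ :=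
  {l | i + l ≤ T.length + 1 ∧ IsLyndonWord ((suffixAt T i).take l)}

/-- `A` is the Lyndon array of `T`. -/
def IsLyndonArray {σ : ℕ} (T : List (Fin σ)) (A : ℕ → ℕ) : Prop :=
  ∀ i, 1 ≤ i → i ≤ T.length → IsGreatest (lyndonLengths T i) (A i)

/-! ### A word RAM

The machine has the read-only text, the two output arrays and a working memory, and a number of
registers fixed by the program.  Every instruction costs one step.  A memory access outside
the arrays, a write to the text, and a value that does not fit into a word are faults: the
computation gets stuck without halting. -/

/-- The memory segments: the text, the two output arrays and the working memory. -/
inductive Segment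
  | text | sa | la | work

inductive ArithOp
  | add | sub | mul | div

/-- Subtraction is cut off at `0`; division rounds down. -/
def ArithOp.eval : ArithOp → ℕ → ℕ → ℕ
  | .add, x, y => x + y
  | .sub, x, y => x - y
  | .mul, x, y => x * y
  | .div, x, y => x / y

/-- Instructions of a machine with `r` registers. -/
inductive Instr (r : ℕ)
  /-- `dst := v` -/
  | const (dst : Fin r) (v : ℕ)
  /-- `dst := x o y` -/
  | arith (o : ArithOp) (dst x y : Fin r)
  /-- `dst := seg[addr]` -/
  | load (seg : Segment) (dst addr : Fin r)
  /-- `seg[addr] := src` -/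
  | store (seg : Segment) (addr src : Fin r)
  /-- go to instruction `l` -/
  | jump (l : ℕ)
  /-- go to instruction `l` if `x < y` -/
  | jumpLt (x y : Fin r) (l : ℕ)
  /-- go to instruction `l` if `x = y` -/
  | jumpEq (x y : Fin r) (l : ℕ)
  | halt

/-- A program: a number of registers and a finite list of instructions. -/
structure Program where
  regs : ℕ
  code : List (Instr regs)

/-- What a run depends on besides the program: the text, the number of cells of the working memory,
and the word bound (a word holds one of the numbers `0, …, wordBound - 1`). -/
structure Env where
  σ : ℕ
  text : List (Fin σ)
  workCells : ℕ
  wordBound : ℕ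

/-- A configuration of a machine with `r` registers. -/
structure Config (r : ℕ) where
  pc : ℕ
  reg : Fin r → ℕ
  sa : ℕ → ℕ
  la : ℕ → ℕ
  work : ℕ → ℕ

/-- The text and the output arrays have the addresses `1, …, n`, the working memory has the
addresses `0, …, workCells - 1`. -/
def Env.validAddr (E : Env) : Segment → ℕ → Prop
  | .work, a => a < E.workCells
  | _, a => 1 ≤ a ∧ a ≤ E.text.length

instance (E : Env) (seg : Segment) (a : ℕ) : Decidable (E.validAddr seg a) := by
  cases seg <;> unfold Env.validAddr <;> infer_instance

/-- The content of a memory cell. -/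
def Config.read {r : ℕ} (E : Env) (C : Config r) : Segment → ℕ → ℕ
  | .text, a => symbolAt E.text a
  | .sa, a => C.sa a
  | .la, a => C.la a
  | .work, a => C.work a

/-- Write a memory cell; the text cannot be written. -/
def Config.write {r : ℕ} (C : Config r) : Segment → ℕ → ℕ → Option (Config r)
  | .text, _, _ => none
  | .sa, a, v => some { C with sa := Function.update C.sa a v }
  | .la, a, v => some { C with la := Function.update C.la a v }
  | .work, a, v => some { C with work := Function.update C.work a v }

/-- Put `v` into a register, provided that it fits into a word, and go to the next instruction. -/
def Config.setReg {r : ℕ} (E : Env) (C : Config r) (dst : Fin r) (v : ℕ) : Option (Config r) :=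
  if v < E.wordBound then
    some { C with reg := Function.update C.reg dst v, pc := C.pc + 1 }
  else none

/-- One instruction. There is no successor configuration after a fault and after `halt`. -/
def Instr.exec {r : ℕ} (E : Env) (C : Config r) : Instr r → Option (Config r)
  | .const dst v => C.setReg E dst v
  | .arith o dst x y => C.setReg E dst (o.eval (C.reg x) (C.reg y))
  | .load seg dst addr =>
      if E.validAddr seg (C.reg addr) then C.setReg E dst (C.read E seg (C.reg addr)) else none
  | .store seg addr src =>
      if E.validAddr seg (C.reg addr) then
        (C.write seg (C.reg addr) (C.reg src)).map fun D => { D with pc := C.pc + 1 }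
      else none
  | .jump l => some { C with pc := l }
  | .jumpLt x y l => some { C with pc := if C.reg x < C.reg y then l else C.pc + 1 }
  | .jumpEq x y l => some { C with pc := if C.reg x = C.reg y then l else C.pc + 1 }
  | .halt => none

/-- One step of the program. -/
def Program.step (P : Program) (E : Env) (C : Config P.regs) : Option (Config P.regs) :=
  match P.code[C.pc]? with
  | some I => I.exec E C
  | none => none

/-- At the start the first two registers hold the length of the text and the alphabet size;
everything else is `0`. -/
def Program.init (P : Program) (E : Env) : Config P.regs where
  pc := 0
  reg := fun i => if i.val = 0 then E.text.length else if i.val = 1 then E.σ else 0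
  sa := fun _ => 0
  la := fun _ => 0
  work := fun _ => 0

/-- The configuration after `t` steps, if the program makes that many steps. -/
def Program.run (P : Program) (E : Env) : ℕ → Option (Config P.regs)
  | 0 => some (P.init E)
  | t + 1 => (P.run E t).bind (P.step E)

/-- The machine has halted properly, at a `halt` instruction. -/
def Program.HaltedAt (P : Program) (C : Config P.regs) : Prop :=
  P.code[C.pc]? = some Instr.halt

/-! ### The last step of induced suffix sorting, with the pointer arrays -/

/-- The suffix at position `i` is S-type (with the convention that the last suffix is). -/
abbrev IsSType {σ : ℕ} (T : List (Fin σ)) (i : ℕ) : Prop :=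
  i = T.length ∨ suffixAt T i < suffixAt T (i + 1)

/-- The inverse suffix array: the rank of suffix `j` among all suffixes, counted from `1`. -/
def suffixRank {σ : ℕ} (T : List (Fin σ)) (j : ℕ) : ℕ :=
  ((Finset.Icc 1 T.length).filter fun m => suffixAt T m ≤ suffixAt T j).card

/-- The array `A` is ready for Step 4 of SACA-K: the L-type suffixes, and the suffix that consists
of the end-marker, stand at their final places (the other entries are free). -/
def LTypesPlaced {σ : ℕ} (T : List (Fin σ)) (A : ℕ → ℕ) : Prop :=
  ∀ j, 1 ≤ j → j ≤ T.length → (¬ IsSType T j ∨ j = T.length) → A (suffixRank T j) = j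

/-- The data of Step 4: the array `SA`, the bucket array `C`, the array `LA` and the pointer
arrays `NEXT` and `PREV`. -/
structure InducingState where
  sa : ℕ → ℕ
  bucket : ℕ → ℕ
  la : ℕ → ℕ
  next : ℕ → ℕ
  prev : ℕ → ℕ

/-- The start of Step 4: `C[c]` is the last position of the `c`-bucket, `LA = 0`, `NEXT[i] = i + 1`,
`PREV[i] = i - 1`. -/
def InducingState.start {σ : ℕ} (T : List (Fin σ)) (sa₀ : ℕ → ℕ) : InducingState where
  sa := sa₀
  bucket := fun c => T.countP fun x => decide (x.val ≤ c)
  la := fun _ => 0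
  next := fun i => i + 1
  prev := fun i => i - 1

/-- Iteration `i` of Step 4. Let `j = SA[i]`. Set `LA[j] = NEXT[j] - j` and take `j` out of
the linked list; then, if the suffix at `j - 1` exists and is S-type, insert `j - 1` at the tail of
its bucket. -/
def InducingState.iter {σ : ℕ} (T : List (Fin σ)) (i : ℕ) (S : InducingState) : InducingState :=
  let j := S.sa i
  let c := symbolAt T (j - 1)
  let induces : Prop := 1 < j ∧ IsSType T (j - 1)
  { sa := if induces then Function.update S.sa (S.bucket c) (j - 1) else S.sa
    bucket := if induces then Function.update S.bucket c (S.bucket c - 1) else S.bucket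
    la := Function.update S.la j (S.next j - j)
    next := if 0 < S.prev j then Function.update S.next (S.prev j) (S.next j) else S.next
    prev := if S.next j < T.length + 1 then Function.update S.prev (S.next j) (S.prev j)
      else S.prev }

/-- Step 4 after its first `m` iterations, which are `i = n, n - 1, …, n - m + 1`. -/
def stepFour {σ : ℕ} (T : List (Fin σ)) (sa₀ : ℕ → ℕ) : ℕ → InducingState
  | 0 => InducingState.start T sa₀
  | m + 1 => (stepFour T sa₀ m).iter T (T.length - m)

/-- `next` and `prev` link the zero entries of `la` in `1, …, n` into a doubly linked list, ended
by `n + 1` on the right and by `0` on the left. -/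
def LinksZeros (n : ℕ) (la next prev : ℕ → ℕ) : Prop :=
  ∀ i, 1 ≤ i → i ≤ n → la i = 0 →
    IsLeast {l | i < l ∧ (l ≤ n ∧ la l = 0 ∨ l = n + 1)} (next i) ∧
    ((1 ≤ prev i ∧ prev i < i ∧ la (prev i) = 0 ∧ next (prev i) = i) ∨
      (prev i = 0 ∧ ∀ l, 1 ≤ l → l < i → la l ≠ 0))

/-- The configuration `C` stores the arrays `SA`, `LA`, `NEXT` and `PREV` of `S`: the first two in
the output arrays, `NEXT[1..n]` in the cells `p + 1, …, p + n` of the working memory and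
`PREV[1..n]` in the cells `q + 1, …, q + n`. -/
def Config.Stores {r : ℕ} (C : Config r) (n p q : ℕ) (S : InducingState) : Prop :=
  ∀ i, 1 ≤ i → i ≤ n →
    C.sa i = S.sa i ∧ C.la i = S.la i ∧ C.work (p + i) = S.next i ∧ C.work (q + i) = S.prev i

/-! The Lyndon array can be read off from the order of the suffixes. A word is Lyndon iff it is
smaller than all its proper suffixes (`isLyndonWord_of_lt_drop`, `IsLyndonWord.lt_drop`); hence, if
l is the first position after i with T_l < T_i (or n + 1), the longest Lyndon factor at i has length
l - i (`isGreatest_lyndonLengths`). Step 4 visits the suffixes in decreasing order and deletes each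
from a linked list of positions. When j is visited, the list holds exactly the suffixes of rank at
most that of j, so the right neighbour of j is the next smaller suffix.

That the entry read is final is induced sorting. An S-type suffix has a larger successor, so it was
inserted when that successor was visited. The place is right because in a bucket the S-type suffixes
follow the L-type ones and are ordered like their successors (`card_insertedSet`). The invariant
`Induced` records all this, `Induced.iter` preserves it, and `stepFour_spec` is part 2.

For part 1 any linear-time preparation of Step 4 within the space bound will do. A complete suffix
array satisfies `LTypesPlaced`, so the program sorts all suffixes by the skew algorithm and then
runs Step 4 over the result. Triples at positions not divisible by three are radix sorted and named;
the names form a string of about two thirds of the length with the suffix order of the sample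
(`IsReduction.sufLt`). The other suffixes are sorted by one more pass, and the two lists are merged,
comparing one or two symbols and then ranks (`compare_one`, `compare_two`). The recursion is
unfolded into a loop down and a loop up over a stack of strings. It fits into 4n + σ + O(1) cells
(`Levels.space`); the output arrays lend 2n of them until they are needed. Step 4 reuses the working
memory for both pointer arrays and the σ bucket pointers. Types are not stored: that of j - 1
follows from two symbols and a bucket pointer (`Induced.isSType_iff_bucket`).

To obtain machine runs, programs are written in a small while language over one flat memory, whose
compilation preserves results and step bounds (`Run.comp_correct`), and are verified by weakest
preconditions with a clock (`WP`, `wp_loop`, `ok_forTo`). -/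

set_option linter.constructorNameAsVariable false
set_option linter.unusedVariables false

/-! ### A structured language over a flat memory, and its compilation -/

/-- The program variables. -/
inductive Var
  | n | sg | s | b | m | K | n0 | m1 | bR | A | B | C | D | p | ia | oa | kb | cb
  | i | j | k | u | x | y | z | x0 | x1 | x2 | y0 | y1 | y2 | a | c | nm | q | nx | pv | fl
  deriving DecidableEq

/-- Expressions; `mem` reads the flat memory and `txt` the text. -/
inductive Exp
  | const (v : ℕ)
  | var (x : Var)
  | bin (o : ArithOp) (a b : Exp)
  | txt (a : Exp)
  | mem (a : Exp)

instance : Add Exp := ⟨Exp.bin .add⟩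
instance : Sub Exp := ⟨Exp.bin .sub⟩
instance : Mul Exp := ⟨Exp.bin .mul⟩
instance : Div Exp := ⟨Exp.bin .div⟩
instance : Coe Var Exp := ⟨Exp.var⟩
notation "lit(" v ")" => Exp.const v
notation "M[" e "]" => Exp.mem e

/-- Conditions. -/
inductive Cond
  | lt (a b : Exp)
  | eq (a b : Exp)

/-- Structured programs. -/
inductive Stmt
  | skip
  | assign (x : Var) (e : Exp)
  | put (a e : Exp)
  | seq (c d : Stmt)
  | ite (b : Cond) (c d : Stmt)
  | loop (b : Cond) (c : Stmt)

infixr:60 " ;; " => Stmt.seq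
infix:62 " ::= " => Stmt.assign
infix:62 " ::=ₘ " => Stmt.put

/-- The state of a structured program. -/
@[ext] structure St where
  var : Var → ℕ
  mem : ℕ → ℕ

def St.set (S : St) (x : Var) (v : ℕ) : St := { S with var := Function.update S.var x v }
def St.write (S : St) (a v : ℕ) : St := { S with mem := Function.update S.mem a v }

@[simp] lemma St.set_var (S : St) (x y : Var) (v : ℕ) :
    (S.set x v).var y = if y = x then v else S.var y := by
  simp [St.set, Function.update_apply]
@[simp] lemma St.set_mem (S : St) (x : Var) (v : ℕ) : (S.set x v).mem = S.mem := rfl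
@[simp] lemma St.write_var (S : St) (a v : ℕ) : (S.write a v).var = S.var := rfl
@[simp] lemma St.write_mem (S : St) (a v : ℕ) :
    (S.write a v).mem = Function.update S.mem a v := rfl

/-- The size of the flat memory: the working memory and the two output arrays. -/
def Env.size (E : Env) : ℕ := E.workCells + 2 * E.text.length

def Exp.val (E : Env) (S : St) : Exp → ℕ
  | .const v => v
  | .var x => S.var x
  | .bin o a b => o.eval (a.val E S) (b.val E S)
  | .txt a => symbolAt E.text (a.val E S)
  | .mem a => S.mem (a.val E S)

/-- Evaluation does not fault. -/
def Exp.ok (E : Env) (S : St) : Exp → Prop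
  | .const v => v < E.wordBound
  | .var _ => True
  | .bin .add a b => a.ok E S ∧ b.ok E S ∧ a.val E S + b.val E S < E.wordBound
  | .bin .mul a b => a.ok E S ∧ b.ok E S ∧ a.val E S * b.val E S < E.wordBound
  | .bin .sub a b => a.ok E S ∧ b.ok E S
  | .bin .div a b => a.ok E S ∧ b.ok E S
  | .txt a => a.ok E S ∧ 1 ≤ a.val E S ∧ a.val E S ≤ E.text.length
  | .mem a => a.ok E S ∧ a.val E S < E.size

/-- A memory access costs seven: at most five instructions find the segment, one is the access
itself, one jumps to the end of `flatCode`. -/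
def Exp.cost : Exp → ℕ
  | .const _ => 1
  | .var _ => 1
  | .bin _ a b => a.cost + b.cost + 1
  | .txt a => a.cost + 1
  | .mem a => a.cost + 7

/-- The number of temporary registers needed. -/
def Exp.temps : Exp → ℕ
  | .const _ => 1
  | .var _ => 1
  | .bin _ a b => max a.temps (b.temps + 1)
  | .txt a => a.temps
  | .mem a => a.temps

def Cond.val (E : Env) (S : St) : Cond → Prop
  | .lt a b => a.val E S < b.val E S
  | .eq a b => a.val E S = b.val E S

def Cond.ok (E : Env) (S : St) : Cond → Prop
  | .lt a b => a.ok E S ∧ b.ok E S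
  | .eq a b => a.ok E S ∧ b.ok E S

/-- Of the extra two, one pays for the conditional jump and one for the unconditional jump that may
follow in an `ite` or at the exit of a loop. -/
def Cond.cost : Cond → ℕ
  | .lt a b => a.cost + b.cost + 2
  | .eq a b => a.cost + b.cost + 2

/-- There are nine temporary registers, and the left operand occupies one while the right operand is
evaluated. -/
def Cond.fits : Cond → Prop
  | .lt a b => a.temps ≤ 9 ∧ b.temps ≤ 8
  | .eq a b => a.temps ≤ 9 ∧ b.temps ≤ 8

def Stmt.fits : Stmt → Prop
  | .skip => True
  | .assign _ e => e.temps ≤ 9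
  | .put a e => a.temps ≤ 9 ∧ e.temps ≤ 8
  | .seq c d => c.fits ∧ d.fits
  | .ite b c d => b.fits ∧ c.fits ∧ d.fits
  | .loop b c => b.fits ∧ c.fits

/-- Big-step semantics, with a bound on the number of steps of the compiled program. -/
inductive Run (E : Env) : Stmt → St → ℕ → St → Prop
  | skip (S) : Run E .skip S 0 S
  | assign (x e S) (h : e.ok E S) : Run E (x ::= e) S (e.cost + 1) (S.set x (e.val E S))
  | put (a e S) (ha : a.ok E S) (he : e.ok E S) (hv : a.val E S < E.size) :
      Run E (a ::=ₘ e) S (a.cost + e.cost + 7) (S.write (a.val E S) (e.val E S))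
  | seq {c d S t S' u S''} (h : Run E c S t S') (h' : Run E d S' u S'') :
      Run E (c ;; d) S (t + u) S''
  | iteTrue {b c d S t S'} (hb : b.ok E S) (hv : b.val E S) (h : Run E c S t S') :
      Run E (.ite b c d) S (b.cost + t) S'
  | iteFalse {b c d S t S'} (hb : b.ok E S) (hv : ¬ b.val E S) (h : Run E d S t S') :
      Run E (.ite b c d) S (b.cost + t) S'
  | loopFalse {b c S} (hb : b.ok E S) (hv : ¬ b.val E S) : Run E (.loop b c) S b.cost S
  | loopTrue {b c S t S' u S''} (hb : b.ok E S) (hv : b.val E S) (h : Run E c S t S')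
      (h' : Run E (.loop b c) S' u S'') : Run E (.loop b c) S (b.cost + t + 1 + u) S''

/-! #### Registers -/

/-- Registers 0 to 3 are for the text length, the alphabet size, the size of the working memory and
the constant 1; 54 to 62 are the temporaries and 63 stays 0. The variables live in between. -/
def Var.idx (x : Var) : Fin 64 := Fin.ofNat 64 (x.ctorIdx + 4)

lemma Var.ctorIdx_lt (x : Var) : x.ctorIdx < 48 := by cases x <;> decide

lemma Var.idx_val (x : Var) : (x.idx).val = x.ctorIdx + 4 := by
  have := x.ctorIdx_lt
  simp only [Var.idx, Fin.val_ofNat]; omega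

lemma Var.idx_inj {x y : Var} (h : x.idx = y.idx) : x = y := by
  have h := congrArg Fin.val h
  rw [x.idx_val, y.idx_val] at h
  have h : x.ctorIdx = y.ctorIdx := by omega
  rw [← Var.ofNat_ctorIdx x, ← Var.ofNat_ctorIdx y, h]

/-- The temporary registers. -/
def tmp (d : ℕ) : Fin 64 := ⟨min (54 + d) 62, by omega⟩

lemma tmp_val (d : ℕ) : (tmp d).val = min (54 + d) 62 := rfl

/-! #### Compilation -/

/-- Load from, or store to, the flat address in register `t`. -/
def flatCode (pc : ℕ) (t : Fin 64) (f : Segment → Instr 64) : List (Instr 64) :=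
  [.jumpLt t 2 (pc + 7), .arith .sub t t 2, .jumpLt t 0 (pc + 9), .arith .sub t t 0,
    .arith .add t t 3, f .sa, .jump (pc + 11), f .work, .jump (pc + 11), .arith .add t t 3, f .la]

/-- The result goes to `tmp d`, and smaller temporaries are left alone. The machine has no move
instruction; a register is copied by adding the zero register. -/
def Exp.comp : Exp → ℕ → ℕ → List (Instr 64)
  | .const v, _, d => [.const (tmp d) v]
  | .var x, _, d => [.arith .add (tmp d) x.idx 63]
  | .bin o a b, pc, d =>
      a.comp pc d ++ (b.comp (pc + (a.comp pc d).length) (d + 1) ++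
        [.arith o (tmp d) (tmp d) (tmp (d + 1))])
  | .txt a, pc, d => a.comp pc d ++ [.load .text (tmp d) (tmp d)]
  | .mem a, pc, d =>
      a.comp pc d ++ flatCode (pc + (a.comp pc d).length) (tmp d) fun g => .load g (tmp d) (tmp d)

def compTwo (a b : Exp) (pc : ℕ) : List (Instr 64) :=
  a.comp pc 0 ++ b.comp (pc + (a.comp pc 0).length) 1

def Cond.comp : Cond → ℕ → List (Instr 64)
  | .lt a b, pc => compTwo a b pc
  | .eq a b, pc => compTwo a b pc

/-- The conditional jump, after the operands have been put into the temporary registers. -/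
def Cond.jump : Cond → ℕ → Instr 64
  | .lt _ _, l => .jumpLt (tmp 0) (tmp 1) l
  | .eq _ _, l => .jumpEq (tmp 0) (tmp 1) l

/-- Jump targets are absolute, so the compiler carries the position of the code. The else branch
comes first, because the conditional jump is taken when the condition holds. -/
def Stmt.comp : Stmt → ℕ → List (Instr 64)
  | .skip, _ => []
  | .assign x e, pc => e.comp pc 0 ++ [.arith .add x.idx (tmp 0) 63]
  | .put a e, pc =>
      compTwo a e pc ++
        flatCode (pc + (compTwo a e pc).length) (tmp 0) fun g => .store g (tmp 0) (tmp 1)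
  | .seq c d, pc => c.comp pc ++ d.comp (pc + (c.comp pc).length)
  | .ite b c d, pc =>
      let p₁ := pc + (b.comp pc).length
      let D := d.comp (p₁ + 1)
      let p₂ := p₁ + 1 + D.length + 1
      let C := c.comp p₂
      b.comp pc ++ (b.jump p₂ :: (D ++ (.jump (p₂ + C.length) :: C)))
  | .loop b c, pc =>
      let p₁ := pc + (b.comp pc).length
      let C := c.comp (p₁ + 2)
      b.comp pc ++ (b.jump (p₁ + 2) :: .jump (p₁ + 2 + C.length + 1) :: (C ++ [.jump pc]))

/-! #### Steps of the machine -/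

abbrev prog (code : List (Instr 64)) : Program := ⟨64, code⟩

/-- `t` steps from a given configuration. -/
def stepN (P : Program) (E : Env) : ℕ → Config P.regs → Option (Config P.regs)
  | 0, C => some C
  | t + 1, C => (P.step E C).bind (stepN P E t)

lemma stepN_add (P : Program) (E : Env) (t u : ℕ) (C : Config P.regs) :
    stepN P E (t + u) C = (stepN P E t C).bind (stepN P E u) := by
  induction t generalizing C with
  | zero => simp [stepN]
  | succ t ih =>
    rw [Nat.succ_add]
    simp only [stepN]
    cases P.step E C with
    | none => rfl
    | some D => simpa using ih D

/-- `run` appends steps at the end, while `stepN` peels them off at the front and so can be composed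
from an arbitrary configuration. -/
lemma Program.run_eq_stepN (P : Program) (E : Env) (t : ℕ) :
    P.run E t = stepN P E t (P.init E) := by
  induction t with
  | zero => rfl
  | succ t ih =>
    rw [stepN_add, ← ih]
    simp only [Program.run]
    congr 1
    funext C
    simp [stepN]

/-- `C'` is reached from `C` within `B` steps. -/
def Reach (P : Program) (E : Env) (C : Config P.regs) (B : ℕ) (C' : Config P.regs) : Prop :=
  ∃ t ≤ B, stepN P E t C = some C'

lemma Reach.refl {P : Program} {E : Env} (C : Config P.regs) (B : ℕ) : Reach P E C B C :=
  ⟨0, Nat.zero_le _, rfl⟩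

lemma Reach.trans {P : Program} {E : Env} {C D F : Config P.regs} {a b : ℕ}
    (h : Reach P E C a D) (h' : Reach P E D b F) : Reach P E C (a + b) F := by
  obtain ⟨t, ht, h⟩ := h
  obtain ⟨u, hu, h'⟩ := h'
  exact ⟨t + u, by omega, by rw [stepN_add, h]; exact h'⟩

lemma Reach.mono {P : Program} {E : Env} {C D : Config P.regs} {a b : ℕ}
    (h : Reach P E C a D) (hab : a ≤ b) : Reach P E C b D := by
  obtain ⟨t, ht, h⟩ := h
  exact ⟨t, by omega, h⟩

lemma Reach.single {P : Program} {E : Env} {C D : Config P.regs} {I : Instr P.regs}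
    (h : P.code[C.pc]? = some I) (hI : I.exec E C = some D) : Reach P E C 1 D :=
  ⟨1, le_rfl, by simp [stepN, Program.step, h, hI]⟩

/-- The instructions `l` stand at position `pc` of the program. -/
def CodeAt (code : List (Instr 64)) (pc : ℕ) : List (Instr 64) → Prop
  | [] => True
  | I :: l => code[pc]? = some I ∧ CodeAt code (pc + 1) l

lemma codeAt_append {code : List (Instr 64)} {pc : ℕ} {a b : List (Instr 64)} :
    CodeAt code pc (a ++ b) ↔ CodeAt code pc a ∧ CodeAt code (pc + a.length) b := by
  induction a generalizing pc with
  | nil => simp [CodeAt]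
  | cons I l ih =>
    simp only [List.cons_append, CodeAt, ih, List.length_cons, and_assoc]
    rw [show pc + 1 + l.length = pc + (l.length + 1) by omega]

lemma codeAt_self (pre a post : List (Instr 64)) :
    CodeAt (pre ++ (a ++ post)) pre.length a := by
  induction a generalizing pre with
  | nil => trivial
  | cons I l ih =>
    refine ⟨by simp, ?_⟩
    have := ih (pre ++ [I])
    simpa using this

/-! #### Correctness of the compilation -/

/-- The configuration `C` represents the state `S`. -/
structure Represents (E : Env) (C : Config 64) (S : St) : Prop where
  rN : C.reg 0 = E.text.length
  rS : C.reg 2 = E.workCells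
  rOne : C.reg 3 = 1
  rZero : C.reg 63 = 0
  vars : ∀ x : Var, C.reg x.idx = S.var x
  reg_lt : ∀ r, C.reg r < E.wordBound
  work : ∀ a < E.workCells, C.work a = S.mem a
  la : ∀ i < E.text.length, C.la (i + 1) = S.mem (E.workCells + i)
  sa : ∀ i < E.text.length, C.sa (i + 1) = S.mem (E.workCells + E.text.length + i)
  mem_lt : ∀ a < E.size, S.mem a < E.wordBound
  sigma_le : E.σ ≤ E.wordBound

lemma Represents.pc {E : Env} {C : Config 64} {S : St} (h : Represents E C S) (l : ℕ) :
    Represents E { C with pc := l } S :=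
  { h with }

lemma Represents.setTmp {E : Env} {C : Config 64} {S : St} (h : Represents E C S) (d : ℕ) {v l : ℕ}
    (hv : v < E.wordBound) :
    Represents E { C with reg := Function.update C.reg (tmp d) v, pc := l } S := by
  have hne : ∀ r : Fin 64, (r.val < 54 ∨ r.val = 63) → Function.update C.reg (tmp d) v r = C.reg r := by
    intro r hr
    refine Function.update_of_ne (fun e => ?_) _ _
    have := tmp_val d
    rw [e] at hr
    omega
  refine { h with rN := ?_, rS := ?_, rOne := ?_, rZero := ?_, vars := ?_, reg_lt := ?_ }
  · rw [← h.rN]; exact hne 0 (by decide)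
  · rw [← h.rS]; exact hne 2 (by decide)
  · rw [← h.rOne]; exact hne 3 (by decide)
  · rw [← h.rZero]; exact hne 63 (by decide)
  · intro x
    rw [← h.vars]
    refine hne _ (Or.inl ?_)
    have := x.ctorIdx_lt
    rw [x.idx_val]; omega
  · intro r
    by_cases hr : r = tmp d
    · subst hr; simpa using hv
    · simpa [Function.update_of_ne hr] using h.reg_lt r

lemma Represents.setVar {E : Env} {C : Config 64} {S : St} (h : Represents E C S) (x : Var) {v l : ℕ}
    (hv : v < E.wordBound) :
    Represents E { C with reg := Function.update C.reg x.idx v, pc := l } (S.set x v) := by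
  have hx := x.ctorIdx_lt
  have hx' := x.idx_val
  have hne : ∀ r : Fin 64, (r.val < 4 ∨ r.val = 63) → Function.update C.reg x.idx v r = C.reg r := by
    intro r hr
    refine Function.update_of_ne (fun e => ?_) _ _
    rw [e] at hr
    omega
  refine { h with rN := ?_, rS := ?_, rOne := ?_, rZero := ?_, vars := ?_, reg_lt := ?_ }
  · rw [← h.rN]; exact hne 0 (by decide)
  · rw [← h.rS]; exact hne 2 (by decide)
  · rw [← h.rOne]; exact hne 3 (by decide)
  · rw [← h.rZero]; exact hne 63 (by decide)
  · intro y
    by_cases hy : y = x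
    · subst hy; simp
    · have : y.idx ≠ x.idx := fun e => hy (Var.idx_inj e)
      simp [Function.update_of_ne this, hy, h.vars]
  · intro r
    by_cases hr : r = x.idx
    · subst hr; simpa using hv
    · simpa [Function.update_of_ne hr] using h.reg_lt r

lemma symbolAt_lt {σ : ℕ} (T : List (Fin σ)) (i : ℕ) (h1 : 1 ≤ i) (h2 : i ≤ T.length) :
    symbolAt T i < σ := by
  unfold symbolAt
  have : i - 1 < T.length := by omega
  rw [List.getElem?_eq_getElem this]
  exact (T[i-1]).isLt

section
variable {code : List (Instr 64)} {E : Env} {S : St}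

/-- The state of the registers during the evaluation of an expression into `tmp d`. -/
def Evaluated (E : Env) (C : Config 64) (S : St) (pc d v : ℕ) (C₀ : Config 64) : Prop :=
  Represents E C S ∧ C.pc = pc ∧ C.reg (tmp d) = v ∧ ∀ d' < d, C.reg (tmp d') = C₀.reg (tmp d')

/-- The cap in `tmp` protects the zero register 63 but merges all indices from eight on; hence the
bound. -/
lemma tmp_ne {d d' : ℕ} (h : d' < d) (hd : d < 9) : tmp d' ≠ tmp d := by
  intro e
  have := congrArg Fin.val e
  rw [tmp_val, tmp_val] at this
  omega

lemma evaluated_setReg {C C₀ : Config 64} {d v : ℕ} {I : Instr 64} (h : Represents E C S)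
    (hd : d < 9) (hv : v < E.wordBound)
    (hold : ∀ d' < d, C.reg (tmp d') = C₀.reg (tmp d'))
    (hI : code[C.pc]? = some I) (hx : I.exec E C = C.setReg E (tmp d) v) :
    ∃ C', Reach (prog code) E C 1 C' ∧ Evaluated E C' S (C.pc + 1) d v C₀ := by
  refine ⟨{ C with reg := Function.update C.reg (tmp d) v, pc := C.pc + 1 },
    Reach.single hI (by rw [hx, Config.setReg, if_pos hv]), h.setTmp d hv, rfl, by simp, ?_⟩
  intro d' hd'
  rw [← hold d' hd']
  exact Function.update_of_ne (tmp_ne hd' hd) _ _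

/-- The first part of `flatCode`: reach the access instruction for the right segment. -/
lemma reach_flat {C : Config 64} {d a pc : ℕ} {f : Segment → Instr 64} (h : Represents E C S)
    (hd : d < 9) (hpc : C.pc = pc) (ha : C.reg (tmp d) = a) (has : a < E.size)
    (hc : CodeAt code pc (flatCode pc (tmp d) f)) :
    ∃ (C' : Config 64) (g : Segment) (a' : ℕ), Reach (prog code) E C 5 C' ∧ Represents E C' S ∧
      code[C'.pc]? = some (f g) ∧ C'.reg (tmp d) = a' ∧ E.validAddr g a' ∧
      (∀ r ≠ tmp d, C'.reg r = C.reg r) ∧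
      (C'.pc = pc + 10 ∨ code[C'.pc + 1]? = some (.jump (pc + 11))) ∧
      ((g = .work ∧ a' = a ∧ a < E.workCells) ∨
        (g = .la ∧ 1 ≤ a' ∧ a' ≤ E.text.length ∧ a + 1 = E.workCells + a') ∨
        (g = .sa ∧ 1 ≤ a' ∧ a' ≤ E.text.length ∧ a + 1 = E.workCells + E.text.length + a')) := by
  obtain ⟨c0, c1, c2, c3, c4, c5, c6, c7, c8, c9, c10, -⟩ := hc
  have haw : a < E.wordBound := ha ▸ h.reg_lt _
  have ht0 : ∀ r : Fin 64, r.val < 54 → r ≠ tmp d := by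
    intro r hr e
    have := tmp_val d
    rw [e] at hr; omega
  have t0 := ht0 0 (by decide)
  have t2 := ht0 2 (by decide)
  have t3 := ht0 3 (by decide)
  subst hpc
  -- The flat address lies in the working memory, in `la`, or in `sa`, in this order.
  by_cases hw : a < E.workCells
  · refine ⟨{ C with pc := C.pc + 7 }, .work, a, ?_, h.pc _, c7, ha, hw, fun _ _ => rfl,
      Or.inr c8, Or.inl ⟨rfl, rfl, hw⟩⟩
    exact (Reach.single c0 (by simp [Instr.exec, ha, h.rS, hw])).mono (by omega)
  · set C1 : Config 64 := { C with pc := C.pc + 1 } with hC1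
    have r1 : Reach (prog code) E C 1 C1 :=
      Reach.single c0 (by simp [Instr.exec, ha, h.rS, hw, hC1])
    set C2 : Config 64 :=
      { C1 with reg := Function.update C1.reg (tmp d) (a - E.workCells), pc := C.pc + 2 } with hC2
    have h2 : Represents E C2 S := (h.pc (C.pc + 1)).setTmp d (by omega)
    have r2 : Reach (prog code) E C1 1 C2 := by
      refine Reach.single c1 ?_
      simp [Instr.exec, Config.setReg, ArithOp.eval, hC1, ha, h.rS, hC2]
      omega
    have e2 : C2.reg (tmp d) = a - E.workCells := by simp [hC2]
    have o2 : ∀ r ≠ tmp d, C2.reg r = C.reg r := fun r hr => by simp [hC2, hC1, hr]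
    have p2 : C2.pc = C.pc + 2 := rfl
    clear_value C2
    by_cases hl : a - E.workCells < E.text.length
    · set C3 : Config 64 := { C2 with pc := C.pc + 9 } with hC3
      have r3 : Reach (prog code) E C2 1 C3 :=
        Reach.single (by rw [p2]; exact c2) (by simp [Instr.exec, e2, h2.rN, hl, hC3])
      set C4 : Config 64 := { C3 with
        reg := Function.update C3.reg (tmp d) (a - E.workCells + 1), pc := C.pc + 10 } with hC4
      -- The output arrays are numbered from 1. The shifted address is at most the text length,
      -- which fits into a word because a register holds it.
      have hb : a - E.workCells + 1 < E.wordBound := by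
        have := h2.reg_lt 0
        have := h2.rN
        omega
      have r4 : Reach (prog code) E C3 1 C4 := by
        refine Reach.single c9 ?_
        simp [Instr.exec, Config.setReg, ArithOp.eval, hC3, e2, h2.rOne, hC4, hb]
      refine ⟨C4, .la, a - E.workCells + 1, (((r1.trans r2).trans r3).trans r4).mono (by omega),
        (h2.pc _).setTmp d hb, c10, by simp [hC4], ⟨by omega, by omega⟩, ?_, Or.inl rfl,
        Or.inr (Or.inl ⟨rfl, by omega, by omega, by omega⟩)⟩
      intro r hr
      simp [hC4, hC3, hr, o2 r hr]
    · set C3 : Config 64 := { C2 with pc := C.pc + 3 } with hC3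
      have r3 : Reach (prog code) E C2 1 C3 :=
        Reach.single (by rw [p2]; exact c2) (by simp [Instr.exec, e2, h2.rN, hl, hC3, p2])
      set C4 : Config 64 := { C3 with
        reg := Function.update C3.reg (tmp d) (a - E.workCells - E.text.length),
        pc := C.pc + 4 } with hC4
      have h4 : Represents E C4 S := (h2.pc _).setTmp d (by omega)
      have r4 : Reach (prog code) E C3 1 C4 := by
        refine Reach.single c3 ?_
        simp [Instr.exec, Config.setReg, ArithOp.eval, hC3, e2, h2.rN, hC4]
        omega
      have e4 : C4.reg (tmp d) = a - E.workCells - E.text.length := by simp [hC4]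
      have o4 : ∀ r ≠ tmp d, C4.reg r = C.reg r := fun r hr => by simp [hC4, hC3, hr, o2 r hr]
      have p4 : C4.pc = C.pc + 4 := rfl
      clear_value C4
      have hs : a < E.workCells + 2 * E.text.length := has
      set C5 : Config 64 := { C4 with
        reg := Function.update C4.reg (tmp d) (a - E.workCells - E.text.length + 1),
        pc := C.pc + 5 } with hC5
      have hb : a - E.workCells - E.text.length + 1 < E.wordBound := by
        have := h2.reg_lt 0
        have := h2.rN
        omega
      have r5 : Reach (prog code) E C4 1 C5 := by
        refine Reach.single (by rw [p4]; exact c4) ?_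
        simp [Instr.exec, Config.setReg, ArithOp.eval, e4, h4.rOne, hC5, p4, hb]
      refine ⟨C5, .sa, a - E.workCells - E.text.length + 1, ((((r1.trans r2).trans r3).trans r4).trans r5).mono (by omega),
        h4.setTmp d hb, c5, by simp [hC5], ⟨by omega, by omega⟩, ?_, Or.inr c6,
        Or.inr (Or.inr ⟨rfl, by omega, by omega, by omega⟩)⟩
      intro r hr
      simp [hC5, hr, o4 r hr]

lemma flatCode_length (pc : ℕ) (t : Fin 64) (f : Segment → Instr 64) :
    (flatCode pc t f).length = 11 := rfl

/-- After the access instruction, go to the end of `flatCode`. -/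
lemma reach_flat_end {C : Config 64} {p pc : ℕ} (hp : C.pc = p + 1)
    (h : p = pc + 10 ∨ code[p + 1]? = some (.jump (pc + 11))) :
    ∃ l, Reach (prog code) E C 1 { C with pc := l } ∧ l = pc + 11 := by
  rcases h with h | h
  · refine ⟨C.pc, Reach.refl _ _, by omega⟩
  · exact ⟨pc + 11, Reach.single (by rw [hp]; exact h) rfl, rfl⟩

lemma Represents.flat_read {C : Config 64} {a a' : ℕ} {g : Segment} (h : Represents E C S)
    (hg : (g = .work ∧ a' = a ∧ a < E.workCells) ∨
        (g = .la ∧ 1 ≤ a' ∧ a' ≤ E.text.length ∧ a + 1 = E.workCells + a') ∨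
        (g = .sa ∧ 1 ≤ a' ∧ a' ≤ E.text.length ∧ a + 1 = E.workCells + E.text.length + a')) :
    C.read E g a' = S.mem a := by
  rcases hg with ⟨rfl, rfl, hw⟩ | ⟨rfl, h1, h2, h3⟩ | ⟨rfl, h1, h2, h3⟩
  · exact h.work _ hw
  · obtain ⟨b, rfl⟩ : ∃ b, a' = b + 1 := ⟨a' - 1, by omega⟩
    rw [Config.read, h.la b (by omega)]
    congr 1; omega
  · obtain ⟨b, rfl⟩ : ∃ b, a' = b + 1 := ⟨a' - 1, by omega⟩
    rw [Config.read, h.sa b (by omega)]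
    congr 1; omega

lemma Represents.flat_write {C : Config 64} {a a' v : ℕ} {g : Segment} (h : Represents E C S)
    (hv : v < E.wordBound)
    (hg : (g = .work ∧ a' = a ∧ a < E.workCells) ∨
        (g = .la ∧ 1 ≤ a' ∧ a' ≤ E.text.length ∧ a + 1 = E.workCells + a') ∨
        (g = .sa ∧ 1 ≤ a' ∧ a' ≤ E.text.length ∧ a + 1 = E.workCells + E.text.length + a')) :
    ∃ C', C.write g a' v = some C' ∧ C'.pc = C.pc ∧ ∀ l, Represents E { C' with pc := l } (S.write a v) := by
  have hm : ∀ b < E.size, Function.update S.mem a v b < E.wordBound := by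
    intro b hb
    by_cases e : b = a
    · subst e; simpa using hv
    · simpa [Function.update_of_ne e] using h.mem_lt b hb
  rcases hg with ⟨rfl, rfl, hw⟩ | ⟨rfl, h1, h2, h3⟩ | ⟨rfl, h1, h2, h3⟩
  · refine ⟨_, rfl, rfl, fun l =>
      { h with work := ?_, la := ?_, sa := ?_, mem_lt := hm }⟩
    · intro b hb
      by_cases e : b = a'
      · subst e; simp
      · simp [Function.update_of_ne e, h.work b hb]
    · intro i hi
      have e : E.workCells + i ≠ a' := by omega
      simp [Function.update_of_ne e, h.la i hi]
    · intro i hi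
      have e : E.workCells + E.text.length + i ≠ a' := by omega
      simp [Function.update_of_ne e, h.sa i hi]
  · refine ⟨_, rfl, rfl, fun l =>
      { h with work := ?_, la := ?_, sa := ?_, mem_lt := hm }⟩
    · intro b hb
      have e : b ≠ a := by omega
      simp [Function.update_of_ne e, h.work b hb]
    · intro i hi
      by_cases e : i + 1 = a'
      · have e' : E.workCells + i = a := by omega
        simp [e, e']
      · have e' : E.workCells + i ≠ a := by omega
        simp [Function.update_of_ne e, Function.update_of_ne e', h.la i hi]
    · intro i hi
      have e : E.workCells + E.text.length + i ≠ a := by omega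
      simp [Function.update_of_ne e, h.sa i hi]
  · refine ⟨_, rfl, rfl, fun l =>
      { h with work := ?_, la := ?_, sa := ?_, mem_lt := hm }⟩
    · intro b hb
      have e : b ≠ a := by omega
      simp [Function.update_of_ne e, h.work b hb]
    · intro i hi
      have e : E.workCells + i ≠ a := by omega
      simp [Function.update_of_ne e, h.la i hi]
    · intro i hi
      by_cases e : i + 1 = a'
      · have e' : E.workCells + E.text.length + i = a := by omega
        simp [e, e']
      · have e' : E.workCells + E.text.length + i ≠ a := by omega
        simp [Function.update_of_ne e, Function.update_of_ne e', h.sa i hi]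

/-- The last clause of `Evaluated` keeps the left operand alive while the right one is computed. All
registers and cells fit into words already and symbols are below σ, so only constants, sums and
products can overflow; this is why `Exp.ok` bounds no other values. -/
lemma Exp.comp_correct (e : Exp) {C : Config 64} {pc d : ℕ} (h : Represents E C S) (hpc : C.pc = pc)
    (hd : d + e.temps ≤ 9) (hok : e.ok E S) (hc : CodeAt code pc (e.comp pc d)) :
    ∃ C', Reach (prog code) E C e.cost C' ∧
      Evaluated E C' S (pc + (e.comp pc d).length) d (e.val E S) C := by
  induction e generalizing C pc d with
  | const v =>
    subst hpc
    have hd : d < 9 := hd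
    exact evaluated_setReg h hd hok (fun _ _ => rfl) hc.1 rfl
  | var x =>
    subst hpc
    have hd : d < 9 := hd
    refine evaluated_setReg h hd ?_ (fun _ _ => rfl) hc.1 ?_
    · rw [Exp.val, ← h.vars]; exact h.reg_lt _
    · simp [Instr.exec, ArithOp.eval, h.vars, h.rZero, Exp.val]
  | bin o a b iha ihb =>
    simp only [Exp.temps] at hd
    simp only [Exp.comp, codeAt_append, List.length_append] at hc ⊢
    obtain ⟨ca, cb, co, -⟩ := hc
    have hab : a.ok E S ∧ b.ok E S := by
      cases o
      · exact ⟨hok.1, hok.2.1⟩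
      · exact hok
      · exact ⟨hok.1, hok.2.1⟩
      · exact hok
    obtain ⟨C1, r1, h1, p1, v1, o1⟩ := iha h hpc (by omega) hab.1 ca
    obtain ⟨C2, r2, h2, p2, v2, o2⟩ := ihb h1 p1 (by omega) hab.2 cb
    have va := h1.reg_lt (tmp d)
    have vb := h2.reg_lt (tmp (d + 1))
    rw [v1] at va
    rw [v2] at vb
    have hv : o.eval (a.val E S) (b.val E S) < E.wordBound := by
      cases o
      · exact hok.2.2
      · exact (Nat.sub_le _ _).trans_lt va
      · exact hok.2.2
      · exact (Nat.div_le_self _ _).trans_lt va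
    have w1 : C2.reg (tmp d) = a.val E S := by rw [o2 d (by omega), v1]
    obtain ⟨C3, r3, h3, p3, v3, o3⟩ := evaluated_setReg (code := code) (C₀ := C) h2 (d := d)
      (by omega) hv (fun d' hd' => by rw [o2 d' (by omega), o1 d' hd'])
      (by rw [p2]; exact co) (by simp only [Instr.exec]; rw [w1, v2])
    exact ⟨C3, (((r1.trans r2).trans r3)), h3, by rw [p3, p2]; simp; omega, v3, o3⟩
  | txt a iha =>
    simp only [Exp.temps] at hd
    simp only [Exp.comp, codeAt_append, List.length_append] at hc ⊢
    obtain ⟨ca, co, -⟩ := hc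
    obtain ⟨C1, r1, h1, p1, v1, o1⟩ := iha h hpc hd hok.1 ca
    have hdd : d < 9 := by
      have : 1 ≤ a.temps := by
        clear * -
        induction a <;> simp_all [Exp.temps]
      omega
    obtain ⟨C3, r3, h3, p3, v3, o3⟩ := evaluated_setReg (code := code) (C₀ := C) h1 (d := d)
      (v := symbolAt E.text (a.val E S)) hdd
      ((symbolAt_lt _ _ hok.2.1 hok.2.2).trans_le h.sigma_le) o1
      (by rw [p1]; exact co)
      (by
        simp only [Instr.exec]
        rw [v1, if_pos (show E.validAddr .text (a.val E S) from hok.2)]; rfl)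
    exact ⟨C3, r1.trans r3, h3, by rw [p3, p1]; simp; omega, v3, o3⟩
  | mem a iha =>
    simp only [Exp.temps] at hd
    simp only [Exp.comp, codeAt_append, List.length_append] at hc ⊢
    obtain ⟨ca, co⟩ := hc
    obtain ⟨C1, r1, h1, p1, v1, o1⟩ := iha h hpc hd hok.1 ca
    have hdd : d < 9 := by
      have : 1 ≤ a.temps := by
        clear * -
        induction a <;> simp_all [Exp.temps]
      omega
    obtain ⟨C2, g, a', r2, h2, i2, v2, va2, o2, e2, hg⟩ := reach_flat h1 hdd p1 v1 hok.2 co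
    obtain ⟨C3, r3, h3, p3, v3, o3⟩ := evaluated_setReg (code := code) (C₀ := C) h2 (d := d)
      (v := S.mem (a.val E S)) hdd (h.mem_lt _ hok.2)
      (fun d' hd' => by rw [o2 _ (tmp_ne hd' hdd), o1 d' hd'])
      i2 (by simp only [Instr.exec]; rw [v2, if_pos va2, h2.flat_read hg])
    obtain ⟨l, r4, hl⟩ := reach_flat_end (code := code) (E := E) p3 e2
    refine ⟨{ C3 with pc := l }, (((r1.trans r2).trans r3).trans r4), h3.pc _, ?_, v3, o3⟩
    show l = _
    rw [hl, flatCode_length]; omega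

lemma compTwo_correct {a b : Exp} {C : Config 64} {pc : ℕ} (h : Represents E C S) (hpc : C.pc = pc)
    (ha : a.temps ≤ 9) (hb : b.temps ≤ 8) (hoa : a.ok E S) (hob : b.ok E S)
    (hc : CodeAt code pc (compTwo a b pc)) :
    ∃ C', Reach (prog code) E C (a.cost + b.cost) C' ∧ Represents E C' S ∧
      C'.pc = pc + (compTwo a b pc).length ∧ C'.reg (tmp 0) = a.val E S ∧
      C'.reg (tmp 1) = b.val E S := by
  obtain ⟨ca, cb⟩ := codeAt_append.1 hc
  obtain ⟨C1, r1, h1, p1, v1, o1⟩ := a.comp_correct h hpc (by omega) hoa ca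
  obtain ⟨C2, r2, h2, p2, v2, o2⟩ := b.comp_correct h1 p1 (by omega) hob cb
  refine ⟨C2, r1.trans r2, h2, ?_, by rw [o2 0 (by omega), v1], v2⟩
  rw [p2, compTwo, List.length_append]; omega

/-- Evaluation of a condition and the conditional jump. -/
lemma Cond.comp_correct (b : Cond) {C : Config 64} {pc l : ℕ} (h : Represents E C S) (hpc : C.pc = pc)
    (hb : b.fits) (hok : b.ok E S) (hc : CodeAt code pc (b.comp pc))
    (hj : code[pc + (b.comp pc).length]? = some (b.jump l)) :
    (b.val E S → ∃ C', Reach (prog code) E C (b.cost - 1) C' ∧ Represents E C' S ∧ C'.pc = l) ∧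
    (¬ b.val E S → ∃ C', Reach (prog code) E C (b.cost - 1) C' ∧ Represents E C' S ∧
      C'.pc = pc + (b.comp pc).length + 1) := by
  cases b with
  | lt x y =>
    obtain ⟨C1, r1, h1, p1, v1, v2⟩ := compTwo_correct h hpc hb.1 hb.2 hok.1 hok.2 hc
    constructor
    · intro hv
      refine ⟨{ C1 with pc := l }, r1.trans (Reach.single (by rw [p1]; exact hj) ?_), h1.pc _, rfl⟩
      have hv : x.val E S < y.val E S := hv
      simp [Cond.jump, Instr.exec, v1, v2, hv]
    · intro hv
      refine ⟨{ C1 with pc := C1.pc + 1 }, r1.trans (Reach.single (by rw [p1]; exact hj) ?_),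
        h1.pc _, by rw [p1]; rfl⟩
      have hv : ¬ x.val E S < y.val E S := hv
      simp [Cond.jump, Instr.exec, v1, v2, hv]
  | eq x y =>
    obtain ⟨C1, r1, h1, p1, v1, v2⟩ := compTwo_correct h hpc hb.1 hb.2 hok.1 hok.2 hc
    constructor
    · intro hv
      refine ⟨{ C1 with pc := l }, r1.trans (Reach.single (by rw [p1]; exact hj) ?_), h1.pc _, rfl⟩
      have hv : x.val E S = y.val E S := hv
      simp [Cond.jump, Instr.exec, v1, v2, hv]
    · intro hv
      refine ⟨{ C1 with pc := C1.pc + 1 }, r1.trans (Reach.single (by rw [p1]; exact hj) ?_),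
        h1.pc _, by rw [p1]; rfl⟩
      have hv : ¬ x.val E S = y.val E S := hv
      simp [Cond.jump, Instr.exec, v1, v2, hv]

lemma Cond.cost_pos (b : Cond) : 2 ≤ b.cost := by cases b <;> simp [Cond.cost]

/-- Forward simulation by induction on the derivation of the run, which already contains its
termination. After the jump back of a loop the machine stands at the same code again, so the
induction hypothesis for the remaining passes applies. -/
theorem Run.comp_correct {c : Stmt} {t : ℕ} {S' : St} (hr : Run E c S t S') {C : Config 64}
    {pc : ℕ} (h : Represents E C S) (hpc : C.pc = pc) (hf : c.fits) (hc : CodeAt code pc (c.comp pc)) :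
    ∃ C', Reach (prog code) E C t C' ∧ Represents E C' S' ∧ C'.pc = pc + (c.comp pc).length := by
  induction hr generalizing C pc with
  | skip S => exact ⟨C, Reach.refl _ _, h, hpc⟩
  | assign x e S hok =>
    obtain ⟨ca, co, -⟩ := codeAt_append.1 hc
    obtain ⟨C1, r1, h1, p1, v1, o1⟩ := e.comp_correct h hpc (d := 0) (by simpa [Stmt.fits] using hf) hok ca
    have hv : e.val E S < E.wordBound := v1 ▸ h1.reg_lt _
    refine ⟨_, r1.trans (Reach.single (by rw [p1]; exact co) (D := { C1 with
      reg := Function.update C1.reg x.idx (e.val E S), pc := C1.pc + 1 }) ?_),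
      h1.setVar x hv, ?_⟩
    · simp [Instr.exec, ArithOp.eval, v1, h1.rZero, Config.setReg, hv]
    · simp [p1, Stmt.comp]; omega
  | put a e S ha he hv =>
    obtain ⟨ca, co⟩ := codeAt_append.1 hc
    obtain ⟨C1, r1, h1, p1, v1, w1⟩ := compTwo_correct h hpc hf.1 hf.2 ha he ca
    obtain ⟨C2, g, a', r2, h2, i2, v2, va2, o2, e2, hg⟩ :=
      reach_flat h1 (d := 0) (by omega) p1 v1 hv co
    have w2 : C2.reg (tmp 1) = e.val E S := by
      rw [o2 _ (by decide), w1]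
    obtain ⟨C3, e3, p3, h3⟩ := h2.flat_write (v := e.val E S) (w2 ▸ h2.reg_lt _) hg
    obtain ⟨l, r4, hl⟩ := reach_flat_end (code := code) (E := E)
      (C := { C3 with pc := C2.pc + 1 }) rfl e2
    refine ⟨_, ((r1.trans r2).trans (Reach.single i2 (D := { C3 with pc := C2.pc + 1 }) ?_)).trans r4
      |>.mono (by omega), h3 _, ?_⟩
    · simp [Instr.exec, v2, va2, w2, e3]
    · show l = _
      rw [hl, Stmt.comp, List.length_append, flatCode_length]; omega
  | seq _ _ ih1 ih2 =>
    obtain ⟨ca, co⟩ := codeAt_append.1 hc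
    obtain ⟨C1, r1, h1, p1⟩ := ih1 h hpc hf.1 ca
    obtain ⟨C2, r2, h2, p2⟩ := ih2 h1 p1 hf.2 co
    exact ⟨C2, r1.trans r2, h2, by rw [p2, Stmt.comp, List.length_append]; omega⟩
  | @iteTrue b c d S t S' hb hv _ ih =>
    obtain ⟨ca, cj, cc⟩ := codeAt_append.1 hc
    obtain ⟨-, cjj, cc⟩ := codeAt_append.1 cc
    have := b.cost_pos
    obtain ⟨C1, r1, h1, p1⟩ := (b.comp_correct h hpc hf.1 hb ca cj).1 hv
    obtain ⟨C2, r2, h2, p2⟩ := ih h1 p1 hf.2.1 cc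
    refine ⟨C2, (r1.trans r2).mono (by omega), h2, ?_⟩
    rw [p2]; simp [Stmt.comp]; omega
  | @iteFalse b c d S t S' hb hv _ ih =>
    obtain ⟨ca, cj, cc⟩ := codeAt_append.1 hc
    obtain ⟨cd, cjj, cc⟩ := codeAt_append.1 cc
    have := b.cost_pos
    obtain ⟨C1, r1, h1, p1⟩ := (b.comp_correct h hpc hf.1 hb ca cj).2 hv
    obtain ⟨C2, r2, h2, p2⟩ := ih h1 p1 hf.2.2 cd
    refine ⟨_, ((r1.trans r2).trans (Reach.single (by rw [p2]; exact cjj) rfl)).mono (by omega),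
      h2.pc _, ?_⟩
    simp [Stmt.comp]; omega
  | @loopFalse b c S hb hv =>
    obtain ⟨ca, cj, cjj, cc⟩ := codeAt_append.1 hc
    have := b.cost_pos
    obtain ⟨C1, r1, h1, p1⟩ := (b.comp_correct h hpc hf.1 hb ca cj).2 hv
    refine ⟨_, (r1.trans (Reach.single (by rw [p1]; exact cjj) rfl)).mono (by omega),
      h1.pc _, ?_⟩
    simp [Stmt.comp]; omega
  | @loopTrue b c S t S' u S'' hb hv _ _ ih1 ih2 =>
    have hc' := hc
    obtain ⟨ca, cj, cjj, cc⟩ := codeAt_append.1 hc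
    obtain ⟨cc, cl, -⟩ := codeAt_append.1 cc
    have := b.cost_pos
    obtain ⟨C1, r1, h1, p1⟩ := (b.comp_correct h hpc hf.1 hb ca cj).1 hv
    obtain ⟨C2, r2, h2, p2⟩ := ih1 h1 p1 hf.2 cc
    have r3 : Reach (prog code) E C2 1 { C2 with pc := pc } :=
      Reach.single (by rw [p2]; exact cl) rfl
    obtain ⟨C3, r3', h3, p3⟩ := ih2 (h2.pc pc) rfl hf hc'
    exact ⟨C3, (((r1.trans r2).trans r3).trans r3').mono (by omega), h3, p3⟩

end

/-! ### Reasoning about structured programs -/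

section
variable {E : Env} {S S' : St} {c d : Stmt} {Q : ℕ → St → Prop} {t : ℕ}

/-- Started in `S` at time `t`, the program `c` ends at a time and in a state that satisfy `Q`. -/
def WP (E : Env) (c : Stmt) (Q : ℕ → St → Prop) (S : St) (t : ℕ) : Prop :=
  ∃ u S', Run E c S u S' ∧ Q (t + u) S'

/-- Started in `S`, the program ends within `B` steps in a state that satisfies `Q`. -/
def Ok (E : Env) (c : Stmt) (S : St) (B : ℕ) (Q : St → Prop) : Prop :=
  WP E c (fun u S' => u ≤ B ∧ Q S') S 0

/-- The variables that a program may change. -/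
def Stmt.writes : Stmt → Var → Bool
  | .skip, _ => false
  | .assign y _, x => x = y
  | .put _ _, _ => false
  | .seq c d, x => c.writes x || d.writes x
  | .ite _ c d, x => c.writes x || d.writes x
  | .loop _ c, x => c.writes x

/-- `S` and `S'` agree on the variables that `c` does not change. -/
def Frame (c : Stmt) (S S' : St) : Prop := ∀ x, c.writes x = false → S'.var x = S.var x

/-- Since `Stmt.writes` computes, the preservation of a particular variable is later checked by
`rfl`, and specifications need to mention only what changes. -/
lemma Run.frame (h : Run E c S t S') : Frame c S S' := by
  induction h with
  | skip S => exact fun _ _ => rfl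
  | assign x e S h => intro y hy; simp [Stmt.writes] at hy; simp [hy]
  | put a e S ha he hv => exact fun _ _ => rfl
  | seq _ _ ih1 ih2 =>
    intro y hy
    simp [Stmt.writes] at hy
    rw [ih2 y hy.2, ih1 y hy.1]
  | iteTrue _ _ _ ih => intro y hy; simp [Stmt.writes] at hy; exact ih y hy.1
  | iteFalse _ _ _ ih => intro y hy; simp [Stmt.writes] at hy; exact ih y hy.2
  | loopFalse _ _ => exact fun _ _ => rfl
  | loopTrue _ _ _ _ ih1 ih2 => intro y hy; rw [ih2 y hy, ih1 y hy]

lemma Frame.refl (c : Stmt) (S : St) : Frame c S S := fun _ _ => rfl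

lemma Frame.trans {S'' : St} (h : Frame c S S') (h' : Frame c S' S'') : Frame c S S'' :=
  fun x hx => (h' x hx).trans (h x hx)

-- Stated as equivalences, this rule and the next ones let `simp` turn loop-free code into its
-- verification conditions.
@[simp] lemma wp_skip : WP E .skip Q S t ↔ Q t S := by
  constructor
  · rintro ⟨u, S', h, hq⟩; cases h; exact hq
  · exact fun h => ⟨_, _, .skip S, h⟩

@[simp] lemma wp_assign {x : Var} {e : Exp} :
    WP E (x ::= e) Q S t ↔ e.ok E S ∧ Q (t + (e.cost + 1)) (S.set x (e.val E S)) := by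
  constructor
  · rintro ⟨u, S', h, hq⟩; cases h with | assign _ _ _ h => exact ⟨h, hq⟩
  · exact fun h => ⟨_, _, .assign x e S h.1, h.2⟩

@[simp] lemma wp_put {a e : Exp} :
    WP E (a ::=ₘ e) Q S t ↔ (a.ok E S ∧ e.ok E S ∧ a.val E S < E.size) ∧
      Q (t + (a.cost + e.cost + 7)) (S.write (a.val E S) (e.val E S)) := by
  constructor
  · rintro ⟨u, S', h, hq⟩; cases h with | put _ _ _ h1 h2 h3 => exact ⟨⟨h1, h2, h3⟩, hq⟩
  · exact fun h => ⟨_, _, .put a e S h.1.1 h.1.2.1 h.1.2.2, h.2⟩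

@[simp] lemma wp_seq :
    WP E (c ;; d) Q S t ↔ WP E c (fun u S' => WP E d Q S' u) S t := by
  constructor
  · rintro ⟨u, S', h, hq⟩
    cases h with
    | seq h1 h2 => exact ⟨_, _, h1, _, _, h2, by rwa [Nat.add_assoc]⟩
  · rintro ⟨u, S', h, v, S'', h', hq⟩
    exact ⟨_, _, .seq h h', by rwa [← Nat.add_assoc]⟩

@[simp] lemma wp_ite {b : Cond} :
    WP E (.ite b c d) Q S t ↔ b.ok E S ∧ (b.val E S → WP E c Q S (t + b.cost)) ∧
      (¬ b.val E S → WP E d Q S (t + b.cost)) := by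
  constructor
  · rintro ⟨u, S', h, hq⟩
    cases h with
    | iteTrue h1 h2 h3 =>
      exact ⟨h1, fun _ => ⟨_, _, h3, by rwa [Nat.add_assoc]⟩, fun h => absurd h2 h⟩
    | iteFalse h1 h2 h3 =>
      exact ⟨h1, fun h => absurd h h2, fun _ => ⟨_, _, h3, by rwa [Nat.add_assoc]⟩⟩
  · rintro ⟨h1, h2, h3⟩
    by_cases hb : b.val E S
    · obtain ⟨u, S', h, hq⟩ := h2 hb
      exact ⟨_, _, .iteTrue h1 hb h, by rwa [← Nat.add_assoc]⟩
    · obtain ⟨u, S', h, hq⟩ := h3 hb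
      exact ⟨_, _, .iteFalse h1 hb h, by rwa [← Nat.add_assoc]⟩

/-- A conditional assignment. -/
lemma wp_unless {b : Cond} {x : Var} {e : Exp} (hb : b.ok E S) (he : ¬ b.val E S → e.ok E S)
    (h : ∀ u v, u ≤ t + b.cost + e.cost + 1 → (b.val E S → v = S.var x) →
      (¬ b.val E S → v = e.val E S) → Q u (S.set x v)) :
    WP E (.ite b .skip (x ::= e)) Q S t := by
  refine wp_ite.2 ⟨hb, fun hv => wp_skip.2 ?_, fun hv => wp_assign.2 ⟨he hv, ?_⟩⟩
  -- Setting `x` to its old value changes nothing. Thus both branches end in some `S.set x v`, and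
  -- the continuation has to be verified only once.
  · have := h (t + b.cost) (S.var x) (by omega) (fun _ => rfl) (fun h => absurd hv h)
    convert this
    ext y
    · by_cases hy : y = x <;> simp [hy]
    · rfl
  · exact h _ _ (by omega) (fun h => absurd h hv) (fun _ => rfl)

/-- Use of a specification. -/
lemma Ok.wp {B : ℕ} {P : St → Prop} (h : Ok E c S B P)
    (hq : ∀ u S', u ≤ t + B → P S' → Frame c S S' → Q u S') : WP E c Q S t := by
  obtain ⟨u, S', hr, hu, h⟩ := h
  exact ⟨u, S', hr, hq _ _ (by omega) h hr.frame⟩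

lemma Ok.mono {B B' : ℕ} {P P' : St → Prop} (h : Ok E c S B P) (hB : B ≤ B')
    (hq : ∀ S', P S' → Frame c S S' → P' S') : Ok E c S B' P' := by
  obtain ⟨u, S', hr, hu, h⟩ := h
  exact ⟨u, S', hr, by omega, hq _ h hr.frame⟩

/-- The general rule for loops, with an invariant on time and state and a measure. -/
lemma wp_loop {b : Cond} (I : ℕ → St → Prop) (μ : St → ℕ) (h0 : I t S)
    (h : ∀ u S', I u S' → Frame c S S' → b.ok E S' ∧
      (b.val E S' → WP E c (fun v S'' => I (v + 1) S'' ∧ μ S'' < μ S') S' (u + b.cost)) ∧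
      (¬ b.val E S' → Q (u + b.cost) S')) :
    WP E (.loop b c) Q S t := by
  obtain ⟨N, hN⟩ : ∃ N, μ S = N := ⟨_, rfl⟩
  have key : ∀ N S' u, μ S' = N → I u S' → Frame c S S' → WP E (.loop b c) Q S' u := by
    intro N
    induction N using Nat.strong_induction_on with
    | _ N ih =>
      intro S' u hN hI hf
      obtain ⟨h1, h2, h3⟩ := h u S' hI hf
      by_cases hb : b.val E S'
      · obtain ⟨v, S'', hr, hI', hμ⟩ := h2 hb
        obtain ⟨w, S3, hr', hq⟩ := ih _ (hN ▸ hμ) S'' _ rfl hI' (hf.trans hr.frame)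
        refine ⟨_, _, .loopTrue h1 hb hr hr', ?_⟩
        convert hq using 1
        omega
      · exact ⟨_, _, .loopFalse h1 hb, h3 hb⟩
  exact key N S t hN h0 (Frame.refl _ _)

/-- `for x := 0, …, y - 1 do c`. -/
def Stmt.forTo (x y : Var) (c : Stmt) : Stmt :=
  x ::= .const 0 ;; .loop (.lt x y) (c ;; x ::= .bin .add x (.const 1))

/-- Each pass adds 9 to the body: four for the test, four for the increment, one for the jump back.
The remaining 6 are two for the initialisation and four for the last test. The invariant refers to
the state after the increment, hence `S''.set x (k + 1)`. -/
lemma ok_forTo {x y : Var} (I : ℕ → St → Prop) (N B : ℕ) (hN : S.var y = N)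
    (hW : N < E.wordBound) (hx : c.writes x = false) (hy : c.writes y = false) (hxy : x ≠ y)
    (h0 : I 0 (S.set x 0))
    (h : ∀ k S', k < N → I k S' → S'.var x = k → Frame (.forTo x y c) S S' →
      WP E c (fun u S'' => u ≤ B ∧ I (k + 1) (S''.set x (k + 1))) S' 0) :
    Ok E (.forTo x y c) S (N * (B + 9) + 6) (fun S' => I N S' ∧ S'.var x = N) := by
  have hyx : y ≠ x := fun h => hxy h.symm
  rw [Ok, Stmt.forTo, wp_seq, wp_assign]
  refine ⟨by simp only [Exp.ok]; omega, ?_⟩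
  refine wp_loop (fun u S' => S'.var x ≤ N ∧ S'.var y = N ∧ I (S'.var x) S' ∧
    Frame (.forTo x y c) S S' ∧ u ≤ 2 + S'.var x * (B + 9)) (fun S' => N - S'.var x) ?_ ?_
  · refine ⟨by simp [Exp.val], by simp [hyx, hN], by simpa [Exp.val] using h0, ?_, by simp [Exp.cost]⟩
    intro z hz
    have : z ≠ x := by
      rintro rfl
      simp [Stmt.forTo, Stmt.writes] at hz
    simp [this]
  · rintro u S' ⟨h1, h2, h3, h4, h5⟩ -
    refine ⟨⟨trivial, trivial⟩, fun hb => ?_, fun hb => ?_⟩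
    · simp only [Cond.val, Exp.val, h2] at hb
      obtain ⟨v, S'', hr, hv, hI⟩ := h _ S' hb h3 rfl h4
      have ex := hr.frame x hx
      have ey := hr.frame y hy
      rw [wp_seq]
      refine ⟨v, S'', hr, ?_⟩
      refine wp_assign.2 ⟨⟨trivial, by simp only [Exp.ok]; omega, ?_⟩, ?_⟩
      · simp only [Exp.val, ex]; omega
      · have e : (S''.set x ((Exp.var x).bin ArithOp.add (Exp.const 1) |>.val E S''))
            = S''.set x (S'.var x + 1) := by simp [Exp.val, ArithOp.eval, ex]
        rw [e]
        refine ⟨⟨by simp; omega, by simp [hyx, ey, h2], by simpa using hI, ?_, ?_⟩, ?_⟩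
        · refine h4.trans fun z hz => ?_
          simp only [Stmt.forTo, Stmt.writes, Bool.or_eq_false_iff] at hz
          have : z ≠ x := by simpa using hz.1
          simp [this, hr.frame z hz.2.1]
        · simp only [Cond.cost, Exp.cost, St.set_var, if_true, Nat.add_mul]
          omega
        · simp; omega
    · simp only [Cond.val, Exp.val, h2] at hb
      have e : S'.var x = N := by omega
      refine ⟨?_, by rwa [e] at h3, e⟩
      rw [e] at h5
      simp only [Cond.cost, Exp.cost]
      omega

end

@[simp] lemma Exp.val_add (E S a b) : (a + b : Exp).val E S = a.val E S + b.val E S := rfl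
@[simp] lemma Exp.val_sub (E S a b) : (a - b : Exp).val E S = a.val E S - b.val E S := rfl
@[simp] lemma Exp.val_mul (E S a b) : (a * b : Exp).val E S = a.val E S * b.val E S := rfl
@[simp] lemma Exp.val_div (E S a b) : (a / b : Exp).val E S = a.val E S / b.val E S := rfl
@[simp] lemma Exp.val_const (E S) (v : ℕ) : (Exp.const v).val E S = v := rfl
@[simp] lemma Exp.val_var (E S x) : (Exp.var x).val E S = S.var x := rfl
@[simp] lemma Exp.val_txt (E S a) : (Exp.txt a).val E S = symbolAt E.text (a.val E S) := rfl
@[simp] lemma Exp.val_mem (E S a) : (Exp.mem a).val E S = S.mem (a.val E S) := rfl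
@[simp] lemma Exp.ok_add (E S a b) : (a + b : Exp).ok E S ↔
    a.ok E S ∧ b.ok E S ∧ a.val E S + b.val E S < E.wordBound := Iff.rfl
@[simp] lemma Exp.ok_sub (E S a b) : (a - b : Exp).ok E S ↔ a.ok E S ∧ b.ok E S := Iff.rfl
@[simp] lemma Exp.ok_mul (E S a b) : (a * b : Exp).ok E S ↔
    a.ok E S ∧ b.ok E S ∧ a.val E S * b.val E S < E.wordBound := Iff.rfl
@[simp] lemma Exp.ok_div (E S a b) : (a / b : Exp).ok E S ↔ a.ok E S ∧ b.ok E S := Iff.rfl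
@[simp] lemma Exp.ok_const (E S) (v : ℕ) : (Exp.const v).ok E S ↔ v < E.wordBound := Iff.rfl
@[simp] lemma Exp.ok_var (E S x) : (Exp.var x).ok E S := trivial
@[simp] lemma Exp.ok_txt (E S a) : (Exp.txt a).ok E S ↔
    a.ok E S ∧ 1 ≤ a.val E S ∧ a.val E S ≤ E.text.length := Iff.rfl
@[simp] lemma Exp.ok_mem (E S a) : (Exp.mem a).ok E S ↔ a.ok E S ∧ a.val E S < E.size := Iff.rfl
@[simp] lemma Exp.cost_add (a b : Exp) : (a + b).cost = a.cost + b.cost + 1 := rfl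
@[simp] lemma Exp.cost_sub (a b : Exp) : (a - b).cost = a.cost + b.cost + 1 := rfl
@[simp] lemma Exp.cost_mul (a b : Exp) : (a * b).cost = a.cost + b.cost + 1 := rfl
@[simp] lemma Exp.cost_div (a b : Exp) : (a / b).cost = a.cost + b.cost + 1 := rfl
@[simp] lemma Exp.cost_const (v : ℕ) : (Exp.const v).cost = 1 := rfl
@[simp] lemma Exp.cost_var (x : Var) : (Exp.var x).cost = 1 := rfl
@[simp] lemma Exp.cost_txt (a : Exp) : (Exp.txt a).cost = a.cost + 1 := rfl
@[simp] lemma Exp.cost_mem (a : Exp) : (Exp.mem a).cost = a.cost + 7 := rfl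
@[simp] lemma Cond.val_lt (E S a b) : (Cond.lt a b).val E S ↔ a.val E S < b.val E S := Iff.rfl
@[simp] lemma Cond.val_eq (E S a b) : (Cond.eq a b).val E S ↔ a.val E S = b.val E S := Iff.rfl
@[simp] lemma Cond.ok_lt (E S a b) : (Cond.lt a b).ok E S ↔ a.ok E S ∧ b.ok E S := Iff.rfl
@[simp] lemma Cond.ok_eq (E S a b) : (Cond.eq a b).ok E S ↔ a.ok E S ∧ b.ok E S := Iff.rfl
@[simp] lemma Cond.cost_lt (a b : Exp) : (Cond.lt a b).cost = a.cost + b.cost + 2 := rfl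
@[simp] lemma Cond.cost_eq (a b : Exp) : (Cond.eq a b).cost = a.cost + b.cost + 2 := rfl

/-! ### Counting sort -/

/-- Stable sorting of the `p` elements at `ia` to `oa`, by the keys `mem[kb + x] ≤ K`, with counters
at `cb`. -/
def countingSort : Stmt :=
  .x0 ::= Exp.var .K + lit(1) ;;
  .forTo .i .x0 (Exp.var .cb + Exp.var .i ::=ₘ lit(0)) ;;
  .forTo .i .p (
    .x ::= .mem (Exp.var .kb + .mem (Exp.var .ia + Exp.var .i)) ;;
    Exp.var .cb + Exp.var .x ::=ₘ .mem (Exp.var .cb + Exp.var .x) + lit(1)) ;;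
  .y ::= lit(0) ;;
  .forTo .i .x0 (
    .x ::= .mem (Exp.var .cb + Exp.var .i) ;;
    Exp.var .cb + Exp.var .i ::=ₘ Exp.var .y ;;
    .y ::= Exp.var .y + Exp.var .x) ;;
  .forTo .i .p (
    .z ::= .mem (Exp.var .ia + Exp.var .i) ;;
    .x ::= .mem (Exp.var .kb + Exp.var .z) ;;
    .y ::= .mem (Exp.var .cb + Exp.var .x) ;;
    Exp.var .oa + Exp.var .y ::=ₘ Exp.var .z ;;
    Exp.var .cb + Exp.var .x ::=ₘ Exp.var .y + lit(1))

/-! #### Positions in a stably sorted sequence -/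

section
variable (κ : ℕ → ℕ)

/-- The position of the `i`-th element in the stable sorting of `κ 0, …, κ (p - 1)`. -/
def sortPos (p i : ℕ) : ℕ := Nat.count (fun j => κ j < κ i) p + Nat.count (fun j => κ j = κ i) i

lemma count_lt_succ (v p : ℕ) : Nat.count (fun j => κ j < v + 1) p =
    Nat.count (fun j => κ j < v) p + Nat.count (fun j => κ j = v) p := by
  induction p with
  | zero => simp
  | succ p ih =>
    simp only [Nat.count_succ, ih]
    split_ifs <;> omega

lemma count_lt_mono {v w : ℕ} (h : v ≤ w) (p : ℕ) :
    Nat.count (fun j => κ j < v) p ≤ Nat.count (fun j => κ j < w) p := by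
  induction p with
  | zero => simp
  | succ p ih =>
    simp only [Nat.count_succ]
    split_ifs <;> omega

lemma count_eq_lt {p i : ℕ} (h : i < p) :
    Nat.count (fun j => κ j = κ i) i < Nat.count (fun j => κ j = κ i) p :=
  Nat.count_strict_mono (p := fun j => κ j = κ i) rfl h

lemma sortPos_lt {p i : ℕ} (h : i < p) : sortPos κ p i < p := by
  have h1 := count_eq_lt κ h
  have h2 := count_lt_succ κ (κ i) p
  have h3 : Nat.count (fun j => κ j < κ i + 1) p ≤ p := Nat.count_le _
  unfold sortPos
  omega

/-- If κ i < κ j, the first summand for j counts all elements with key at most κ i, and i lies among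
them. For equal keys only the second summand differs. -/
lemma sortPos_lt_sortPos {p i j : ℕ} (hi : i < p)
    (h : κ i < κ j ∨ κ i = κ j ∧ i < j) : sortPos κ p i < sortPos κ p j := by
  unfold sortPos
  rcases h with h | ⟨h, hij⟩
  · have h1 := count_eq_lt κ hi
    have h2 := count_lt_succ κ (κ i) p
    have h3 := count_lt_mono κ (show κ i + 1 ≤ κ j from h) p
    omega
  · have := count_eq_lt κ hij
    simp only [h] at this ⊢
    omega

lemma sortPos_inj {p i j : ℕ} (hi : i < p) (hj : j < p) (h : sortPos κ p i = sortPos κ p j) :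
    i = j := by
  by_contra hne
  have h1 := fun h => sortPos_lt_sortPos κ (j := j) hi h
  have h2 := fun h => sortPos_lt_sortPos κ (j := i) hj h
  omega

lemma exists_sortPos_eq {p u : ℕ} (hu : u < p) : ∃ i < p, sortPos κ p i = u := by
  have := Finset.surjOn_of_injOn_of_card_le (s := Finset.range p) (t := Finset.range p)
    (sortPos κ p) (fun i hi => by simpa using sortPos_lt κ (by simpa using hi))
    (fun i hi j hj h => sortPos_inj κ (by simpa using hi) (by simpa using hj) h) le_rfl
  obtain ⟨i, hi, h⟩ := this (by simpa using hu)
  exact ⟨i, by simpa using hi, h⟩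

end

/-- `b` arranges the `p` elements of `a` in the order of their keys, stably. -/
def StablySorts (p : ℕ) (key a b : ℕ → ℕ) : Prop :=
  ∃ π : ℕ → ℕ, (∀ u < p, π u < p ∧ b u = a (π u)) ∧
    (∀ u v, u < v → v < p →
      key (a (π u)) < key (a (π v)) ∨ key (a (π u)) = key (a (π v)) ∧ π u < π v) ∧
    ∀ i < p, ∃ u < p, π u = i

/-- The required permutation is the inverse of `sortPos`. -/
lemma stablySorts_of_sortPos {p : ℕ} {key a b : ℕ → ℕ}
    (h : ∀ i < p, b (sortPos (fun i => key (a i)) p i) = a i) : StablySorts p key a b := by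
  set κ := fun i => key (a i)
  have hs : ∀ u, ∃ i, u < p → i < p ∧ sortPos κ p i = u := fun u => by
    by_cases hu : u < p
    · obtain ⟨i, h1, h2⟩ := exists_sortPos_eq κ hu
      exact ⟨i, fun _ => ⟨h1, h2⟩⟩
    · exact ⟨0, fun h => absurd h hu⟩
  choose π hπ using hs
  refine ⟨π, fun u hu => ⟨(hπ u hu).1, ?_⟩, fun u v huv hv => ?_, fun i hi => ?_⟩
  · have := h _ (hπ u hu).1
    rwa [(hπ u hu).2] at this
  · obtain ⟨h1, h2⟩ := hπ u (by omega)
    obtain ⟨h3, h4⟩ := hπ v hv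
    by_contra hc
    have : κ (π v) < κ (π u) ∨ κ (π v) = κ (π u) ∧ π v < π u ∨ π u = π v := by
      simp only [κ]; omega
    rcases this with h5 | h5 | h5
    · have := sortPos_lt_sortPos κ h3 (Or.inl h5); omega
    · have := sortPos_lt_sortPos κ h3 (Or.inr h5); omega
    · rw [h5] at h2; omega
  · exact ⟨sortPos κ p i, sortPos_lt κ hi,
      sortPos_inj κ (hπ _ (sortPos_lt κ hi)).1 hi (hπ _ (sortPos_lt κ hi)).2⟩

lemma StablySorts.mem {p : ℕ} {key a b : ℕ → ℕ} (h : StablySorts p key a b) {u : ℕ} (hu : u < p) :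
    ∃ i < p, b u = a i := by
  obtain ⟨π, h1, -, -⟩ := h
  exact ⟨π u, h1 u hu⟩

lemma StablySorts.mem' {p : ℕ} {key a b : ℕ → ℕ} (h : StablySorts p key a b) {i : ℕ} (hi : i < p) :
    ∃ u < p, b u = a i := by
  obtain ⟨π, h1, -, h3⟩ := h
  obtain ⟨u, hu, e⟩ := h3 i hi
  exact ⟨u, hu, by rw [(h1 u hu).2, e]⟩

/-- Sorting refines a previous order. -/
lemma StablySorts.sorted {p : ℕ} {key a b : ℕ → ℕ} (h : StablySorts p key a b) {R : ℕ → ℕ → Prop}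
    (hR : ∀ i j, i < j → j < p → R (a i) (a j)) {u v : ℕ} (huv : u < v) (hv : v < p) :
    key (b u) < key (b v) ∨ key (b u) = key (b v) ∧ R (b u) (b v) := by
  obtain ⟨π, h1, h2, h3⟩ := h
  rw [(h1 u (by omega)).2, (h1 v hv).2]
  rcases h2 u v huv hv with h | h
  · exact Or.inl h
  · exact Or.inr ⟨h.1, hR _ _ h.2 (h1 v hv).1⟩

/-- The counting sort is correct and takes linear time. -/
lemma ok_countingSort {E : Env} {S : St} {p ia oa kb cb K : ℕ} (a key : ℕ → ℕ)
    (hp : S.var .p = p) (hia : S.var .ia = ia) (hoa : S.var .oa = oa) (hkb : S.var .kb = kb)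
    (hcb : S.var .cb = cb) (hK : S.var .K = K)
    (ha : ∀ i < p, S.mem (ia + i) = a i)
    (hkey : ∀ i < p, S.mem (kb + a i) = key (a i) ∧ key (a i) ≤ K ∧ kb + a i < ia ∧ kb + a i < oa)
    (hdis : ia + p ≤ oa ∨ oa + p ≤ ia) (hic : ia + p ≤ cb) (hoc : oa + p ≤ cb)
    (hsz : cb + K + 1 ≤ E.size) (hW : E.size + 10 ≤ E.wordBound) :
    Ok E countingSort S (200 * (p + K + 1)) (fun S' =>
      (∀ x, (x < oa ∨ oa + p ≤ x) → (x < cb ∨ cb + K < x) → S'.mem x = S.mem x) ∧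
      StablySorts p key a (fun u => S'.mem (oa + u))) := by
  set κ := fun i => key (a i) with hκ
  rw [Ok, countingSort]
  simp only [wp_seq, wp_assign]
  refine ⟨by simp; omega, ?_⟩
  -- clear the counters
  refine Ok.wp (ok_forTo (N := K + 1) (B := 12) (I := fun k S' =>
    (∀ v < k, S'.mem (cb + v) = 0) ∧ ∀ x, (x < cb ∨ cb + K < x) → S'.mem x = S.mem x)
    (by simp [hK]) (by omega) rfl rfl (by decide) (by simp) ?_) ?_
  · rintro k S1 hk ⟨h1, h2⟩ hi hf
    have e1 : S1.var .cb = cb := by rw [hf _ rfl]; simp [hcb]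
    simp only [wp_put]
    refine ⟨by simp [e1, hi]; omega, by simp, fun v hv => ?_, fun x hx => ?_⟩
    · simp only [e1, hi, St.set_mem, St.write_mem, Exp.val_add, Exp.val_var, Exp.val_const,
        Function.update_apply, Nat.add_left_cancel_iff]
      split_ifs with h
      · rfl
      · exact h1 v (by omega)
    · have : x ≠ cb + k := by omega
      simp [e1, hi, this, h2 x hx]
  rintro u1 S1 hu1 ⟨⟨z1, m1⟩, -⟩ f1
  have e1 : S1.var .p = p := by rw [f1 _ rfl]; simp [hp]
  have ecb : S1.var .cb = cb := by rw [f1 _ rfl]; simp [hcb]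
  have eia : S1.var .ia = ia := by rw [f1 _ rfl]; simp [hia]
  have eoa : S1.var .oa = oa := by rw [f1 _ rfl]; simp [hoa]
  have ekb : S1.var .kb = kb := by rw [f1 _ rfl]; simp [hkb]
  have ex0 : S1.var .x0 = K + 1 := by rw [f1 _ rfl]; simp [hK]
  -- count
  refine Ok.wp (ok_forTo (N := p) (B := 50) (I := fun k S' =>
    (∀ v ≤ K, S'.mem (cb + v) = Nat.count (fun j => κ j = v) k) ∧
      ∀ x, (x < cb ∨ cb + K < x) → S'.mem x = S.mem x)
    e1 (by omega) rfl rfl (by decide)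
    ⟨fun v hv => by simpa using z1 v (by omega), fun x hx => by simpa using m1 x hx⟩ ?_) ?_
  · rintro k S2 hk ⟨h1, h2⟩ hi hf
    have g1 : S2.var .cb = cb := by rw [hf _ rfl, ecb]
    have g2 : S2.var .ia = ia := by rw [hf _ rfl, eia]
    have g3 : S2.var .kb = kb := by rw [hf _ rfl, ekb]
    obtain ⟨k1, k2, k3, k4⟩ := hkey k hk
    have v1 : S2.mem (ia + k) = a k := by rw [h2 _ (by omega), ha k hk]
    have v2 : S2.mem (kb + a k) = key (a k) := by rw [h2 _ (by omega), k1]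
    have v3 := h1 _ k2
    have v4 : Nat.count (fun j => κ j = key (a k)) k ≤ k := Nat.count_le _
    simp only [wp_seq, wp_put, wp_assign]
    simp only [Exp.ok_mem, Exp.ok_add, Exp.ok_var, Exp.val_add, Exp.val_var, Exp.val_mem, g1, g2, g3, hi, v1,
      v2, St.set_var, St.set_mem, reduceCtorEq, if_true, if_false, v3, Exp.ok_const, Exp.val_const,
      true_and]
    refine ⟨by omega, by omega, by simp, fun v hv => ?_, fun x hx => ?_⟩
    · simp only [St.set_mem, St.write_mem, Function.update_apply, Nat.add_left_cancel_iff,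
        Nat.count_succ]
      split_ifs with h h' h'
      · subst h; rfl
      · exact absurd h.symm h'
      · exact absurd h'.symm h
      · exact h1 v hv
    · have : x ≠ cb + key (a k) := by omega
      simp [this, h2 x hx]
  rintro u2 S2 hu2 ⟨⟨z2, m2⟩, -⟩ f2
  have g1 : S2.var .p = p := by rw [f2 _ rfl, e1]
  have g2 : S2.var .cb = cb := by rw [f2 _ rfl, ecb]
  have g3 : S2.var .ia = ia := by rw [f2 _ rfl, eia]
  have g4 : S2.var .oa = oa := by rw [f2 _ rfl, eoa]
  have g5 : S2.var .kb = kb := by rw [f2 _ rfl, ekb]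
  have g6 : S2.var .x0 = K + 1 := by rw [f2 _ rfl, ex0]
  refine ⟨by simp; omega, ?_⟩
  -- prefix sums
  refine Ok.wp (ok_forTo (N := K + 1) (B := 50) (I := fun k S' =>
    S'.var .y = Nat.count (fun j => κ j < k) p ∧
    (∀ v, k ≤ v → v ≤ K → S'.mem (cb + v) = Nat.count (fun j => κ j = v) p) ∧
    (∀ v, v < k → S'.mem (cb + v) = Nat.count (fun j => κ j < v) p) ∧
      ∀ x, (x < cb ∨ cb + K < x) → S'.mem x = S.mem x)
    (by simp [g6]) (by omega) rfl rfl (by decide)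
    ⟨by simp, fun v _ hv => by simpa using z2 v hv, by simp, fun x hx => by simpa using m2 x hx⟩
    ?_) ?_
  · rintro k S3 hk ⟨h0, h1, h2, h3⟩ hi hf
    have q1 : S3.var .cb = cb := by rw [hf _ rfl]; simp [g2]
    have q2 := h1 k le_rfl (by omega)
    have q3 := count_lt_succ κ k p
    have q4 : Nat.count (fun j => κ j < k + 1) p ≤ p := Nat.count_le _
    simp only [wp_seq, wp_put, wp_assign]
    simp only [Exp.ok_mem, Exp.ok_add, Exp.ok_var, Exp.val_add, Exp.val_var, Exp.val_mem, q1, hi, h0,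
      q2, St.set_var, St.set_mem, St.write_var, reduceCtorEq, if_true, if_false, true_and]
    refine ⟨by omega, by omega, by omega, by simp, by rw [q3], ?_, ?_, ?_⟩
    · intro v hv hv'
      have : cb + v ≠ cb + k := by omega
      simp [Function.update_apply, h1 v (by omega) hv']
      omega
    · intro v hv
      simp only [St.write_mem, Function.update_apply, Nat.add_left_cancel_iff]
      split_ifs with h
      · rw [h]
      · exact h2 v (by omega)
    · intro x hx
      have : x ≠ cb + k := by omega
      simp [this, h3 x hx]
  rintro u3 S3 hu3 ⟨⟨-, -, z3, m3⟩, -⟩ f3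
  have q1 : S3.var .p = p := by rw [f3 _ rfl]; simp [g1]
  have q2 : S3.var .cb = cb := by rw [f3 _ rfl]; simp [g2]
  have q3 : S3.var .ia = ia := by rw [f3 _ rfl]; simp [g3]
  have q4 : S3.var .oa = oa := by rw [f3 _ rfl]; simp [g4]
  have q5 : S3.var .kb = kb := by rw [f3 _ rfl]; simp [g5]
  -- distribute
  refine Ok.wp (ok_forTo (N := p) (B := 80) (I := fun k S' =>
    (∀ v ≤ K, S'.mem (cb + v) =
      Nat.count (fun j => κ j < v) p + Nat.count (fun j => κ j = v) k) ∧
    (∀ i < k, S'.mem (oa + sortPos κ p i) = a i) ∧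
      ∀ x, (x < oa ∨ oa + p ≤ x) → (x < cb ∨ cb + K < x) → S'.mem x = S.mem x)
    q1 (by omega) rfl rfl (by decide)
    ⟨fun v hv => by simpa using z3 v (by omega), by simp, fun x _ hx => by simpa using m3 x hx⟩
    ?_) ?_
  · rintro k S4 hk ⟨h1, h2, h3⟩ hi hf
    have r1 : S4.var .cb = cb := by rw [hf _ rfl, q2]
    have r2 : S4.var .ia = ia := by rw [hf _ rfl, q3]
    have r3 : S4.var .kb = kb := by rw [hf _ rfl, q5]
    have r4 : S4.var .oa = oa := by rw [hf _ rfl, q4]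
    obtain ⟨k1, k2, k3, k4⟩ := hkey k hk
    have v1 : S4.mem (ia + k) = a k := by rw [h3 _ (by omega) (by omega), ha k hk]
    have v2 : S4.mem (kb + a k) = key (a k) := by rw [h3 _ (by omega) (by omega), k1]
    -- The counter of a key holds the number of smaller keys plus the number of equal keys already
    -- placed, which is the stable position of the current element.
    have v3 : S4.mem (cb + key (a k)) = sortPos κ p k := h1 _ k2
    have v4 := sortPos_lt κ hk
    simp only [wp_seq, wp_put, wp_assign]
    simp only [Exp.ok_mem, Exp.ok_add, Exp.ok_var, Exp.val_add, Exp.val_var, Exp.val_mem, r1, r2, r3, r4, hi,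
      v1, v2, St.set_var, St.set_mem, St.write_var, reduceCtorEq, if_true, if_false, v3, Exp.ok_const,
      Exp.val_const, true_and]
    refine ⟨by omega, by omega, by omega, by omega, by omega, by simp, ?_, ?_, ?_⟩
    · intro v hv
      have : cb + v ≠ oa + sortPos κ p k := by omega
      simp only [St.set_mem, St.write_mem, Function.update_apply, Nat.add_left_cancel_iff, this, if_false,
        Nat.count_succ]
      split_ifs with h h' h'
      · subst h; rfl
      · exact absurd h.symm h'
      · exact absurd h'.symm h
      · exact h1 v hv
    · intro i hik
      have w1 := sortPos_lt κ (show i < p by omega)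
      have : oa + sortPos κ p i ≠ cb + key (a k) := by omega
      simp only [St.set_mem, St.write_mem, Function.update_apply, Nat.add_left_cancel_iff, this, if_false]
      split_ifs with h
      · rw [sortPos_inj κ (by omega) hk h]
      · refine h2 i ?_
        rcases Nat.lt_succ_iff_lt_or_eq.1 hik with h' | h'
        · exact h'
        · exact absurd (by rw [h']) h
    · intro x hx hx'
      have w1 : x ≠ cb + key (a k) := by omega
      have w2 : x ≠ oa + sortPos κ p k := by omega
      simp [w1, w2, h3 x hx hx']
  rintro u4 S4 hu4 ⟨⟨-, z4, m4⟩, -⟩ f4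
  refine ⟨?_, m4, stablySorts_of_sortPos z4⟩
  simp at hu1 hu2 hu3 hu4
  omega

/-! ### Suffix order of zero-padded sequences and the reduction to two thirds -/

/-- The suffix of `s` at `i` is lexicographically smaller than the suffix at `j`. -/
def SufLt (s : ℕ → ℕ) (i j : ℕ) : Prop :=
  ∃ k, (∀ l < k, s (i + l) = s (j + l)) ∧ s (i + k) < s (j + k)

/-- `s` is positive on `0, …, m - 1` and zero afterwards. -/
structure Padded (s : ℕ → ℕ) (m : ℕ) : Prop where
  pos : ∀ i < m, 0 < s i
  zero : ∀ i, m ≤ i → s i = 0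

section
variable {s : ℕ → ℕ} {m : ℕ}

lemma SufLt.irrefl (i : ℕ) : ¬ SufLt s i i := fun ⟨_, _, h⟩ => lt_irrefl _ h

lemma SufLt.trans {i j k : ℕ} (h : SufLt s i j) (h' : SufLt s j k) : SufLt s i k := by
  obtain ⟨a, h1, h2⟩ := h
  obtain ⟨b, h3, h4⟩ := h'
  rcases lt_trichotomy a b with h | h | h
  · exact ⟨a, fun l hl => (h1 l hl).trans (h3 l (by omega)), by rw [← h3 a h]; exact h2⟩
  · subst h
    exact ⟨a, fun l hl => (h1 l hl).trans (h3 l hl), h2.trans h4⟩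
  · exact ⟨b, fun l hl => (h1 l (by omega)).trans (h3 l hl), by rw [h1 b h]; exact h4⟩

lemma SufLt.asymm {i j : ℕ} (h : SufLt s i j) : ¬ SufLt s j i :=
  fun h' => SufLt.irrefl i (h.trans h')

lemma SufLt.ne {i j : ℕ} (h : SufLt s i j) : i ≠ j := by
  rintro rfl; exact SufLt.irrefl i h

lemma sufLt_iff {i j : ℕ} :
    SufLt s i j ↔ s i < s j ∨ s i = s j ∧ SufLt s (i + 1) (j + 1) := by
  constructor
  · rintro ⟨k, h1, h2⟩
    cases k with
    | zero => exact Or.inl h2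
    | succ k =>
      refine Or.inr ⟨h1 0 (by omega), k, fun l hl => ?_, ?_⟩
      · have := h1 (l + 1) (by omega)
        rwa [show i + 1 + l = i + (l + 1) by omega, show j + 1 + l = j + (l + 1) by omega]
      · rwa [show i + 1 + k = i + (k + 1) by omega, show j + 1 + k = j + (k + 1) by omega]
  · rintro (h | ⟨h, k, h1, h2⟩)
    · exact ⟨0, by simp, h⟩
    · refine ⟨k + 1, fun l hl => ?_, ?_⟩
      · cases l with
        | zero => exact h
        | succ l =>
          have := h1 l (by omega)
          rwa [show i + 1 + l = i + (l + 1) by omega, show j + 1 + l = j + (l + 1) by omega] at this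
      · rwa [show i + 1 + k = i + (k + 1) by omega, show j + 1 + k = j + (k + 1) by omega] at h2

lemma exists_first_ne {i j : ℕ} (h : ∃ l, s (i + l) ≠ s (j + l)) : SufLt s i j ∨ SufLt s j i := by
  classical
  have h1 := Nat.find_spec h
  have h2 : ∀ l < Nat.find h, s (i + l) = s (j + l) := fun l hl => by
    have := Nat.find_min h hl
    simpa using this
  rcases lt_or_gt_of_ne h1 with h3 | h3
  · exact Or.inl ⟨_, h2, h3⟩
  · exact Or.inr ⟨_, fun l hl => (h2 l hl).symm, h3⟩

/-- The suffix that starts later is the first to reach the padding: at offset m - j it shows 0 and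
the other one still a positive symbol. -/
lemma Padded.total_aux (hs : Padded s m) {i j : ℕ} (hij : i < j) (hi : i < m) :
    SufLt s i j ∨ SufLt s j i := by
  refine exists_first_ne ⟨m - j, ?_⟩
  have h1 := hs.zero (j + (m - j)) (by omega)
  have h2 := hs.pos (i + (m - j)) (by omega)
  omega

lemma Padded.total (hs : Padded s m) {i j : ℕ} (hij : i ≠ j) (h : i < m ∨ j < m) :
    SufLt s i j ∨ SufLt s j i := by
  rcases lt_or_gt_of_ne hij with h' | h'
  · exact hs.total_aux h' (by omega)
  · exact (hs.total_aux h' (by omega)).symm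

lemma Padded.lt_of_sufLt (hs : Padded s m) {i j : ℕ} (h : SufLt s i j) : j < m := by
  obtain ⟨k, -, hk⟩ := h
  by_contra hj
  rw [hs.zero (j + k) (by omega)] at hk
  omega

/-- Three consecutive symbols, in lexicographic order. -/
def tri (s : ℕ → ℕ) (x : ℕ) : ℕ ×ₗ ℕ ×ₗ ℕ := toLex (s x, toLex (s (x + 1), s (x + 2)))

lemma tri_lt_iff {x y : ℕ} : tri s x < tri s y ↔
    s x < s y ∨ s x = s y ∧ (s (x + 1) < s (y + 1) ∨ s (x + 1) = s (y + 1) ∧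
      s (x + 2) < s (y + 2)) := by
  simp [tri, Prod.Lex.toLex_lt_toLex]

lemma tri_eq_iff {x y : ℕ} : tri s x = tri s y ↔
    s x = s y ∧ s (x + 1) = s (y + 1) ∧ s (x + 2) = s (y + 2) := by
  simp [tri]

/-- The length of the reduced string. -/
def redLen (m : ℕ) : ℕ := (m + 2) / 3 + m / 3

/-- The position of the `u`-th triple. -/
def samplePos (m u : ℕ) : ℕ := if u < (m + 2) / 3 then 3 * u + 1 else 3 * (u - (m + 2) / 3) + 2

/-- The number of the triple at position `x`. -/
def sampleIdx (m x : ℕ) : ℕ := if x % 3 = 1 then x / 3 else (m + 2) / 3 + x / 3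

/-! ### The sample positions and the reduced string -/

lemma sampleIdx_samplePos (m u : ℕ) : sampleIdx m (samplePos m u) = u := by
  unfold sampleIdx samplePos
  split_ifs <;> omega

lemma samplePos_inj {u v : ℕ} (h : samplePos m u = samplePos m v) : u = v := by
  rw [← sampleIdx_samplePos m u, h, sampleIdx_samplePos]

/-- Equality occurs: for m ≡ 1 mod 3 the first class contains the empty suffix at m. Its zero triple
separates the two classes in the reduced string, and it gives every multiple of three below m a
successor in the sample. -/
lemma samplePos_le {u : ℕ} (h : u < redLen m) : samplePos m u ≤ m := by
  unfold samplePos redLen at *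
  split_ifs <;> omega

lemma samplePos_mod (m u : ℕ) : samplePos m u % 3 ≠ 0 := by
  unfold samplePos
  split_ifs <;> omega

/-- The string `r` of the ranks of the triples of `s`. -/
structure IsReduction (s : ℕ → ℕ) (m : ℕ) (r : ℕ → ℕ) : Prop where
  padded : Padded r (redLen m)
  lt : ∀ u v, u < redLen m → v < redLen m →
    tri s (samplePos m u) < tri s (samplePos m v) → r u < r v
  eq : ∀ u v, u < redLen m → v < redLen m →
    tri s (samplePos m u) = tri s (samplePos m v) → r u = r v

/-- A mismatch within three symbols shows in the names of the triples. If it comes later, the two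
triples agree and are free of padding, the next triples of the same classes start three places
further on, and the offset drops by three. The case `u = redLen m`, the end of the reduced string,
is needed for the induction. -/
lemma IsReduction.sufLt_aux {r : ℕ → ℕ} (hr : IsReduction s m r) (hs : Padded s m) (k : ℕ) :
    ∀ u v, u ≤ redLen m → v < redLen m →
      (∀ l < k, s (samplePos m u + l) = s (samplePos m v + l)) →
      s (samplePos m u + k) < s (samplePos m v + k) → SufLt r u v := by
  induction k using Nat.strong_induction_on with
  | _ k ih =>
    intro u v hu hv h1 h2
    rcases Nat.lt_or_ge u (redLen m) with hu' | hu'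
    swap
    · refine ⟨0, by simp, ?_⟩
      have := hr.padded.pos v hv
      have := hr.padded.zero u hu'
      simpa using by omega
    rcases Nat.lt_or_ge k 3 with hk | hk
    · refine ⟨0, by simp, hr.lt u v hu' hv ?_⟩
      rw [tri_lt_iff]
      have a0 := h1 0
      have a1 := h1 1
      simp only [Nat.add_zero] at a0
      interval_cases k
      · exact Or.inl h2
      · exact Or.inr ⟨a0 (by omega), Or.inl h2⟩
      · exact Or.inr ⟨a0 (by omega), Or.inr ⟨a1 (by omega), h2⟩⟩
    · have a0 := h1 0 (by omega)
      have a1 := h1 1 (by omega)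
      have a2 := h1 2 (by omega)
      simp only [Nat.add_zero] at a0
      have hvm : samplePos m v + k < m := by
        by_contra hc
        rw [hs.zero (samplePos m v + k) (by omega)] at h2
        omega
      have hum : samplePos m u + 2 < m := by
        by_contra hc
        rw [hs.zero (samplePos m u + 2) (by omega)] at a2
        have := hs.pos (samplePos m v + 2) (by omega)
        omega
      -- Whatever m is mod 3, the last triple of the first class reaches into the padding. So u is
      -- not that triple, and u + 1 does not cross into the other class.
      have eu : samplePos m (u + 1) = samplePos m u + 3 := by
        unfold samplePos redLen at *
        split_ifs at * <;> omega
      have ev : samplePos m (v + 1) = samplePos m v + 3 := by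
        unfold samplePos redLen at *
        split_ifs at * <;> omega
      have hv1 : v + 1 < redLen m := by
        clear ih h1 h2 a0 a1 a2 eu ev
        unfold samplePos redLen at *
        split_ifs at * <;> omega
      obtain ⟨q, rfl⟩ : ∃ q, k = q + 3 := ⟨k - 3, by omega⟩
      refine sufLt_iff.2 (Or.inr ⟨hr.eq u v hu' hv (tri_eq_iff.2 ⟨a0, a1, a2⟩), ?_⟩)
      refine ih q (by omega) (u + 1) (v + 1) (by omega) hv1 (fun l hl => ?_) ?_
      · rw [eu, ev, show samplePos m u + 3 + l = samplePos m u + (l + 3) by omega,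
          show samplePos m v + 3 + l = samplePos m v + (l + 3) by omega]
        exact h1 _ (by omega)
      · rw [eu, ev, show samplePos m u + 3 + q = samplePos m u + (q + 3) by omega,
          show samplePos m v + 3 + q = samplePos m v + (q + 3) by omega]
        exact h2

lemma IsReduction.sufLt {r : ℕ → ℕ} (hr : IsReduction s m r) (hs : Padded s m) {u v : ℕ}
    (hu : u ≤ redLen m) (hv : v < redLen m) (h : SufLt s (samplePos m u) (samplePos m v)) :
    SufLt r u v := by
  obtain ⟨k, h1, h2⟩ := h
  exact hr.sufLt_aux hs k u v hu hv h1 h2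

lemma IsReduction.sufLt_of_sufLt {r : ℕ → ℕ} (hr : IsReduction s m r) (hs : Padded s m) {u v : ℕ}
    (hu : u < redLen m) (hv : v < redLen m) (h : SufLt r u v) :
    SufLt s (samplePos m u) (samplePos m v) := by
  have hne : samplePos m u ≠ samplePos m v := fun e => h.ne (samplePos_inj e)
  have h1 := samplePos_le hu
  have h2 := samplePos_le hv
  rcases hs.total hne (by omega) with h3 | h3
  · exact h3
  · exact absurd (hr.sufLt hs hv.le hu h3) h.asymm

/-- `A` lists the suffixes of `s` in increasing order. -/
structure SortsSuffixes (s : ℕ → ℕ) (m : ℕ) (A : ℕ → ℕ) : Prop where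
  lt : ∀ k < m, A k < m
  sorted : ∀ i j, i < j → j < m → SufLt s (A i) (A j)

lemma SortsSuffixes.inj {A : ℕ → ℕ} (h : SortsSuffixes s m A) {i j : ℕ} (hi : i < m) (hj : j < m)
    (e : A i = A j) : i = j := by
  rcases lt_trichotomy i j with h' | h' | h'
  · exact absurd e (h.sorted i j h' hj).ne
  · exact h'
  · exact absurd e.symm (h.sorted j i h' hi).ne

lemma SortsSuffixes.surj {A : ℕ → ℕ} (h : SortsSuffixes s m A) {x : ℕ} (hx : x < m) :
    ∃ i < m, A i = x := by
  have := Finset.surjOn_of_injOn_of_card_le (s := Finset.range m) (t := Finset.range m)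
    A (fun i hi => by simpa using h.lt i (by simpa using hi))
    (fun i hi j hj e => h.inj (by simpa using hi) (by simpa using hj) e) le_rfl
  obtain ⟨i, hi, e⟩ := this (by simpa using hx)
  exact ⟨i, by simpa using hi, e⟩

/-- `rk` holds the ranks of the suffixes of the reduced string. -/
structure IsRank (m' : ℕ) (A rk : ℕ → ℕ) : Prop where
  rank : ∀ t < m', rk (A t) = t + 1
  pad : rk m' = 0

/-! ### Ranks of the sample suffixes and comparisons by rank -/

section
variable {r A rk : ℕ → ℕ}

lemma rank_lt_of_sufLt (hr : IsReduction s m r) (hs : Padded s m)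
    (hA : SortsSuffixes r (redLen m) A) (hrk : IsRank (redLen m) A rk) {u v : ℕ}
    (hu : u ≤ redLen m) (hv : v < redLen m) (h : SufLt s (samplePos m u) (samplePos m v)) :
    rk u < rk v := by
  obtain ⟨j, hj, rfl⟩ := hA.surj hv
  rw [hrk.rank j hj]
  rcases hu.lt_or_eq with hu | rfl
  · obtain ⟨i, hi, rfl⟩ := hA.surj hu
    rw [hrk.rank i hi]
    have h := hr.sufLt hs (hA.lt i hi).le hv h
    have hij : i < j := by
      by_contra hc
      rcases (not_lt.1 hc).lt_or_eq with hc | rfl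
      · exact h.asymm (hA.sorted j i hc hi)
      · exact h.ne rfl
    omega
  · rw [hrk.pad]; omega

/-- The index `redLen m` is admitted as well. Its position is at most m only for m ≡ 2 mod 3; then
it is m, the empty suffix, for which rank 0 is right. -/
lemma rank_lt_iff (hr : IsReduction s m r) (hs : Padded s m)
    (hA : SortsSuffixes r (redLen m) A) (hrk : IsRank (redLen m) A rk) {u v : ℕ}
    (hu : u ≤ redLen m) (hv : v ≤ redLen m) (huv : u ≠ v)
    (hum : samplePos m u ≤ m) (hvm : samplePos m v ≤ m) :
    rk u < rk v ↔ SufLt s (samplePos m u) (samplePos m v) := by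
  have key : ∀ v, v ≤ redLen m → samplePos m v < m → v < redLen m := by
    intro v hv h
    unfold samplePos redLen at *
    split_ifs at h <;> omega
  have hne : samplePos m u ≠ samplePos m v := fun e => huv (samplePos_inj e)
  constructor
  · intro h
    rcases hs.total hne (by omega) with h3 | h3
    · exact h3
    · have := rank_lt_of_sufLt hr hs hA hrk hv (key u hu (hs.lt_of_sufLt h3)) h3
      omega
  · intro h
    exact rank_lt_of_sufLt hr hs hA hrk hu (key v hv (hs.lt_of_sufLt h)) h

/-- Comparison of a suffix at a multiple of three with one in the first class. -/
lemma compare_one (hr : IsReduction s m r) (hs : Padded s m)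
    (hA : SortsSuffixes r (redLen m) A) (hrk : IsRank (redLen m) A rk) {w u : ℕ}
    (hw : 3 * w < m) (hu : 3 * u + 1 < m) :
    SufLt s (3 * w) (3 * u + 1) ↔
      s (3 * w) < s (3 * u + 1) ∨ s (3 * w) = s (3 * u + 1) ∧ rk w < rk ((m + 2) / 3 + u) := by
  have e1 : samplePos m w = 3 * w + 1 := by unfold samplePos; rw [if_pos (by omega)]
  have e2 : samplePos m ((m + 2) / 3 + u) = 3 * u + 2 := by
    unfold samplePos; rw [if_neg (by omega)]; omega
  rw [rank_lt_iff hr hs hA hrk (by unfold redLen; omega) (by unfold redLen; omega) (by omega)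
    (by omega) (by omega), e1, e2, sufLt_iff]

/-- Comparison of a suffix at a multiple of three with one in the second class. -/
lemma compare_two (hr : IsReduction s m r) (hs : Padded s m)
    (hA : SortsSuffixes r (redLen m) A) (hrk : IsRank (redLen m) A rk) {w u : ℕ}
    (hw : 3 * w < m) (hu : 3 * u + 2 < m) :
    SufLt s (3 * w) (3 * u + 2) ↔
      s (3 * w) < s (3 * u + 2) ∨ s (3 * w) = s (3 * u + 2) ∧
        (s (3 * w + 1) < s (3 * u + 3) ∨ s (3 * w + 1) = s (3 * u + 3) ∧
          rk ((m + 2) / 3 + w) < rk (u + 1)) := by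
  rw [sufLt_iff, sufLt_iff (i := 3 * w + 1)]
  refine or_congr_right (and_congr_right fun h1 => or_congr_right (and_congr_right fun h2 => ?_))
  -- The second symbols are both real: were one of them padding, so would be the other, and m would
  -- be 3u + 3 as well as 3w + 1.
  have hu' : 3 * u + 3 < m := by
    by_contra hc
    rw [show 3 * u + 2 + 1 = 3 * u + 3 by omega, hs.zero (3 * u + 3) (by omega)] at h2
    rcases Nat.lt_or_ge (3 * w + 1) m with h | h
    · have := hs.pos _ h; omega
    · omega
  have hw' : 3 * w + 1 < m := by
    by_contra hc
    rw [show 3 * u + 2 + 1 = 3 * u + 3 by omega, hs.zero (3 * w + 1) (by omega)] at h2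
    have := hs.pos _ hu'
    omega
  have e1 : samplePos m (u + 1) = 3 * u + 4 := by unfold samplePos; rw [if_pos (by omega)]; omega
  have e2 : samplePos m ((m + 2) / 3 + w) = 3 * w + 2 := by
    unfold samplePos; rw [if_neg (by omega)]; omega
  rw [rank_lt_iff hr hs hA hrk (by unfold redLen; omega) (by unfold redLen; omega) (by omega)
    (by omega) (by omega), e1, e2]

lemma sample_sorted (hr : IsReduction s m r) (hs : Padded s m)
    (hA : SortsSuffixes r (redLen m) A) {i j : ℕ} (hij : i < j) (hj : j < redLen m) :
    SufLt s (samplePos m (A i)) (samplePos m (A j)) :=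
  hr.sufLt_of_sufLt hs (hA.lt _ (by omega)) (hA.lt _ hj) (hA.sorted i j hij hj)

/-- Only the first sample suffix may be empty. -/
lemma sample_lt (hr : IsReduction s m r) (hs : Padded s m)
    (hA : SortsSuffixes r (redLen m) A) {i : ℕ} (hi : i < redLen m)
    (h : redLen m + (m + 2) / 3 ≤ m + i) : samplePos m (A i) < m := by
  rcases Nat.eq_zero_or_pos i with rfl | h0
  -- For i = 0 the hypothesis says that m is not 1 mod 3, so that no sample position equals m.
  · have := hA.lt 0 hi
    unfold redLen at *
    unfold samplePos
    split_ifs <;> omega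
  · exact hs.lt_of_sufLt (sample_sorted hr hs hA h0 hi)

/-- `A` is a permutation, so every index of the first class occurs exactly once. -/
lemma count_sample (hA : SortsSuffixes r (redLen m) A) :
    Nat.count (fun t => A t < (m + 2) / 3) (redLen m) = (m + 2) / 3 := by
  rw [Nat.count_eq_card_filter_range]
  conv_rhs => rw [← Finset.card_range ((m + 2) / 3)]
  refine Finset.card_bij (fun t _ => A t) ?_ ?_ ?_
  · intro t ht; simpa using (Finset.mem_filter.1 ht).2
  · intro i hi j hj e
    simp only [Finset.mem_filter, Finset.mem_range] at hi hj
    exact hA.inj hi.1 hj.1 e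
  · intro u hu
    simp only [Finset.mem_range] at hu
    obtain ⟨i, hi, e⟩ := hA.surj (x := u) (by unfold redLen; omega)
    exact ⟨i, by simp [hi, e, hu], e⟩

lemma exists_count_eq (P : ℕ → Prop) [DecidablePred P] {c p : ℕ} (h : c < Nat.count P p) :
    ∃ t < p, P t ∧ Nat.count P t = c := by
  induction p with
  | zero => simp at h
  | succ p ih =>
    rw [Nat.count_succ] at h
    by_cases hc : c < Nat.count P p
    · obtain ⟨t, h1, h2⟩ := ih hc
      exact ⟨t, by omega, h2⟩
    · split_ifs at h with hp
      · exact ⟨p, by omega, hp, by omega⟩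
      · omega

/-- The suffixes at multiples of three, in the order of their ranks without the first symbol. -/
lemma sortedBy_rank (hr : IsReduction s m r) (hs : Padded s m)
    (hA : SortsSuffixes r (redLen m) A) {B : ℕ → ℕ}
    (hB : ∀ t < redLen m, A t < (m + 2) / 3 →
      B (Nat.count (fun t => A t < (m + 2) / 3) t) = 3 * A t) :
    ∃ b : ℕ → ℕ, (∀ c < (m + 2) / 3, B c = 3 * b c ∧ b c < (m + 2) / 3) ∧
      ∀ c d, c < d → d < (m + 2) / 3 → SufLt s (3 * b c + 1) (3 * b d + 1) := by
  set P := fun t => A t < (m + 2) / 3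
  have hc := count_sample hA
  have key : ∀ c, ∃ t, c < (m + 2) / 3 → t < redLen m ∧ P t ∧ Nat.count P t = c := by
    intro c
    by_cases h : c < (m + 2) / 3
    · obtain ⟨t, ht⟩ := exists_count_eq P (c := c) (p := redLen m) (by rw [hc]; exact h)
      exact ⟨t, fun _ => ht⟩
    · exact ⟨0, fun h' => absurd h' h⟩
  -- τ c is the place in `A` of the c-th entry from the first class. As τ is increasing, the
  -- selected entries inherit the order of `A`.
  choose τ hτ using key
  refine ⟨fun c => A (τ c), fun c hcc => ?_, fun c d hcd hd => ?_⟩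
  · obtain ⟨h1, h2, h3⟩ := hτ c hcc
    have := hB _ h1 h2
    rw [h3] at this
    exact ⟨this, h2⟩
  · obtain ⟨h1, h2, h3⟩ := hτ c (by omega)
    obtain ⟨h4, h5, h6⟩ := hτ d hd
    have hlt : τ c < τ d := by
      by_contra hh
      have := Nat.count_monotone P (not_lt.1 hh)
      omega
    have := sample_sorted hr hs hA hlt h4
    unfold samplePos at this
    rwa [if_pos h2, if_pos h5] at this

end

/-- The names of the triples at the sorted positions `y 0, y 1, …`. -/
def triName (s y : ℕ → ℕ) : ℕ → ℕ
  | 0 => 1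
  | t + 1 => triName s y t + if tri s (y (t + 1)) = tri s (y t) then 0 else 1

lemma triName_pos (s y : ℕ → ℕ) (t : ℕ) : 1 ≤ triName s y t := by
  induction t with
  | zero => exact le_rfl
  | succ t ih => simp only [triName]; omega

lemma triName_le (s y : ℕ → ℕ) (t : ℕ) : triName s y t ≤ t + 1 := by
  induction t with
  | zero => exact le_rfl
  | succ t ih => simp only [triName]; split_ifs <;> omega

/-- In a sorted list equal triples are adjacent, so the name increases exactly where the triple
changes. -/
lemma triName_spec {y : ℕ → ℕ} {p : ℕ}
    (hy : ∀ u v, u < v → v < p → tri s (y u) ≤ tri s (y v)) {u v : ℕ} (huv : u ≤ v) (hv : v < p) :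
    (tri s (y u) = tri s (y v) → triName s y u = triName s y v) ∧
    (tri s (y u) < tri s (y v) → triName s y u < triName s y v) ∧
    triName s y u ≤ triName s y v := by
  induction v with
  | zero =>
    obtain rfl : u = 0 := by omega
    exact ⟨fun _ => rfl, fun h => absurd h (lt_irrefl _), le_rfl⟩
  | succ v ih =>
    rcases huv.lt_or_eq with huv | rfl
    swap
    · exact ⟨fun _ => rfl, fun h => absurd h (lt_irrefl _), le_rfl⟩
    obtain ⟨h1, h2, h3⟩ := ih (by omega) (by omega)
    have h4 := hy v (v + 1) (by omega) hv
    have h5 : tri s (y u) ≤ tri s (y v) := by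
      rcases (Nat.lt_succ_iff.1 huv).lt_or_eq with h | rfl
      · exact hy u v h (by omega)
      · exact le_rfl
    simp only [triName]
    split_ifs with he
    · rw [he]
      exact ⟨h1, h2, h3⟩
    · refine ⟨fun h => ?_, fun _ => by omega, by omega⟩
      exact absurd (le_antisymm (h ▸ h5) h4) he

lemma isReduction_of_names {y r : ℕ → ℕ} (hy : ∀ u v, u < v → v < redLen m →
      tri s (y u) ≤ tri s (y v))
    (hsurj : ∀ u < redLen m, ∃ t < redLen m, y t = samplePos m u)
    (hr : ∀ t < redLen m, r (sampleIdx m (y t)) = triName s y t)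
    (hz : ∀ u, redLen m ≤ u → r u = 0) : IsReduction s m r := by
  have key : ∀ u < redLen m, ∃ t < redLen m, y t = samplePos m u ∧ r u = triName s y t := by
    intro u hu
    obtain ⟨t, ht, e⟩ := hsurj u hu
    refine ⟨t, ht, e, ?_⟩
    rw [← hr t ht, e, sampleIdx_samplePos]
  refine ⟨⟨fun u hu => ?_, hz⟩, fun u v hu hv h => ?_, fun u v hu hv h => ?_⟩
  · obtain ⟨t, -, -, e⟩ := key u hu
    rw [e]; exact triName_pos s y t
  · obtain ⟨a, ha, ea, ra⟩ := key u hu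
    obtain ⟨b, hb, eb, rb⟩ := key v hv
    rw [← ea, ← eb] at h
    rw [ra, rb]
    rcases Nat.lt_or_ge b a with hab | hab
    · exact absurd (hy b a hab ha) (not_le.2 h)
    · exact (triName_spec hy hab hb).2.1 h
  · obtain ⟨a, ha, ea, ra⟩ := key u hu
    obtain ⟨b, hb, eb, rb⟩ := key v hv
    rw [← ea, ← eb] at h
    rw [ra, rb]
    rcases le_total a b with hab | hab
    · exact (triName_spec hy hab hb).1 h
    · exact ((triName_spec hy hab ha).1 h.symm).symm

end

/-! ### Suffix sorting: the reduction step -/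

/-- From `b` on there stand: the string with three zeros, a header cell holding m, the reduced
string with its own zeros and header cell, two arrays `A` and `B` for the radix sort, and the
counters. The next level will put its reduced string where `A` begins, since `A` is no longer needed
then. -/
def downInit : Stmt :=
  .n0 ::= (Exp.var .m + lit(2)) / lit(3) ;;
  .m1 ::= Exp.var .n0 + Exp.var .m / lit(3) ;;
  .bR ::= Exp.var .b + Exp.var .m + lit(4) ;;
  .A ::= Exp.var .bR + Exp.var .m1 + lit(4) ;;
  .B ::= Exp.var .A + Exp.var .m1 ;;
  .cb ::= Exp.var .B + Exp.var .m1 ;;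
  .p ::= Exp.var .m1 ;;
  Exp.var .b + Exp.var .m + lit(3) ::=ₘ Exp.var .m

/-- List the positions of the triples. -/
def listTriples : Stmt :=
  .forTo .k .m1 (.ite (.lt (Exp.var .k) (Exp.var .n0))
    (Exp.var .A + Exp.var .k ::=ₘ lit(3) * Exp.var .k + lit(1))
    (Exp.var .A + Exp.var .k ::=ₘ lit(3) * (Exp.var .k - Exp.var .n0) + lit(2)))

def sortPass (src dst : Var) (o : ℕ) : Stmt :=
  .ia ::= Exp.var src ;; .oa ::= Exp.var dst ;; .kb ::= Exp.var .b + lit(o) ;; countingSort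

/-- The variables and the string at the start of the sorting passes. -/
structure SortState (S : St) (b m K : ℕ) (s : ℕ → ℕ) : Prop where
  vb : S.var .b = b
  vm : S.var .m = m
  vK : S.var .K = K
  vn0 : S.var .n0 = (m + 2) / 3
  vm1 : S.var .m1 = redLen m
  vbR : S.var .bR = b + m + 4
  vA : S.var .A = b + m + 8 + redLen m
  vB : S.var .B = b + m + 8 + 2 * redLen m
  vcb : S.var .cb = b + m + 8 + 3 * redLen m
  vp : S.var .p = redLen m
  str : ∀ i < m + 3, S.mem (b + i) = s i
  hdr : S.mem (b + m + 3) = m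

section
variable {E : Env} {S : St} {b m K : ℕ} {s : ℕ → ℕ}

lemma ok_downInit (hb : S.var .b = b) (hm : S.var .m = m) (hK : S.var .K = K)
    (hs : ∀ i < m + 3, S.mem (b + i) = s i)
    (hsz : b + m + 9 + 3 * redLen m + K ≤ E.size) (hW : 4 * E.size + 10 ≤ E.wordBound) :
    Ok E downInit S 100 fun S' =>
      SortState S' b m K s ∧ ∀ x < b + m + 3, S'.mem x = S.mem x := by
  have hr : redLen m = (m + 2) / 3 + m / 3 := rfl
  simp only [Ok, downInit, wp_seq, wp_assign, wp_put]
  simp [hb, hm]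
  refine ⟨by omega, by omega, by omega, by omega, by omega, by omega, by omega, ?_, ?_⟩
  · constructor <;> simp [hb, hm, hK, hr] <;> try omega
    intro i hi
    have : b + i ≠ b + m + 3 := by omega
    simp [this, hs i hi]
  · intro x hx
    have : x ≠ b + m + 3 := by omega
    simp [this]

lemma SortState.of_frame {c : Stmt} {S' : St} (h : SortState S b m K s) (hf : Frame c S S')
    (hw : c.writes .b = false ∧ c.writes .m = false ∧ c.writes .K = false ∧ c.writes .n0 = false ∧
      c.writes .m1 = false ∧ c.writes .bR = false ∧ c.writes .A = false ∧ c.writes .B = false ∧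
      c.writes .cb = false ∧ c.writes .p = false)
    (hmem : ∀ x < b + m + 4, S'.mem x = S.mem x) : SortState S' b m K s := by
  obtain ⟨h1, h2, h3, h4, h5, h6, h7, h8, h9, h10⟩ := hw
  exact ⟨(hf _ h1).trans h.vb, (hf _ h2).trans h.vm, (hf _ h3).trans h.vK, (hf _ h4).trans h.vn0,
    (hf _ h5).trans h.vm1, (hf _ h6).trans h.vbR, (hf _ h7).trans h.vA, (hf _ h8).trans h.vB,
    (hf _ h9).trans h.vcb, (hf _ h10).trans h.vp,
    fun i hi => (hmem _ (by omega)).trans (h.str i hi), (hmem _ (by omega)).trans h.hdr⟩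

lemma ok_listTriples (h : SortState S b m K s)
    (hsz : b + m + 9 + 3 * redLen m + K ≤ E.size) (hW : 4 * E.size + 10 ≤ E.wordBound) :
    Ok E listTriples S (40 * redLen m + 6) fun S' =>
      (∀ x < b + m + 4, S'.mem x = S.mem x) ∧
      ∀ u < redLen m, S'.mem (b + m + 8 + redLen m + u) = samplePos m u := by
  have hr : redLen m = (m + 2) / 3 + m / 3 := rfl
  rw [listTriples]
  refine (ok_forTo (N := redLen m) (B := 31) (I := fun k S' =>
    (∀ x < b + m + 4, S'.mem x = S.mem x) ∧
      ∀ u < k, S'.mem (b + m + 8 + redLen m + u) = samplePos m u)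
    h.vm1 (by omega) rfl rfl (by decide) (by simp) ?_).mono (by omega) (fun _ h _ => h.1)
  rintro k S1 hk ⟨h1, h2⟩ hi hf
  have eA : S1.var .A = _ := (hf _ rfl).trans h.vA
  have en : S1.var .n0 = _ := (hf _ rfl).trans h.vn0
  have e : ∀ v, v = samplePos m k → (∀ x < b + m + 4,
      Function.update S1.mem (b + m + 8 + redLen m + k) v x = S.mem x) ∧
      ∀ u < k + 1, Function.update S1.mem (b + m + 8 + redLen m + k) v
        (b + m + 8 + redLen m + u) = samplePos m u := by
    rintro v rfl
    refine ⟨fun x hx => ?_, fun u hu => ?_⟩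
    · have : x ≠ b + m + 8 + redLen m + k := by omega
      simp [this, h1 x hx]
    · rw [Function.update_apply]
      split_ifs with hc
      · congr 1; omega
      · exact h2 u (by omega)
  rw [wp_ite]
  refine ⟨by simp, fun hb => ?_, fun hb => ?_⟩
  · simp [en, hi] at hb
    simp [eA, hi]
    obtain ⟨e1, e2⟩ := e (3 * k + 1) (by rw [samplePos, if_pos hb])
    exact ⟨⟨by omega, by omega, by omega⟩, e1, fun u hu => e2 u (by omega)⟩
  · simp [en, hi] at hb
    simp [eA, hi, en]
    obtain ⟨e1, e2⟩ := e (3 * (k - (m + 2) / 3) + 2) (by rw [samplePos, if_neg (by omega)])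
    exact ⟨⟨by omega, by omega, by omega⟩, e1, fun u hu => e2 u (by omega)⟩

/-- One pass of the radix sort, by symbol `o` of the triples. A position is at most m and `o` at
most 2, so the three zeros behind the string suffice for reading. -/
lemma ok_sortPass {src dst : Var} {o : ℕ} (h : SortState S b m K s)
    (hsd : src = .A ∧ dst = .B ∨ src = .B ∧ dst = .A) (ho : o ≤ 2) (hK : ∀ i, s i ≤ K)
    {a : ℕ → ℕ} (ha : ∀ i < redLen m, S.mem (S.var src + i) = a i ∧ a i ≤ m)
    (hsz : b + m + 9 + 3 * redLen m + K ≤ E.size) (hW : 4 * E.size + 10 ≤ E.wordBound) :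
    Ok E (sortPass src dst o) S (220 * (redLen m + K + 1)) fun S' =>
      SortState S' b m K s ∧ (∀ x < b + m + 4, S'.mem x = S.mem x) ∧
      ∃ b' : ℕ → ℕ, (∀ i < redLen m, S'.mem (S'.var dst + i) = b' i ∧ b' i ≤ m) ∧
        StablySorts (redLen m) (fun x => s (x + o)) a b' := by
  have hr : redLen m = (m + 2) / 3 + m / 3 := rfl
  have hw : (sortPass src dst o).writes .b = false ∧ (sortPass src dst o).writes .m = false ∧
      (sortPass src dst o).writes .K = false ∧ (sortPass src dst o).writes .n0 = false ∧
      (sortPass src dst o).writes .m1 = false ∧ (sortPass src dst o).writes .bR = false ∧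
      (sortPass src dst o).writes .A = false ∧ (sortPass src dst o).writes .B = false ∧
      (sortPass src dst o).writes .cb = false ∧ (sortPass src dst o).writes .p = false :=
    ⟨rfl, rfl, rfl, rfl, rfl, rfl, rfl, rfl, rfl, rfl⟩
  have hsrc : src ≠ .ia ∧ src ≠ .oa ∧ src ≠ .kb ∧ dst ≠ .ia ∧ dst ≠ .oa ∧ dst ≠ .kb := by
    rcases hsd with ⟨rfl, rfl⟩ | ⟨rfl, rfl⟩ <;> decide
  have hreg : b + m + 8 + redLen m ≤ S.var src ∧ b + m + 8 + redLen m ≤ S.var dst ∧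
      S.var src + redLen m ≤ b + m + 8 + 3 * redLen m ∧
      S.var dst + redLen m ≤ b + m + 8 + 3 * redLen m ∧
      (S.var src + redLen m ≤ S.var dst ∨ S.var dst + redLen m ≤ S.var src) := by
    rcases hsd with ⟨rfl, rfl⟩ | ⟨rfl, rfl⟩ <;> rw [h.vA, h.vB] <;> omega
  have hdw : (sortPass src dst o).writes dst = false := by
    rcases hsd with ⟨rfl, rfl⟩ | ⟨rfl, rfl⟩ <;> rfl
  obtain ⟨n1, n2, n3, n4, n5, n6⟩ := hsrc
  obtain ⟨r1, r2, r3, r4, r5⟩ := hreg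
  have main : Ok E (sortPass src dst o) S (220 * (redLen m + K + 1)) fun S' =>
      (∀ x < b + m + 4, S'.mem x = S.mem x) ∧
      StablySorts (redLen m) (fun x => s (x + o)) a (fun u => S'.mem (S.var dst + u)) := by
    rw [Ok, sortPass]
    simp only [wp_seq, wp_assign]
    refine ⟨trivial, trivial, by simp [h.vb]; omega, ?_⟩
    refine Ok.wp (ok_countingSort (p := redLen m) (ia := S.var src) (oa := S.var dst)
      (kb := b + o) (cb := b + m + 8 + 3 * redLen m) (K := K) a (fun x => s (x + o))
      (by simp [h.vp]) (by simp) (by simp [n4]) (by simp [h.vb])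
      (by simp [h.vcb]) (by simp [h.vK]) (fun i hi => by simpa using (ha i hi).1) ?_ r5 r3 r4
      (by omega) (by omega)) ?_
    · intro i hi
      have := (ha i hi).2
      refine ⟨?_, hK _, by omega, by omega⟩
      have e := h.str (a i + o) (by omega)
      simp only [St.set_mem]
      rw [← e]; congr 1; omega
    · rintro u S' hu ⟨q1, q2⟩ -
      refine ⟨?_, fun x hx => ?_, q2⟩
      · simp at hu; omega
      · rw [q1 x (by omega) (by omega)]; rfl
  refine main.mono le_rfl ?_
  rintro S' ⟨q1, q2⟩ hf
  refine ⟨h.of_frame hf hw q1, q1, _, fun i hi => ⟨by rw [hf _ hdw], ?_⟩, q2⟩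
  obtain ⟨j, hj, e⟩ := q2.mem hi
  rw [e]; exact (ha j hj).2

/-- Sort the triples. -/
def sortTriples : Stmt :=
  downInit ;; listTriples ;; sortPass .A .B 2 ;; sortPass .B .A 1 ;; sortPass .A .B 0

/-- The least significant symbol comes first; each stable pass refines the order left by the
previous one. -/
lemma ok_sortTriples (hb : S.var .b = b) (hm : S.var .m = m) (hK : S.var .K = K)
    (hs : ∀ i < m + 3, S.mem (b + i) = s i) (hsK : ∀ i, s i ≤ K)
    (hsz : b + m + 9 + 3 * redLen m + K ≤ E.size) (hW : 4 * E.size + 10 ≤ E.wordBound) :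
    Ok E sortTriples S (810 * (redLen m + K + 1)) fun S' =>
      SortState S' b m K s ∧ (∀ x < b + m + 3, S'.mem x = S.mem x) ∧
      ∃ y : ℕ → ℕ, (∀ i < redLen m, S'.mem (b + m + 8 + 2 * redLen m + i) = y i) ∧
        (∀ t < redLen m, ∃ u < redLen m, y t = samplePos m u) ∧
        (∀ u < redLen m, ∃ t < redLen m, y t = samplePos m u) ∧
        ∀ u v, u < v → v < redLen m → tri s (y u) ≤ tri s (y v) := by
  rw [Ok, sortTriples]
  simp only [wp_seq]
  refine (ok_downInit hb hm hK hs hsz hW).wp ?_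
  rintro u0 S0 hu0 ⟨h0, m0⟩ -
  refine (ok_listTriples h0 hsz hW).wp ?_
  rintro u1 S1 hu1 ⟨m1, l1⟩ f1
  have h1 := h0.of_frame f1 ⟨rfl, rfl, rfl, rfl, rfl, rfl, rfl, rfl, rfl, rfl⟩ m1
  refine (ok_sortPass h1 (Or.inl ⟨rfl, rfl⟩) (by omega : 2 ≤ 2) hsK (a := samplePos m)
    (fun i hi => ⟨by rw [h1.vA]; exact l1 i hi, samplePos_le hi⟩) hsz hW).wp ?_
  rintro u2 S2 hu2 ⟨h2, m2, a2, e2, t2⟩ -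
  refine (ok_sortPass h2 (Or.inr ⟨rfl, rfl⟩) (by omega : 1 ≤ 2) hsK e2 hsz hW).wp ?_
  rintro u3 S3 hu3 ⟨h3, m3, a3, e3, t3⟩ -
  refine (ok_sortPass h3 (Or.inl ⟨rfl, rfl⟩) (by omega : 0 ≤ 2) hsK e3 hsz hW).wp ?_
  rintro u4 S4 hu4 ⟨h4, m4, a4, e4, t4⟩ -
  refine ⟨by omega, h4, fun x hx => ?_, a4, fun i hi => ?_, fun t ht => ?_, fun u hu => ?_, ?_⟩
  · rw [m4 x (by omega), m3 x (by omega), m2 x (by omega), m1 x (by omega), m0 x hx]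
  · have := (e4 i hi).1
    rwa [h4.vB] at this
  · obtain ⟨i, hi, w4⟩ := t4.mem ht
    obtain ⟨j, hj, w3⟩ := t3.mem hi
    obtain ⟨k, hk, w2⟩ := t2.mem hj
    exact ⟨k, hk, by rw [w4, w3, w2]⟩
  · obtain ⟨i, hi, w2⟩ := t2.mem' hu
    obtain ⟨j, hj, w3⟩ := t3.mem' hi
    obtain ⟨k, hk, w4⟩ := t4.mem' hj
    exact ⟨k, hk, by rw [w4, w3, w2]⟩
  · intro u v huv hv
    have := t4.sorted (R := fun x y => s (x + 1) < s (y + 1) ∨ s (x + 1) = s (y + 1) ∧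
      s (x + 2) ≤ s (y + 2)) (fun i j hij hj => ?_) huv hv
    · by_contra hc
      rw [not_le, tri_lt_iff] at hc
      simp only [Nat.add_zero] at this
      omega
    · have := t3.sorted (R := fun x y => s (x + 2) ≤ s (y + 2)) (fun i j hij hj => ?_) hij hj
      · exact this
      · have := t2.sorted (R := fun x y => True) (fun i j hij hj => trivial) hij hj
        show s (a2 i + 2) ≤ s (a2 j + 2)
        have h' : s (a2 i + 2) < s (a2 j + 2) ∨ s (a2 i + 2) = s (a2 j + 2) ∧ True := this
        omega


/-- Give names to the triples. -/
def nameTriples : Stmt :=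
  .nm ::= lit(0) ;; .x0 ::= Exp.var .K + lit(1) ;; .x1 ::= lit(0) ;; .x2 ::= lit(0) ;;
  .forTo .k .m1 (
    .x ::= M[Exp.var .B + Exp.var .k] ;;
    .y0 ::= M[Exp.var .b + Exp.var .x] ;;
    .y1 ::= M[Exp.var .b + Exp.var .x + lit(1)] ;;
    .y2 ::= M[Exp.var .b + Exp.var .x + lit(2)] ;;
    .ite (.eq ((Exp.var .y0 - Exp.var .x0) + (Exp.var .x0 - Exp.var .y0) +
        ((Exp.var .y1 - Exp.var .x1) + (Exp.var .x1 - Exp.var .y1)) +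
        ((Exp.var .y2 - Exp.var .x2) + (Exp.var .x2 - Exp.var .y2))) lit(0))
      .skip (.nm ::= Exp.var .nm + lit(1)) ;;
    .x0 ::= Exp.var .y0 ;; .x1 ::= Exp.var .y1 ;; .x2 ::= Exp.var .y2 ;;
    .u ::= Exp.var .x / lit(3) ;;
    .ite (.eq (Exp.var .x - lit(3) * Exp.var .u) lit(1)) .skip (.u ::= Exp.var .n0 + Exp.var .u) ;;
    Exp.var .bR + Exp.var .u ::=ₘ Exp.var .nm) ;;
  Exp.var .bR + Exp.var .m1 ::=ₘ lit(0) ;;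
  Exp.var .bR + Exp.var .m1 + lit(1) ::=ₘ lit(0) ;;
  Exp.var .bR + Exp.var .m1 + lit(2) ::=ₘ lit(0)

lemma sampleIdx_lt {u : ℕ} (h : u < redLen m) : sampleIdx m (samplePos m u) < redLen m := by
  rwa [sampleIdx_samplePos]

/-- The previous triple initially starts with K + 1, which is no symbol; hence the first triple
counts as new and gets the name 1. Two triples agree iff the truncated differences of their symbols,
in both directions, add up to 0. -/
lemma ok_nameTriples (h : SortState S b m K s) (hsK : ∀ i, s i ≤ K)
    (hsz : b + m + 9 + 3 * redLen m + K ≤ E.size) (hW : 4 * E.size + 10 ≤ E.wordBound)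
    {y : ℕ → ℕ} (hy : ∀ i < redLen m, S.mem (b + m + 8 + 2 * redLen m + i) = y i)
    (hpos : ∀ t < redLen m, ∃ u < redLen m, y t = samplePos m u)
    (hsort : ∀ u v, u < v → v < redLen m → tri s (y u) ≤ tri s (y v)) :
    Ok E nameTriples S (210 * redLen m + 100) fun S' =>
      (∀ x < b + m + 4, S'.mem x = S.mem x) ∧
      (∀ t < redLen m, S'.mem (b + m + 4 + sampleIdx m (y t)) = triName s y t) ∧
      ∀ i < 3, S'.mem (b + m + 4 + redLen m + i) = 0 := by
  have hr : redLen m = (m + 2) / 3 + m / 3 := rfl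
  rw [Ok, nameTriples]
  simp only [wp_seq, wp_assign]
  refine ⟨by simp; omega, by simp [h.vK]; omega, by simp; omega, by simp; omega, ?_⟩
  refine Ok.wp (ok_forTo (N := redLen m) (B := 200) (I := fun k S' =>
    (k = 0 → S'.var .nm = 0 ∧ S'.var .x0 = K + 1 ∧ S'.var .x1 = 0 ∧ S'.var .x2 = 0) ∧
    (0 < k → S'.var .nm = triName s y (k - 1) ∧ S'.var .x0 = s (y (k - 1)) ∧
      S'.var .x1 = s (y (k - 1) + 1) ∧ S'.var .x2 = s (y (k - 1) + 2)) ∧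
    (∀ x, (x < b + m + 4 ∨ b + m + 4 + redLen m ≤ x) → S'.mem x = S.mem x) ∧
    (∀ t < k, S'.mem (b + m + 4 + sampleIdx m (y t)) = triName s y t))
    (by simp [h.vm1]) (by omega) rfl rfl (by decide) (by simp [h.vK]) ?_) ?_
  · rintro k S1 hk ⟨i1, i2, i3, i4⟩ hi hf
    have eB : S1.var .B = _ := (hf _ rfl).trans h.vB
    have eb : S1.var .b = _ := (hf _ rfl).trans h.vb
    have en : S1.var .n0 = _ := (hf _ rfl).trans h.vn0
    have er : S1.var .bR = _ := (hf _ rfl).trans h.vbR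
    obtain ⟨w, hw, ew⟩ := hpos k hk
    have hm := samplePos_le hw
    have hidx := sampleIdx_lt hw
    rw [← ew] at hm hidx
    have v1 : S1.mem (b + m + 8 + 2 * redLen m + k) = y k := by
      rw [i3 _ (by omega), hy k hk]
    have rd : ∀ o < 3, S1.mem (b + y k + o) = s (y k + o) := fun o ho => by
      rw [i3 _ (by omega), Nat.add_assoc, h.str _ (by omega)]
    have rd0 := rd 0 (by omega)
    simp only [Nat.add_zero] at rd0
    have rd1 := rd 1 (by omega)
    have rd2 := rd 2 (by omega)
    have k0 := hsK (y k)
    have k1 := hsK (y k + 1)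
    have k2 := hsK (y k + 2)
    have hxs : S1.var .x0 ≤ K + 1 ∧ S1.var .x1 ≤ K ∧ S1.var .x2 ≤ K ∧ S1.var .nm ≤ k := by
      rcases Nat.eq_zero_or_pos k with h0 | h0
      · obtain ⟨a1, a2, a3, a4⟩ := i1 h0
        omega
      · obtain ⟨a1, a2, a3, a4⟩ := i2 h0
        have := hsK (y (k - 1))
        have := hsK (y (k - 1) + 1)
        have := hsK (y (k - 1) + 2)
        have := triName_le s y (k - 1)
        omega
    have hname : (if s (y k) = S1.var .x0 ∧ s (y k + 1) = S1.var .x1 ∧ s (y k + 2) = S1.var .x2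
        then S1.var .nm else S1.var .nm + 1) = triName s y k := by
      rcases Nat.eq_zero_or_pos k with h0 | h0
      · obtain ⟨a1, a2, a3, a4⟩ := i1 h0
        rw [if_neg (by omega), a1, h0]; rfl
      · obtain ⟨a1, a2, a3, a4⟩ := i2 h0
        obtain ⟨q, rfl⟩ : ∃ q, k = q + 1 := ⟨k - 1, by omega⟩
        simp only [Nat.add_sub_cancel] at a1 a2 a3 a4
        rw [a1, a2, a3, a4, triName]
        simp only [← tri_eq_iff]
        split_ifs <;> rfl
    have hn1 := triName_le s y k
    have fin : ∀ S2 : St, S2.var .nm = triName s y k → S2.var .x0 = s (y k) →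
        S2.var .x1 = s (y k + 1) → S2.var .x2 = s (y k + 2) →
        S2.mem = Function.update S1.mem (b + m + 4 + sampleIdx m (y k)) (triName s y k) →
        (k + 1 = 0 → S2.var .nm = 0 ∧ S2.var .x0 = K + 1 ∧ S2.var .x1 = 0 ∧ S2.var .x2 = 0) ∧
        (0 < k + 1 → S2.var .nm = triName s y (k + 1 - 1) ∧ S2.var .x0 = s (y (k + 1 - 1)) ∧
          S2.var .x1 = s (y (k + 1 - 1) + 1) ∧ S2.var .x2 = s (y (k + 1 - 1) + 2)) ∧
        (∀ x, (x < b + m + 4 ∨ b + m + 4 + redLen m ≤ x) → S2.mem x = S.mem x) ∧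
        (∀ t < k + 1, S2.mem (b + m + 4 + sampleIdx m (y t)) = triName s y t) := by
      intro S2 b1 b2 b3 b4 b5
      refine ⟨by omega, fun _ => ⟨b1, b2, b3, b4⟩, fun x hx => ?_, fun t ht => ?_⟩
      · have : x ≠ b + m + 4 + sampleIdx m (y k) := by omega
        rw [b5, Function.update_of_ne this, i3 x hx]
      · rcases Nat.lt_succ_iff_lt_or_eq.1 ht with ht | rfl
        · rw [b5, Function.update_apply]
          split_ifs with hc
          -- `y` is not assumed to be injective. If a position occurred twice, both entries would
          -- carry the same triple and therefore the same name.
          · obtain ⟨w', hw', ew'⟩ := hpos t (by omega)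
            rw [ew, ew', sampleIdx_samplePos, sampleIdx_samplePos] at hc
            have : w' = w := by omega
            refine ((triName_spec hsort ht.le hk).1 ?_).symm
            rw [ew, ew', this]
          · exact i4 t ht
        · rw [b5, Function.update_self]
    simp only [wp_seq, wp_assign]
    refine ⟨by simp [eB, hi]; omega, by simp [eB, eb, hi, v1]; omega, by simp [eB, eb, hi, v1]; omega,
      by simp [eB, eb, hi, v1]; omega, ?_⟩
    refine wp_unless (by simp [eB, eb, hi, v1, rd0, rd1, rd2]; omega) (by simp; omega) ?_
    intro t1 w1 ht1 hw1 hw1'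
    simp [eB, eb, hi, v1, rd0, rd1, rd2] at ht1 hw1 hw1'
    have ew1 : w1 = triName s y k := by
      rw [← hname]
      split_ifs with hc
      · exact hw1 (by omega) (by omega) (by omega) (by omega) (by omega) (by omega)
      · exact hw1' (by omega)
    refine ⟨trivial, trivial, trivial, by simp; omega, ?_⟩
    refine wp_unless (by simp [eB, hi, v1]; omega) (by simp [eB, hi, v1, en]; omega) ?_
    intro t2 w2 ht2 hw2 hw2'
    simp [eB, hi, v1, en] at ht2 hw2 hw2'
    have ew2 : w2 = sampleIdx m (y k) := by
      rw [sampleIdx]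
      split_ifs with hc
      · exact hw2 (by omega)
      · exact hw2' (by omega)
    refine wp_put.2 ⟨by simp [er]; omega, by simp; omega, fin _ ?_ ?_ ?_ ?_ ?_⟩ <;>
      simp [eB, eb, er, hi, v1, rd0, rd1, rd2, ew1, ew2]
  · rintro u1 S1 hu1 ⟨⟨-, -, i3, i4⟩, -⟩ f1
    have em : S1.var .m1 = _ := (f1 _ rfl).trans h.vm1
    have er : S1.var .bR = _ := (f1 _ rfl).trans h.vbR
    simp only [wp_put]
    refine ⟨by simp [em, er]; omega, by simp [em, er]; omega, by simp [em, er]; omega, ?_, ?_, ?_, ?_⟩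
    · simp at hu1 ⊢; omega
    · intro x hx
      simp [em, er, Function.update_apply]
      rw [if_neg (by omega), if_neg (by omega), if_neg (by omega), i3 x (by omega)]
    · intro t ht
      obtain ⟨w, hw, ew⟩ := hpos t ht
      have hidx := sampleIdx_lt hw
      rw [← ew] at hidx
      simp [em, er, Function.update_apply]
      rw [if_neg (by omega), if_neg (by omega), if_neg (by omega), i4 t ht]
    · intro i hi
      simp [em, er, Function.update_apply]
      intros
      omega

end

/-- The string `s` of length `m` stands at address `b`, followed by zeros. -/
structure StringAt (M : ℕ → ℕ) (b m : ℕ) (s : ℕ → ℕ) : Prop where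
  padded : Padded s m
  mem : ∀ i < m + 3, M (b + i) = s i

/-- From a string to its reduced string. -/
def levelDown : Stmt :=
  sortTriples ;; nameTriples ;;
  .b ::= Exp.var .bR ;; .m ::= Exp.var .m1 ;; .K ::= Exp.var .m1

section
variable {E : Env} {S : St} {b m K : ℕ} {s : ℕ → ℕ}

lemma ok_levelDown (hb : S.var .b = b) (hm : S.var .m = m) (hK : S.var .K = K)
    (hs : StringAt S.mem b m s) (hsK : ∀ i, s i ≤ K)
    (hsz : b + m + 9 + 3 * redLen m + K ≤ E.size) (hW : 4 * E.size + 10 ≤ E.wordBound) :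
    Ok E levelDown S (1100 * (redLen m + K + 1)) fun S' =>
      S'.var .b = b + m + 4 ∧ S'.var .m = redLen m ∧ S'.var .K = redLen m ∧
      S'.mem (b + m + 3) = m ∧ (∀ x < b + m + 3, S'.mem x = S.mem x) ∧
      ∃ r, IsReduction s m r ∧ (∀ i, r i ≤ redLen m) ∧
        StringAt S'.mem (b + m + 4) (redLen m) r := by
  rw [Ok, levelDown]
  simp only [wp_seq, wp_assign]
  refine (ok_sortTriples hb hm hK hs.mem hsK hsz hW).wp ?_
  rintro u1 S1 hu1 ⟨h1, m1, y, e1, p1, q1, t1⟩ -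
  refine (ok_nameTriples h1 hsK hsz hW e1 p1 t1).wp ?_
  rintro u2 S2 hu2 ⟨m2, n2, z2⟩ f2
  have h2 := h1.of_frame f2 ⟨rfl, rfl, rfl, rfl, rfl, rfl, rfl, rfl, rfl, rfl⟩ m2
  refine ⟨trivial, trivial, trivial, ?_, ?_, ?_, ?_, ?_, ?_, ?_⟩
  · simp; omega
  · simp [h2.vbR]
  · simp [h2.vm1]
  · simp [h2.vm1]
  · simpa using h2.hdr
  · intro x hx
    simp [m2 x (by omega), m1 x hx]
  -- The reduced string has to vanish everywhere beyond its length, whereas the memory is known to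
  -- be zero on three cells only.
  · refine ⟨fun u => if u < redLen m then S2.mem (b + m + 4 + u) else 0, ?_⟩
    have hred : IsReduction s m (fun u => if u < redLen m then S2.mem (b + m + 4 + u) else 0) := by
      refine isReduction_of_names t1 q1 (fun t ht => ?_) (fun u hu => if_neg (by omega))
      obtain ⟨w, hw, ew⟩ := p1 t ht
      have := sampleIdx_lt hw
      rw [← ew] at this
      simp only [this, if_true]
      exact n2 t ht
    refine ⟨hred, fun i => ?_, hred.padded, fun i hi => ?_⟩
    · simp only
      split_ifs with h
      · obtain ⟨t, ht, e⟩ := q1 i h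
        have := n2 t ht
        rw [e, sampleIdx_samplePos] at this
        rw [this]
        have := triName_le s y t
        omega
      · omega
    · simp only [St.set_mem]
      split_ifs with h
      · rfl
      · have := z2 (i - redLen m) (by omega)
        rwa [show b + m + 4 + redLen m + (i - redLen m) = b + m + 4 + i by omega] at this

end

/-! ### Suffix sorting: merging -/

/-- The length of the longer string is recovered from the header cell just before the current one.
Symbols are bounded by σ for the original string, at address 0, and by the length for all strings of
names. -/
def upInit : Stmt :=
  .m1 ::= Exp.var .m ;;
  .bR ::= Exp.var .b ;;
  .m ::= M[Exp.var .b - lit(1)] ;;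
  .b ::= Exp.var .bR - lit(4) - Exp.var .m ;;
  .n0 ::= (Exp.var .m + lit(2)) / lit(3) ;;
  .A ::= Exp.var .bR + Exp.var .m1 + lit(4) ;;
  .B ::= Exp.var .A + Exp.var .m1 ;;
  .C ::= Exp.var .B + Exp.var .n0 ;;
  .D ::= Exp.var .C + Exp.var .n0 ;;
  .K ::= Exp.var .sg ;;
  .ite (.eq (Exp.var .b) lit(0)) .skip (.K ::= Exp.var .m)

/-- The variables, the string and the sorted suffixes of the reduced string during the merging. -/
structure UpState (S : St) (b m K : ℕ) (s A : ℕ → ℕ) : Prop where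
  vb : S.var .b = b
  vm : S.var .m = m
  vK : S.var .K = K
  vn0 : S.var .n0 = (m + 2) / 3
  vm1 : S.var .m1 = redLen m
  vbR : S.var .bR = b + m + 4
  vA : S.var .A = b + m + 8 + redLen m
  vB : S.var .B = b + m + 8 + 2 * redLen m
  vC : S.var .C = b + m + 8 + 2 * redLen m + (m + 2) / 3
  vD : S.var .D = b + m + 8 + 2 * redLen m + 2 * ((m + 2) / 3)
  str : ∀ i < m + 3, S.mem (b + i) = s i
  arr : ∀ t < redLen m, S.mem (b + m + 8 + redLen m + t) = A t

section
variable {E : Env} {S : St} {b m K : ℕ} {s A : ℕ → ℕ}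

lemma UpState.of_frame {c : Stmt} {S' : St} (h : UpState S b m K s A) (hf : Frame c S S')
    (hw : c.writes .b = false ∧ c.writes .m = false ∧ c.writes .K = false ∧ c.writes .n0 = false ∧
      c.writes .m1 = false ∧ c.writes .bR = false ∧ c.writes .A = false ∧ c.writes .B = false ∧
      c.writes .C = false ∧ c.writes .D = false)
    (hmem : ∀ x < b + m + 3, S'.mem x = S.mem x)
    (harr : ∀ t < redLen m, S'.mem (b + m + 8 + redLen m + t) = S.mem (b + m + 8 + redLen m + t)) :
    UpState S' b m K s A := by
  obtain ⟨h1, h2, h3, h4, h5, h6, h7, h8, h9, h10⟩ := hw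
  exact ⟨(hf _ h1).trans h.vb, (hf _ h2).trans h.vm, (hf _ h3).trans h.vK, (hf _ h4).trans h.vn0,
    (hf _ h5).trans h.vm1, (hf _ h6).trans h.vbR, (hf _ h7).trans h.vA, (hf _ h8).trans h.vB,
    (hf _ h9).trans h.vC, (hf _ h10).trans h.vD,
    fun i hi => (hmem _ (by omega)).trans (h.str i hi), fun t ht => (harr t ht).trans (h.arr t ht)⟩

lemma ok_upInit {sg : ℕ} (hb : S.var .b = b + m + 4) (hm : S.var .m = redLen m)
    (hsg : S.var .sg = sg) (hhd : S.mem (b + m + 3) = m)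
    (hs : ∀ i < m + 3, S.mem (b + i) = s i)
    (hA : ∀ t < redLen m, S.mem (b + m + 8 + redLen m + t) = A t)
    (hsz : b + m + 9 + 2 * redLen m + 2 * ((m + 2) / 3) + m ≤ E.size)
    (hW : 4 * E.size + 10 ≤ E.wordBound) :
    Ok E upInit S 100 fun S' =>
      UpState S' b m (if b = 0 then sg else m) s A ∧ S'.mem = S.mem := by
  have hr : redLen m = (m + 2) / 3 + m / 3 := rfl
  rw [Ok, upInit]
  simp only [wp_seq, wp_assign]
  have e1 : b + m + 4 - 1 = b + m + 3 := by omega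
  have e2 : b + m + 4 - 4 - m = b := by omega
  refine ⟨by simp, by simp, by simp [hb]; omega, by simp [hb]; omega, by simp [hb, e1, hhd]; omega,
    by simp [hb, hm]; omega, by simp [hb, hm]; omega, by simp [hb, hm, e1, hhd]; omega,
    by simp [hb, hm, e1, hhd]; omega, trivial, ?_⟩
  refine wp_unless (by simp; omega) (fun _ => trivial) ?_
  intro u v hu hv hv'
  simp [hb, hm, e1, hhd, hsg] at hu hv hv'
  have hvK : v = if b = 0 then sg else m := by
    split_ifs with h
    · exact hv h
    · exact hv' h
  refine ⟨by omega, ?_, rfl⟩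
  constructor <;> simp [hb, hm, e1, hhd, hvK] <;> omega

/-- Replace the reduced string by the ranks of its suffixes. -/
def computeRanks : Stmt :=
  .forTo .k .m1 (
    .x ::= M[Exp.var .A + Exp.var .k] ;;
    Exp.var .bR + Exp.var .x ::=ₘ Exp.var .k + lit(1))

/-- The reduced string may be overwritten, as its suffixes are sorted already. The zero behind it
becomes the rank of the empty suffix. -/
lemma ok_computeRanks (h : UpState S b m K s A) {r : ℕ → ℕ}
    (hA : SortsSuffixes r (redLen m) A) (hpad : S.mem (b + m + 4 + redLen m) = 0)
    (hsz : b + m + 9 + 2 * redLen m + 2 * ((m + 2) / 3) + m ≤ E.size)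
    (hW : 4 * E.size + 10 ≤ E.wordBound) :
    Ok E computeRanks S (50 * redLen m + 6) fun S' =>
      UpState S' b m K s A ∧ (∀ x < b + m + 4, S'.mem x = S.mem x) ∧
      IsRank (redLen m) A (fun u => S'.mem (b + m + 4 + u)) := by
  have hr : redLen m = (m + 2) / 3 + m / 3 := rfl
  rw [computeRanks]
  refine (ok_forTo (N := redLen m) (B := 41) (I := fun k S' =>
    (∀ t < k, S'.mem (b + m + 4 + A t) = t + 1) ∧
      ∀ x, (x < b + m + 4 ∨ b + m + 4 + redLen m ≤ x) → S'.mem x = S.mem x)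
    h.vm1 (by omega) rfl rfl (by decide) (by simp) ?_).mono (by omega) ?_
  · rintro k S1 hk ⟨h1, h2⟩ hi hf
    have eA : S1.var .A = _ := (hf _ rfl).trans h.vA
    have er : S1.var .bR = _ := (hf _ rfl).trans h.vbR
    have v1 : S1.mem (b + m + 8 + redLen m + k) = A k := by rw [h2 _ (by omega), h.arr k hk]
    have v2 := hA.lt k hk
    simp only [wp_seq, wp_put, wp_assign]
    refine ⟨by simp [eA, hi]; omega, by simp [eA, er, hi, v1]; omega, by simp, ?_, ?_⟩
    · intro t ht
      simp only [eA, er, hi, v1, St.set_mem, St.write_mem, Exp.val_add, Exp.val_var, Exp.val_mem, Exp.val_const,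
        St.set_var, Function.update_apply, Nat.add_left_cancel_iff, reduceCtorEq, if_true, if_false]
      split_ifs with hc
      · rw [hA.inj (by omega) hk hc]
      · refine h1 t ?_
        rcases Nat.lt_succ_iff_lt_or_eq.1 ht with ht | rfl
        · exact ht
        · exact absurd rfl hc
    · intro x hx
      have : x ≠ b + m + 4 + A k := by omega
      simp [eA, er, hi, v1, this, h2 x hx]
  · rintro S' ⟨⟨h1, h2⟩, -⟩ hf
    refine ⟨h.of_frame hf ⟨rfl, rfl, rfl, rfl, rfl, rfl, rfl, rfl, rfl, rfl⟩
      (fun x hx => h2 x (by omega)) (fun t ht => h2 _ (by omega)),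
      fun x hx => h2 x (by omega), h1, ?_⟩
    show S'.mem (b + m + 4 + redLen m) = 0
    rw [h2 _ (by omega), hpad]

/-- List the positions divisible by three, in the order of the ranks of their successors. -/
def listMultiples : Stmt :=
  .j ::= lit(0) ;;
  .forTo .k .m1 (
    .x ::= M[Exp.var .A + Exp.var .k] ;;
    .ite (.lt (Exp.var .x) (Exp.var .n0))
      (Exp.var .B + Exp.var .j ::=ₘ lit(3) * Exp.var .x ;; .j ::= Exp.var .j + lit(1))
      .skip)

/-- Index x of the first class is position 3x + 1, the successor of 3x. So a scan of `A` that keeps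
the first class meets the multiples of three in the order of their tails. -/
lemma ok_listMultiples (h : UpState S b m K s A) {r : ℕ → ℕ}
    (hA : SortsSuffixes r (redLen m) A)
    (hsz : b + m + 9 + 2 * redLen m + 2 * ((m + 2) / 3) + m ≤ E.size)
    (hW : 4 * E.size + 10 ≤ E.wordBound) :
    Ok E listMultiples S (60 * redLen m + 8) fun S' =>
      UpState S' b m K s A ∧ (∀ x < b + m + 8 + 2 * redLen m, S'.mem x = S.mem x) ∧
      ∀ t < redLen m, A t < (m + 2) / 3 →
        S'.mem (b + m + 8 + 2 * redLen m + Nat.count (fun t => A t < (m + 2) / 3) t) = 3 * A t := by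
  have hr : redLen m = (m + 2) / 3 + m / 3 := rfl
  set P := fun t => A t < (m + 2) / 3 with hP
  have hcount := count_sample hA
  rw [Ok, listMultiples]
  simp only [wp_seq, wp_assign]
  refine ⟨by simp; omega, ?_⟩
  refine Ok.wp (ok_forTo (N := redLen m) (B := 51) (I := fun k S' =>
    S'.var .j = Nat.count P k ∧ (∀ x < b + m + 8 + 2 * redLen m, S'.mem x = S.mem x) ∧
      ∀ t < k, P t → S'.mem (b + m + 8 + 2 * redLen m + Nat.count P t) = 3 * A t)
    (by simp [h.vm1]) (by omega) rfl rfl (by decide) (by simp) ?_) ?_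
  · rintro k S1 hk ⟨h1, h2, h3⟩ hi hf
    have eA : S1.var .A = _ := (hf _ rfl).trans h.vA
    have eB : S1.var .B = _ := (hf _ rfl).trans h.vB
    have en : S1.var .n0 = _ := (hf _ rfl).trans h.vn0
    have v1 : S1.mem (b + m + 8 + redLen m + k) = A k := by rw [h2 _ (by omega), h.arr k hk]
    have v2 := hA.lt k hk
    have c1 : Nat.count P (k + 1) ≤ (m + 2) / 3 :=
      (Nat.count_monotone P hk).trans hcount.le
    simp only [wp_seq, wp_put, wp_assign, wp_ite, wp_skip]
    refine ⟨by simp [eA, hi]; omega, by simp, fun hb => ?_, fun hb => ?_⟩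
    · simp [eA, hi, v1, en] at hb
      rw [Nat.count_succ, if_pos hb] at c1
      refine ⟨by simp [eA, eB, hi, v1, h1]; omega, by simp [h1]; omega, by simp, ?_, ?_, ?_⟩
      · rw [Nat.count_succ, if_pos hb]; simp [h1]
      · intro x hx
        have : x ≠ b + m + 8 + 2 * redLen m + Nat.count P k := by omega
        simp [eA, eB, hi, v1, h1, this, h2 x hx]
      · intro t ht hp
        rcases Nat.lt_succ_iff_lt_or_eq.1 ht with ht | rfl
        · have : Nat.count P t ≠ Nat.count P k := (Nat.count_strict_mono hp ht).ne
          simp [eA, eB, hi, v1, h1, this, h3 t ht hp]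
        · simp [eA, eB, hi, v1, h1]
    · simp [eA, hi, v1, en] at hb
      have hb' : ¬ P k := by simp [hP]; omega
      refine ⟨by simp, ?_, ?_, ?_⟩
      · rw [Nat.count_succ, if_neg hb']; simp [h1]
      · intro x hx
        simp [h2 x hx]
      · intro t ht hp
        rcases Nat.lt_succ_iff_lt_or_eq.1 ht with ht | rfl
        · simp [h3 t ht hp]
        · exact absurd hp hb'
  · rintro u1 S1 hu1 ⟨⟨-, h2, h3⟩, -⟩ hf
    refine ⟨by simp at hu1; omega, ?_, h2, h3⟩
    have h0 : UpState (S.set .j (Exp.val E S lit(0))) b m K s A :=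
      h.of_frame (c := .j ::= lit(0)) (fun x hx => by simp [Stmt.writes] at hx; simp [hx])
        ⟨rfl, rfl, rfl, rfl, rfl, rfl, rfl, rfl, rfl, rfl⟩ (fun _ _ => rfl) (fun _ _ => rfl)
    exact h0.of_frame hf ⟨rfl, rfl, rfl, rfl, rfl, rfl, rfl, rfl, rfl, rfl⟩
      (fun x hx => h2 x (by omega)) (fun t ht => h2 _ (by omega))

def sortMultiples : Stmt :=
  .ia ::= Exp.var .B ;; .oa ::= Exp.var .C ;; .kb ::= Exp.var .b ;; .cb ::= Exp.var .D ;;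
  .p ::= Exp.var .n0 ;; countingSort

/-- A single stable pass by the first symbol completes the sorting, since ties are already in the
order of the tails. -/
lemma ok_sortMultiples (h : UpState S b m K s A) (hsK : ∀ i, s i ≤ K) {a : ℕ → ℕ}
    (ha : ∀ c < (m + 2) / 3, S.mem (b + m + 8 + 2 * redLen m + c) = 3 * a c ∧ a c < (m + 2) / 3)
    (hsort : ∀ c d, c < d → d < (m + 2) / 3 → SufLt s (3 * a c + 1) (3 * a d + 1))
    (hsz : b + m + 9 + 2 * redLen m + 2 * ((m + 2) / 3) + m ≤ E.size)
    (hsz' : b + m + 9 + 2 * redLen m + 2 * ((m + 2) / 3) + K ≤ E.size)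
    (hW : 4 * E.size + 10 ≤ E.wordBound) :
    Ok E sortMultiples S (220 * ((m + 2) / 3 + K + 1)) fun S' =>
      UpState S' b m K s A ∧ (∀ x < b + m + 8 + 2 * redLen m, S'.mem x = S.mem x) ∧
      ∃ w : ℕ → ℕ, (∀ c < (m + 2) / 3,
        S'.mem (b + m + 8 + 2 * redLen m + (m + 2) / 3 + c) = 3 * w c ∧ w c < (m + 2) / 3) ∧
        ∀ c d, c < d → d < (m + 2) / 3 → SufLt s (3 * w c) (3 * w d) := by
  have hr : redLen m = (m + 2) / 3 + m / 3 := rfl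
  have main : Ok E sortMultiples S (220 * ((m + 2) / 3 + K + 1)) fun S' =>
      (∀ x < b + m + 8 + 2 * redLen m, S'.mem x = S.mem x) ∧
      StablySorts ((m + 2) / 3) s (fun c => 3 * a c)
        (fun c => S'.mem (b + m + 8 + 2 * redLen m + (m + 2) / 3 + c)) := by
    rw [Ok, sortMultiples]
    simp only [wp_seq, wp_assign]
    refine ⟨trivial, trivial, trivial, trivial, trivial, ?_⟩
    refine Ok.wp (ok_countingSort (p := (m + 2) / 3) (ia := b + m + 8 + 2 * redLen m)
      (oa := b + m + 8 + 2 * redLen m + (m + 2) / 3) (kb := b)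
      (cb := b + m + 8 + 2 * redLen m + 2 * ((m + 2) / 3)) (K := K) (fun c => 3 * a c) s
      (by simp [h.vn0]) (by simp [h.vB]) (by simp [h.vC]) (by simp [h.vb])
      (by simp [h.vD]) (by simp [h.vK]) (fun i hi => by simpa using (ha i hi).1) ?_ (by omega)
      (by omega) (by omega) (by omega) (by omega)) ?_
    · intro i hi
      have := (ha i hi).2
      exact ⟨h.str _ (by omega), hsK _, by omega, by omega⟩
    · rintro u S' hu ⟨q1, q2⟩ -
      refine ⟨?_, fun x hx => ?_, q2⟩
      · simp at hu; omega
      · rw [q1 x (by omega) (by omega)]; rfl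
  refine main.mono le_rfl ?_
  rintro S' ⟨q1, q2⟩ hf
  refine ⟨h.of_frame hf ⟨rfl, rfl, rfl, rfl, rfl, rfl, rfl, rfl, rfl, rfl⟩
    (fun x hx => q1 x (by omega)) (fun t ht => q1 _ (by omega)), q1,
    fun c => S'.mem (b + m + 8 + 2 * redLen m + (m + 2) / 3 + c) / 3, ?_, ?_⟩
  · intro c hc
    obtain ⟨d, hd, e⟩ := q2.mem hc
    have := (ha d hd).2
    simp only at e ⊢
    rw [e]
    omega
  · intro c d hcd hd
    have e : ∀ c < (m + 2) / 3, 3 * (S'.mem (b + m + 8 + 2 * redLen m + (m + 2) / 3 + c) / 3) =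
        S'.mem (b + m + 8 + 2 * redLen m + (m + 2) / 3 + c) := by
      intro c hc
      obtain ⟨d, hd, e⟩ := q2.mem hc
      rw [e]; omega
    rw [e c (by omega), e d hd]
    exact sufLt_iff.2 (q2.sorted (R := fun x y => SufLt s (x + 1) (y + 1)) hsort hcd hd)

end

/-- The state of the merging of the sorted lists `X` (of length `p`) and `Y` (of length `q`), after
`k` elements have been written to `out`; `a` and `c` are the next elements. -/
structure MergeInv (s : ℕ → ℕ) (m p q : ℕ) (X Y out : ℕ → ℕ) (k a c : ℕ) : Prop where
  ha : a ≤ p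
  hc : c ≤ q
  sum : a + c + m = k + p + q
  lt : ∀ u < k, out u < m
  sorted : ∀ u v, u < v → v < k → SufLt s (out u) (out v)
  ltX : ∀ u < k, ∀ t, a ≤ t → t < p → SufLt s (out u) (X t)
  ltY : ∀ u < k, ∀ t, c ≤ t → t < q → SufLt s (out u) (Y t)

/-! ### The steps of a merge -/

section
variable {s X Y out out' : ℕ → ℕ} {m p q k a c : ℕ}

lemma MergeInv.takeX (h : MergeInv s m p q X Y out k a c) (ha : a < p) (hX : X a < m)
    (hXs : ∀ i j, i < j → j < p → SufLt s (X i) (X j))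
    (hY : ∀ t, c ≤ t → t < q → SufLt s (X a) (Y t))
    (ho : ∀ u < k, out' u = out u) (hk : out' k = X a) :
    MergeInv s m p q X Y out' (k + 1) (a + 1) c := by
  refine ⟨ha, h.hc, by have := h.sum; omega, fun u hu => ?_, fun u v huv hv => ?_,
    fun u hu t ht htp => ?_, fun u hu t ht htq => ?_⟩
  · rcases Nat.lt_succ_iff_lt_or_eq.1 hu with hu | rfl
    · rw [ho u hu]; exact h.lt u hu
    · rwa [hk]
  · rw [ho u (by omega)]
    rcases Nat.lt_succ_iff_lt_or_eq.1 hv with hv | rfl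
    · rw [ho v hv]; exact h.sorted u v huv hv
    · rw [hk]; exact h.ltX u huv a le_rfl ha
  · rcases Nat.lt_succ_iff_lt_or_eq.1 hu with hu | rfl
    · rw [ho u hu]; exact h.ltX u hu t (by omega) htp
    · rw [hk]; exact hXs a t ht htp
  · rcases Nat.lt_succ_iff_lt_or_eq.1 hu with hu | rfl
    · rw [ho u hu]; exact h.ltY u hu t ht htq
    · rw [hk]; exact hY t ht htq

lemma MergeInv.takeY (h : MergeInv s m p q X Y out k a c) (hc : c < q) (hY : Y c < m)
    (hYs : ∀ i j, i < j → j < q → SufLt s (Y i) (Y j))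
    (hX : ∀ t, a ≤ t → t < p → SufLt s (Y c) (X t))
    (ho : ∀ u < k, out' u = out u) (hk : out' k = Y c) :
    MergeInv s m p q X Y out' (k + 1) a (c + 1) := by
  refine ⟨h.ha, hc, by have := h.sum; omega, fun u hu => ?_, fun u v huv hv => ?_,
    fun u hu t ht htp => ?_, fun u hu t ht htq => ?_⟩
  · rcases Nat.lt_succ_iff_lt_or_eq.1 hu with hu | rfl
    · rw [ho u hu]; exact h.lt u hu
    · rwa [hk]
  · rw [ho u (by omega)]
    rcases Nat.lt_succ_iff_lt_or_eq.1 hv with hv | rfl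
    · rw [ho v hv]; exact h.sorted u v huv hv
    · rw [hk]; exact h.ltY u huv c le_rfl hc
  · rcases Nat.lt_succ_iff_lt_or_eq.1 hu with hu | rfl
    · rw [ho u hu]; exact h.ltX u hu t ht htp
    · rw [hk]; exact hX t ht htp
  · rcases Nat.lt_succ_iff_lt_or_eq.1 hu with hu | rfl
    · rw [ho u hu]; exact h.ltY u hu t (by omega) htq
    · rw [hk]; exact hYs c t ht htq

end

/-- `fl := 1` if `(x0, x1, x2)` is lexicographically smaller than `(y0, y1, y2)`. -/
def lexLess : Stmt :=
  .fl ::= lit(0) ;;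
  .ite (.lt (Exp.var .x0) (Exp.var .y0)) (.fl ::= lit(1))
    (.ite (.eq (Exp.var .x0) (Exp.var .y0))
      (.ite (.lt (Exp.var .x1) (Exp.var .y1)) (.fl ::= lit(1))
        (.ite (.eq (Exp.var .x1) (Exp.var .y1))
          (.ite (.lt (Exp.var .x2) (Exp.var .y2)) (.fl ::= lit(1)) .skip) .skip)) .skip)

/-- Compare the next multiple of three with the next element of the sample. -/
def compareNext : Stmt :=
  .u ::= M[Exp.var .A + Exp.var .a] ;;
  .x ::= M[Exp.var .C + Exp.var .c] ;;
  .y ::= Exp.var .x / lit(3) ;;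
  .x0 ::= M[Exp.var .b + Exp.var .x] ;;
  .ite (.lt (Exp.var .u) (Exp.var .n0))
    (.y0 ::= M[Exp.var .b + (lit(3) * Exp.var .u + lit(1))] ;;
      .x1 ::= M[Exp.var .bR + Exp.var .y] ;;
      .y1 ::= M[Exp.var .bR + (Exp.var .n0 + Exp.var .u)] ;;
      .x2 ::= lit(0) ;; .y2 ::= lit(0))
    (.z ::= Exp.var .u - Exp.var .n0 ;;
      .y0 ::= M[Exp.var .b + (lit(3) * Exp.var .z + lit(2))] ;;
      .x1 ::= M[Exp.var .b + (Exp.var .x + lit(1))] ;;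
      .y1 ::= M[Exp.var .b + (lit(3) * Exp.var .z + lit(3))] ;;
      .x2 ::= M[Exp.var .bR + (Exp.var .n0 + Exp.var .y)] ;;
      .y2 ::= M[Exp.var .bR + (Exp.var .z + lit(1))]) ;;
  lexLess

section
variable {E : Env} {S : St} {b m K : ℕ} {s A : ℕ → ℕ}

lemma ok_lexLess (hW : 1 < E.wordBound) :
    Ok E lexLess S 40 fun S' => S'.mem = S.mem ∧
      (S'.var .fl = 1 ↔ S.var .x0 < S.var .y0 ∨ S.var .x0 = S.var .y0 ∧
        (S.var .x1 < S.var .y1 ∨ S.var .x1 = S.var .y1 ∧ S.var .x2 < S.var .y2)) := by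
  simp only [Ok, lexLess, wp_seq, wp_assign, wp_ite, wp_skip]
  simp
  refine ⟨by omega, fun _ => ⟨hW, by omega⟩, fun _ => ⟨fun _ => ⟨fun _ => ⟨hW, by omega⟩,
    fun _ => ⟨fun _ => ⟨fun _ => ⟨hW, by omega⟩, fun _ => by omega⟩, fun _ => by omega⟩⟩,
    fun _ => by omega⟩⟩

/-- Against the first class one symbol and a rank are compared, against the second two symbols and a
rank. Zeros in the third components let `lexLess` serve both cases. -/
lemma ok_compareNext (h : UpState S b m K s A) (hs : Padded s m) {r w : ℕ → ℕ} {a c : ℕ}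
    (hred : IsReduction s m r) (hA : SortsSuffixes r (redLen m) A)
    (hrk : IsRank (redLen m) A (fun u => S.mem (b + m + 4 + u)))
    (ha : S.var .a = a) (hc : S.var .c = c) (hap : a < redLen m) (hcp : c < (m + 2) / 3)
    (hX : samplePos m (A a) < m)
    (hw : S.mem (b + m + 8 + 2 * redLen m + (m + 2) / 3 + c) = 3 * w c) (hw' : w c < (m + 2) / 3)
    (hsz : b + m + 9 + 2 * redLen m + 2 * ((m + 2) / 3) + m ≤ E.size)
    (hW : 4 * E.size + 10 ≤ E.wordBound) :
    Ok E compareNext S 200 fun S' => S'.mem = S.mem ∧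
      (S'.var .fl = 1 ↔ SufLt s (3 * w c) (samplePos m (A a))) := by
  have hr : redLen m = (m + 2) / 3 + m / 3 := rfl
  have e1 := h.arr a hap
  have e2 := hA.lt a hap
  have e3 : ∀ i < m + 3, S.mem (b + i) = s i := h.str
  have e4 : 3 * w c / 3 = w c := by omega
  have t0 := e3 (3 * w c) (by omega)
  simp only [Ok, compareNext, wp_seq, wp_assign, wp_ite]
  simp only [Exp.val_add, Exp.val_var, Exp.val_mem, Exp.val_const, Exp.val_div, Exp.val_mul, Exp.val_sub,
    Exp.ok_add, Exp.ok_var, Exp.ok_mem, Exp.ok_const, Exp.ok_div, Exp.ok_mul, Exp.ok_sub, St.set_var,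
    St.set_mem, reduceCtorEq, if_true, if_false, Cond.ok_lt, Cond.val_lt, true_and, and_true, h.vA, h.vC, h.vb,
    h.vbR, h.vn0, ha, hc, e1, hw, e4, t0]
  refine ⟨by omega, by omega, by omega, by omega, fun hu => ?_, fun hu => ?_⟩
  · have hu' : samplePos m (A a) = 3 * A a + 1 := by rw [samplePos, if_pos hu]
    rw [hu'] at hX ⊢
    have t1 := e3 (3 * A a + 1) (by omega)
    refine ⟨by omega, by omega, by omega, by omega, by omega, (ok_lexLess (by omega)).wp ?_⟩
    rintro u S' hu ⟨q1, q2⟩ -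
    refine ⟨by simp at hu; omega, by rw [q1]; rfl, ?_⟩
    rw [q2, compare_one hred hs hA hrk (by omega) hX]
    simp [t1]
  · have hu' : samplePos m (A a) = 3 * (A a - (m + 2) / 3) + 2 := by rw [samplePos, if_neg hu]
    rw [hu'] at hX ⊢
    have t1 := e3 (3 * (A a - (m + 2) / 3) + 2) (by omega)
    have t2 := e3 (3 * w c + 1) (by omega)
    have t3 := e3 (3 * (A a - (m + 2) / 3) + 3) (by omega)
    refine ⟨by omega, by omega, by omega, by omega, by omega, (ok_lexLess (by omega)).wp ?_⟩
    rintro u S' hu ⟨q1, q2⟩ -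
    refine ⟨by simp at hu; omega, by rw [q1]; rfl, ?_⟩
    rw [q2, compare_two hred hs hA hrk (by omega) hX]
    simp [t1, t2, t3]

/-- Decide which list provides the next element. -/
def chooseNext : Stmt :=
  .ite (.lt (Exp.var .a) (Exp.var .m1))
    (.ite (.lt (Exp.var .c) (Exp.var .n0)) compareNext (.fl ::= lit(0)))
    (.fl ::= lit(1))

def takeNext : Stmt :=
  .ite (.eq (Exp.var .fl) lit(1))
    (Exp.var .D + Exp.var .k ::=ₘ M[Exp.var .C + Exp.var .c] ;; .c ::= Exp.var .c + lit(1))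
    (.u ::= M[Exp.var .A + Exp.var .a] ;;
      .ite (.lt (Exp.var .u) (Exp.var .n0))
        (Exp.var .D + Exp.var .k ::=ₘ lit(3) * Exp.var .u + lit(1))
        (Exp.var .D + Exp.var .k ::=ₘ lit(3) * (Exp.var .u - Exp.var .n0) + lit(2)) ;;
      .a ::= Exp.var .a + lit(1))

/-- The start m1 + n0 - m of `a` is 1 for m ≡ 1 mod 3 and 0 otherwise. It skips the empty suffix,
which is the least of the sample when present. -/
def mergeAll : Stmt :=
  .a ::= Exp.var .m1 + Exp.var .n0 - Exp.var .m ;; .c ::= lit(0) ;;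
  .forTo .k .m (chooseNext ;; takeNext)

lemma ok_chooseNext (h : UpState S b m K s A) (hs : Padded s m) {r w : ℕ → ℕ} {a c : ℕ}
    (hred : IsReduction s m r) (hA : SortsSuffixes r (redLen m) A)
    (hrk : IsRank (redLen m) A (fun u => S.mem (b + m + 4 + u)))
    (ha : S.var .a = a) (hc : S.var .c = c) (hac : a < redLen m ∨ c < (m + 2) / 3)
    (hX : a < redLen m → samplePos m (A a) < m)
    (hw : ∀ c < (m + 2) / 3, S.mem (b + m + 8 + 2 * redLen m + (m + 2) / 3 + c) = 3 * w c ∧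
      w c < (m + 2) / 3)
    (hsz : b + m + 9 + 2 * redLen m + 2 * ((m + 2) / 3) + m ≤ E.size)
    (hW : 4 * E.size + 10 ≤ E.wordBound) :
    Ok E chooseNext S 220 fun S' => S'.mem = S.mem ∧
      (S'.var .fl = 1 → c < (m + 2) / 3 ∧
        (a < redLen m → SufLt s (3 * w c) (samplePos m (A a)))) ∧
      (S'.var .fl ≠ 1 → a < redLen m ∧
        (c < (m + 2) / 3 → SufLt s (samplePos m (A a)) (3 * w c))) := by
  rw [Ok, chooseNext, wp_ite, wp_ite]
  refine ⟨⟨trivial, trivial⟩, fun h1 => ⟨⟨trivial, trivial⟩, fun h2 => ?_, fun h2 => ?_⟩, fun h1 => ?_⟩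
  · simp only [Cond.val_lt, Exp.val_var, ha, hc, h.vm1, h.vn0] at h1 h2
    obtain ⟨w1, w2⟩ := hw c h2
    refine (ok_compareNext h hs hred hA hrk ha hc h1 h2 (hX h1) w1 w2 hsz hW).wp ?_
    rintro u S' hu ⟨q1, q2⟩ -
    simp at hu
    refine ⟨by omega, q1, fun hf => ⟨h2, fun _ => q2.1 hf⟩, fun hf => ⟨h1, fun _ => ?_⟩⟩
    have hne : 3 * w c ≠ samplePos m (A a) := by
      have := samplePos_mod m (A a)
      omega
    rcases hs.total hne (Or.inr (hX h1)) with h3 | h3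
    · exact absurd (q2.2 h3) hf
    · exact h3
  · simp only [Cond.val_lt, Exp.val_var, ha, hc, h.vm1, h.vn0] at h1 h2
    simp [h1, h2]
    omega
  · simp only [Cond.val_lt, Exp.val_var, ha, h.vm1] at h1
    simp [h1]
    omega

lemma ok_takeNext (h : UpState S b m K s A) {w : ℕ → ℕ} {a c k : ℕ}
    (ha : S.var .a = a) (hc : S.var .c = c) (hk : S.var .k = k) (hkm : k < m)
    (hfl : S.var .fl = 1 → c < (m + 2) / 3) (hfl' : S.var .fl ≠ 1 → a < redLen m)
    (hA : ∀ t < redLen m, A t < redLen m)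
    (hw : ∀ c < (m + 2) / 3, S.mem (b + m + 8 + 2 * redLen m + (m + 2) / 3 + c) = 3 * w c ∧
      w c < (m + 2) / 3)
    (hsz : b + m + 9 + 2 * redLen m + 2 * ((m + 2) / 3) + m ≤ E.size)
    (hW : 4 * E.size + 10 ≤ E.wordBound) :
    Ok E takeNext S 60 fun S' =>
      S'.mem = Function.update S.mem (b + m + 8 + 2 * redLen m + 2 * ((m + 2) / 3) + k)
        (if S.var .fl = 1 then 3 * w c else samplePos m (A a)) ∧
      S'.var .a = (if S.var .fl = 1 then a else a + 1) ∧
      S'.var .c = (if S.var .fl = 1 then c + 1 else c) := by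
  have hr : redLen m = (m + 2) / 3 + m / 3 := rfl
  rw [Ok, takeNext, wp_ite]
  refine ⟨⟨trivial, by simp; omega⟩, fun hf => ?_, fun hf => ?_⟩
  · simp only [Cond.val_eq, Exp.val_var, Exp.val_const] at hf
    have hcm := hfl hf
    have := (hw c hcm).1
    simp only [wp_seq, wp_put, wp_assign]
    simp [h.vD, h.vC, hk, hc, ha, hf, this]
    omega
  · simp only [Cond.val_eq, Exp.val_var, Exp.val_const] at hf
    have ham := hfl' hf
    have e := h.arr a ham
    have := hA a ham
    simp only [wp_seq, wp_put, wp_assign, wp_ite]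
    simp [h.vD, h.vA, h.vn0, hk, hc, ha, hf, e, samplePos]
    refine ⟨by omega, fun hu => ⟨by omega, by omega, by simp [hu]⟩, fun hu => ⟨by omega, by omega, ?_⟩⟩
    rw [if_neg (by omega)]

lemma ok_mergeAll (h : UpState S b m K s A) (hs : Padded s m) {r w : ℕ → ℕ}
    (hred : IsReduction s m r) (hA : SortsSuffixes r (redLen m) A)
    (hrk : IsRank (redLen m) A (fun u => S.mem (b + m + 4 + u)))
    (hw : ∀ c < (m + 2) / 3, S.mem (b + m + 8 + 2 * redLen m + (m + 2) / 3 + c) = 3 * w c ∧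
      w c < (m + 2) / 3)
    (hws : ∀ c d, c < d → d < (m + 2) / 3 → SufLt s (3 * w c) (3 * w d))
    (hsz : b + m + 9 + 2 * redLen m + 2 * ((m + 2) / 3) + m ≤ E.size)
    (hW : 4 * E.size + 10 ≤ E.wordBound) :
    Ok E mergeAll S (300 * m + 30) fun S' =>
      (∀ x < b + m + 8 + 2 * redLen m + 2 * ((m + 2) / 3), S'.mem x = S.mem x) ∧
      SortsSuffixes s m
        (fun k => S'.mem (b + m + 8 + 2 * redLen m + 2 * ((m + 2) / 3) + k)) := by
  have hr : redLen m = (m + 2) / 3 + m / 3 := rfl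
  rw [Ok, mergeAll]
  simp only [wp_seq, wp_assign]
  refine ⟨by simp [h.vm1, h.vn0]; omega, by simp; omega, ?_⟩
  refine Ok.wp (ok_forTo (N := m) (B := 285) (I := fun k S' =>
    (∀ x < b + m + 8 + 2 * redLen m + 2 * ((m + 2) / 3), S'.mem x = S.mem x) ∧
    redLen m + (m + 2) / 3 ≤ m + S'.var .a ∧
    MergeInv s m (redLen m) ((m + 2) / 3) (fun t => samplePos m (A t)) (fun c => 3 * w c)
      (fun k => S'.mem (b + m + 8 + 2 * redLen m + 2 * ((m + 2) / 3) + k)) k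
      (S'.var .a) (S'.var .c))
    (by simp [h.vm]) (by omega) rfl rfl (by decide) ?_ ?_) ?_
  · refine ⟨by simp, by simp [h.vm1, h.vn0, h.vm]; omega, ?_⟩
    constructor <;> simp [h.vm1, h.vn0, h.vm] <;> omega
  · rintro k S1 hk ⟨h1, h1a, h2⟩ hi hf
    have hu : UpState S1 b m K s A := by
      have h0 : UpState ((S.set .a (Exp.val E S (Exp.var .m1 + Exp.var .n0 - Exp.var .m))).set .c
          (Exp.val E (S.set .a (Exp.val E S (Exp.var .m1 + Exp.var .n0 - Exp.var .m))) lit(0)))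
          b m K s A :=
        h.of_frame (c := .a ::= lit(0) ;; .c ::= lit(0))
          (fun x hx => by simp [Stmt.writes] at hx; simp [hx])
          ⟨rfl, rfl, rfl, rfl, rfl, rfl, rfl, rfl, rfl, rfl⟩ (fun _ _ => rfl) (fun _ _ => rfl)
      exact h0.of_frame hf ⟨rfl, rfl, rfl, rfl, rfl, rfl, rfl, rfl, rfl, rfl⟩
        (fun x hx => h1 x (by omega)) (fun t ht => h1 _ (by omega))
    have hrk1 : IsRank (redLen m) A (fun u => S1.mem (b + m + 4 + u)) := by
      refine ⟨fun t ht => ?_, ?_⟩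
      · have := hA.lt t ht
        have := hrk.rank t ht
        show S1.mem (b + m + 4 + A t) = t + 1
        rw [h1 _ (by omega)]; exact this
      · have := hrk.pad
        show S1.mem (b + m + 4 + redLen m) = 0
        rw [h1 _ (by omega)]; exact this
    have hw1 : ∀ c < (m + 2) / 3,
        S1.mem (b + m + 8 + 2 * redLen m + (m + 2) / 3 + c) = 3 * w c ∧ w c < (m + 2) / 3 :=
      fun c hc => ⟨by rw [h1 _ (by omega), (hw c hc).1], (hw c hc).2⟩
    have hsum := h2.sum
    have hha := h2.ha
    have hhc := h2.hc
    -- From the initial value of `a` on, the sample contains only nonempty suffixes; the lower bound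
    -- on `a` in the invariant is kept for this purpose.
    have hX : ∀ t, S1.var .a ≤ t → t < redLen m → samplePos m (A t) < m := fun t ht htp =>
      sample_lt hred hs hA htp (by omega)
    have hXs : ∀ i j, i < j → j < redLen m → SufLt s (samplePos m (A i)) (samplePos m (A j)) :=
      fun i j hij hj => sample_sorted hred hs hA hij hj
    rw [wp_seq]
    refine (ok_chooseNext hu hs hred hA hrk1 rfl rfl (by omega) (hX _ le_rfl) hw1 hsz hW).wp ?_
    rintro t2 S2 ht2 ⟨q1, q2, q3⟩ f2
    have hu2 : UpState S2 b m K s A := hu.of_frame f2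
      ⟨rfl, rfl, rfl, rfl, rfl, rfl, rfl, rfl, rfl, rfl⟩ (fun _ _ => by rw [q1]) (fun _ _ => by rw [q1])
    have ea : S2.var .a = S1.var .a := f2 _ rfl
    have ec : S2.var .c = S1.var .c := f2 _ rfl
    have ek : S2.var .k = k := (f2 _ rfl).trans hi
    refine (ok_takeNext hu2 ea ec ek hk (fun hf => (q2 hf).1) (fun hf => (q3 hf).1) hA.lt
      (by rw [q1]; exact hw1) hsz hW).wp ?_
    rintro t3 S3 ht3 ⟨p1, p2, p3⟩ -
    rw [q1] at p1
    have ho : ∀ u < k, S3.mem (b + m + 8 + 2 * redLen m + 2 * ((m + 2) / 3) + u) =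
        S1.mem (b + m + 8 + 2 * redLen m + 2 * ((m + 2) / 3) + u) := fun u hu => by
      rw [p1, Function.update_of_ne (by omega)]
    have hok : S3.mem (b + m + 8 + 2 * redLen m + 2 * ((m + 2) / 3) + k) = _ :=
      (congrFun p1 _).trans (Function.update_self _ _ _)
    refine ⟨by omega, fun x hx => ?_, ?_, ?_⟩
    · simp only [St.set_mem]
      rw [p1, Function.update_of_ne (by omega), h1 x hx]
    · simp only [St.set_var, reduceCtorEq, if_false, p2]
      split_ifs <;> omega
    · simp only [St.set_var, St.set_mem, reduceCtorEq, if_false, p2, p3]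
      by_cases hfl : S2.var .fl = 1
      · obtain ⟨g1, g2⟩ := q2 hfl
        simp only [hfl, if_true] at hok ⊢
        refine h2.takeY g1 (by have := (hw _ g1).2; omega) hws (fun t ht htp => ?_) ho hok
        rcases ht.lt_or_eq with ht | rfl
        · exact (g2 (by omega)).trans (hXs _ _ ht htp)
        · exact g2 htp
      · obtain ⟨g1, g2⟩ := q3 hfl
        simp only [hfl, if_false] at hok ⊢
        refine h2.takeX g1 (hX _ le_rfl g1) hXs (fun t ht htq => ?_) ho hok
        rcases ht.lt_or_eq with ht | rfl
        · exact (g2 (by omega)).trans (hws _ _ ht htq)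
        · exact g2 htq
  · rintro u1 S1 hu1 ⟨⟨h1, -, h2⟩, -⟩ -
    exact ⟨by simp at hu1; omega, h1, h2.lt, h2.sorted⟩

end

/-- The result has to stand right behind the string and its header, where the next pass upwards
expects it. The merge cannot write there directly, because it still reads the ranks stored there. -/
def copyBack : Stmt :=
  .forTo .k .m (Exp.var .bR + Exp.var .k ::=ₘ M[Exp.var .D + Exp.var .k])

/-- From the sorted suffixes of the reduced string to those of the string. -/
def levelUp : Stmt :=
  upInit ;; computeRanks ;; listMultiples ;; sortMultiples ;; mergeAll ;; copyBack

section
variable {E : Env} {S : St} {b m K sg : ℕ} {s A : ℕ → ℕ}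

lemma ok_copyBack (h : UpState S b m K s A)
    (hsz : b + m + 9 + 2 * redLen m + 2 * ((m + 2) / 3) + m ≤ E.size)
    (hW : 4 * E.size + 10 ≤ E.wordBound) :
    Ok E copyBack S (50 * m + 6) fun S' =>
      (∀ x < b + m + 4, S'.mem x = S.mem x) ∧
      ∀ k < m, S'.mem (b + m + 4 + k) =
        S.mem (b + m + 8 + 2 * redLen m + 2 * ((m + 2) / 3) + k) := by
  have hr : redLen m = (m + 2) / 3 + m / 3 := rfl
  rw [copyBack]
  refine (ok_forTo (N := m) (B := 41) (I := fun k S' =>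
    (∀ x, (x < b + m + 4 ∨ b + m + 8 + 2 * redLen m + 2 * ((m + 2) / 3) ≤ x) →
      S'.mem x = S.mem x) ∧
    ∀ u < k, S'.mem (b + m + 4 + u) = S.mem (b + m + 8 + 2 * redLen m + 2 * ((m + 2) / 3) + u))
    h.vm (by omega) rfl rfl (by decide) (by simp) ?_).mono (by omega)
    (fun S' h _ => ⟨fun x hx => h.1.1 x (Or.inl hx), h.1.2⟩)
  rintro k S1 hk ⟨h1, h2⟩ hi hf
  have eD : S1.var .D = _ := (hf _ rfl).trans h.vD
  have er : S1.var .bR = _ := (hf _ rfl).trans h.vbR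
  have e := h1 (b + m + 8 + 2 * redLen m + 2 * ((m + 2) / 3) + k) (Or.inr (by omega))
  refine wp_put.2 ⟨by simp [eD, er, hi]; omega, by simp, fun x hx => ?_, fun u hu => ?_⟩
  · have : x ≠ b + m + 4 + k := by omega
    simp [eD, er, hi, this, h1 x hx]
  · simp only [eD, er, hi, St.set_mem, St.write_mem, Exp.val_add, Exp.val_var, Exp.val_mem, e,
      Function.update_apply, Nat.add_left_cancel_iff]
    split_ifs with hc
    · rw [hc]
    · exact h2 u (by omega)

lemma ok_levelUp {r : ℕ → ℕ} (hb : S.var .b = b + m + 4) (hm : S.var .m = redLen m)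
    (hsg : S.var .sg = sg) (hhd : S.mem (b + m + 3) = m) (hs : StringAt S.mem b m s)
    (hsK : ∀ i, s i ≤ if b = 0 then sg else m) (hred : IsReduction s m r)
    (hpad : S.mem (b + m + 4 + redLen m) = 0)
    (hA : SortsSuffixes r (redLen m) (fun t => S.mem (b + m + 4 + redLen m + 4 + t)))
    (hsz : b + m + 9 + 2 * redLen m + 2 * ((m + 2) / 3) + m ≤ E.size)
    (hsz' : b + m + 9 + 2 * redLen m + 2 * ((m + 2) / 3) + (if b = 0 then sg else m) ≤ E.size)
    (hW : 4 * E.size + 10 ≤ E.wordBound) :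
    Ok E levelUp S (800 * (m + (if b = 0 then sg else m) + 1)) fun S' =>
      S'.var .b = b ∧ S'.var .m = m ∧ (∀ x < b + m + 3, S'.mem x = S.mem x) ∧
      SortsSuffixes s m (fun t => S'.mem (b + m + 4 + t)) := by
  have hr : redLen m = (m + 2) / 3 + m / 3 := rfl
  set A : ℕ → ℕ := fun t => S.mem (b + m + 4 + redLen m + 4 + t) with hAdef
  rw [Ok, levelUp]
  simp only [wp_seq]
  refine (ok_upInit hb hm hsg hhd hs.mem (A := A) (fun t ht => by rw [hAdef]; congr 1; omega)
    hsz hW).wp ?_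
  rintro u1 S1 hu1 ⟨h1, m1⟩ -
  refine (ok_computeRanks h1 hA (by rw [m1]; exact hpad) hsz hW).wp ?_
  rintro u2 S2 hu2 ⟨h2, m2, rk2⟩ -
  refine (ok_listMultiples h2 hA hsz hW).wp ?_
  rintro u3 S3 hu3 ⟨h3, m3, l3⟩ -
  obtain ⟨w0, hw0, hs0⟩ := sortedBy_rank hred hs.padded hA
    (B := fun c => S3.mem (b + m + 8 + 2 * redLen m + c)) l3
  refine (ok_sortMultiples h3 hsK hw0 hs0 hsz hsz' hW).wp ?_
  rintro u4 S4 hu4 ⟨h4, m4, w, hw, hws⟩ -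
  have rk4 : IsRank (redLen m) A (fun u => S4.mem (b + m + 4 + u)) := by
    refine ⟨fun t ht => ?_, ?_⟩
    · have := hA.lt t ht
      have e := rk2.rank t ht
      show S4.mem (b + m + 4 + A t) = t + 1
      rw [m4 _ (by omega), m3 _ (by omega)]; exact e
    · have e := rk2.pad
      show S4.mem (b + m + 4 + redLen m) = 0
      rw [m4 _ (by omega), m3 _ (by omega)]; exact e
  refine (ok_mergeAll h4 hs.padded hred hA rk4 hw hws hsz hW).wp ?_
  rintro u5 S5 hu5 ⟨m5, s5⟩ f5
  have h5 : UpState S5 b m _ s A := h4.of_frame f5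
    ⟨rfl, rfl, rfl, rfl, rfl, rfl, rfl, rfl, rfl, rfl⟩
    (fun x hx => m5 x (by omega)) (fun t ht => m5 _ (by omega))
  refine (ok_copyBack h5 hsz hW).wp ?_
  rintro u6 S6 hu6 ⟨m6, c6⟩ f6
  refine ⟨?_, (f6 _ rfl).trans h5.vb, (f6 _ rfl).trans h5.vm, fun x hx => ?_, ?_, ?_⟩
  · generalize (if b = 0 then sg else m) = K at *
    omega
  · rw [m6 x (by omega), m5 x (by omega), m4 x (by omega), m3 x (by omega), m2 x (by omega), m1]
  · intro k hk
    show S6.mem (b + m + 4 + k) < m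
    rw [c6 k hk]; exact s5.lt k hk
  · intro i j hij hj
    show SufLt s (S6.mem (b + m + 4 + i)) (S6.mem (b + m + 4 + j))
    rw [c6 i (by omega), c6 j hj]; exact s5.sorted i j hij hj

/-- The strings of all levels stand in the memory; the last one is `s`, of length `m`, at `b`. -/
inductive Levels (sg n : ℕ) (s₀ M : ℕ → ℕ) : ℕ → ℕ → (ℕ → ℕ) → Prop
  | base (h : StringAt M 0 n s₀) (hs : ∀ i, s₀ i ≤ sg) : Levels sg n s₀ M 0 n s₀
  | push {b m : ℕ} {s r : ℕ → ℕ} (h : Levels sg n s₀ M b m s) (hm : 2 ≤ m)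
      (hh : M (b + m + 3) = m) (hr : IsReduction s m r) (hs : ∀ i, r i ≤ redLen m)
      (hm : StringAt M (b + m + 4) (redLen m) r) : Levels sg n s₀ M (b + m + 4) (redLen m) r

/-! ### Space and time of the stack of strings -/

variable {n : ℕ} {s₀ M M' : ℕ → ℕ}

lemma StringAt.congr (h : StringAt M b m s) (hM : ∀ x < b + m + 3, M' x = M x) :
    StringAt M' b m s :=
  ⟨h.padded, fun i hi => by rw [hM _ (by omega), h.mem i hi]⟩

lemma Levels.congr (h : Levels sg n s₀ M b m s) (hM : ∀ x < b + m + 3, M' x = M x) :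
    Levels sg n s₀ M' b m s := by
  induction h with
  | base h hs => exact .base (h.congr hM) hs
  | push h hm hh hr hs hs' ih =>
    exact .push (ih fun x hx => hM x (by omega)) hm (by rw [hM _ (by omega), hh]) hr hs
      (hs'.congr hM)

lemma Levels.stringAt (h : Levels sg n s₀ M b m s) : StringAt M b m s := by
  cases h with
  | base h hs => exact h
  | push h hm hh hr hs hs' => exact hs'

lemma Levels.le (h : Levels sg n s₀ M b m s) (i : ℕ) : s i ≤ if b = 0 then sg else m := by
  cases h with
  | base h hs => exact hs i
  | push h hm hh hr hs hs' => rw [if_neg (by omega)]; exact hs i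

/-- Length 1 is excluded, as it reduces to length 1 again; there the descent stops. -/
lemma redLen_bounds (hm : 2 ≤ m) : 1 ≤ redLen m ∧ redLen m + 1 ≤ m ∧ 3 * redLen m ≤ 2 * m + 2 := by
  have : redLen m = (m + 2) / 3 + m / 3 := rfl
  omega

/-- A step down replaces b by b + m + 4 and m by at most (2m + 2)/3. This does not increase b + 4m
when m ≥ 20. For shorter strings the increase is less than 7 while m falls by at least one, so the
last term absorbs it; 147 = 7 · 21 bounds that term at the start. -/
lemma Levels.space (h : Levels sg n s₀ M b m s) : b + 4 * m + 7 * min m 21 ≤ 4 * n + 147 := by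
  induction h with
  | base h hs => omega
  | @push b m s r h hm hh hr hs hs' ih =>
    have := redLen_bounds hm
    generalize redLen m = r at *
    omega

/-- Sort the suffixes of the string at address `0`. -/
def suffixSort : Stmt :=
  .loop (.lt lit(1) (Exp.var .m)) levelDown ;;
  Exp.var .b + Exp.var .m + lit(4) ::=ₘ lit(0) ;;
  .loop (.lt lit(0) (Exp.var .b)) levelUp

/-- The time is paid from the potential 20000 m. A level of length m costs O(m), and m - `redLen m`
is at least 1 and at least (m - 2)/3. The alphabet size is charged only at `b = 0`, once in each
direction, because elsewhere the symbols are bounded by the length. The measures are m on the way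
down and b on the way up. -/
lemma ok_suffixSort (hn : 1 ≤ n) (hb : S.var .b = 0) (hm : S.var .m = n) (hK : S.var .K = sg)
    (hsg : S.var .sg = sg) (hs : StringAt S.mem 0 n s₀) (hsK : ∀ i, s₀ i ≤ sg)
    (hsz : 4 * n + sg + 200 ≤ E.size) (hW : 4 * E.size + 10 ≤ E.wordBound) :
    Ok E suffixSort S (50000 * (n + sg + 1)) fun S' =>
      SortsSuffixes s₀ n (fun t => S'.mem (n + 4 + t)) := by
  rw [Ok, suffixSort]
  simp only [wp_seq]
  refine wp_loop (fun t S' => ∃ b m s, Levels sg n s₀ S'.mem b m s ∧ S'.var .b = b ∧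
    S'.var .m = m ∧ S'.var .K = (if b = 0 then sg else m) ∧ 1 ≤ m ∧
    t + 20000 * m + (if b = 0 then 20000 * sg else 0) ≤ 20000 * (n + sg)) (fun S' => S'.var .m)
    ⟨0, n, s₀, .base hs hsK, hb, hm, by simpa using hK, hn, by simp; omega⟩ ?_
  rintro t1 S1 ⟨b, m, s, L1, b1, m1, K1, hm1, ht1⟩ f1
  have sp := L1.space
  have hr : redLen m = (m + 2) / 3 + m / 3 := rfl
  refine ⟨by simp; omega, fun hc => ?_, fun hc => ?_⟩
  · simp [m1] at hc
    refine (ok_levelDown b1 m1 K1 L1.stringAt L1.le ?_ hW).wp ?_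
    · split_ifs <;> omega
    rintro t2 S2 ht2 ⟨b2, m2, K2, h2, q2, r, hred, hrl, hst⟩ -
    refine ⟨⟨_, _, r, .push (L1.congr q2) hc h2 hred hrl hst, b2, m2, by simp [K2], by omega, ?_⟩,
      by omega⟩
    simp only [Cond.cost_lt, Exp.cost_const, Exp.cost_var] at ht2
    have rb := redLen_bounds hc
    clear * - ht1 ht2 rb
    rw [if_neg (by omega)]
    split_ifs at ht1 ht2 <;> omega
  simp [m1] at hc
  obtain rfl : m = 1 := by omega
  -- A string of length 1 has the one suffix 0; this entry is written behind it, where the way up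
  -- looks for the sorted suffixes.
  refine wp_put.2 ⟨by simp [b1, m1]; omega, ?_⟩
  have L2 : Levels sg n s₀ (S1.write (Exp.val E S1 (Exp.var .b + Exp.var .m + lit(4)))
      (Exp.val E S1 lit(0))).mem b 1 s := by
    refine L1.congr fun x hx => ?_
    have : x ≠ b + 1 + 4 := by omega
    simp [b1, m1, this]
  have hS2 : (S1.write (Exp.val E S1 (Exp.var .b + Exp.var .m + lit(4)))
      (Exp.val E S1 lit(0))).mem (b + 1 + 4) = 0 := by simp [b1, m1]
  have hv2 : (S1.write (Exp.val E S1 (Exp.var .b + Exp.var .m + lit(4)))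
      (Exp.val E S1 lit(0))).var = S1.var := rfl
  generalize S1.write (Exp.val E S1 (Exp.var .b + Exp.var .m + lit(4)))
      (Exp.val E S1 lit(0)) = S2 at L2 hS2 hv2 ⊢
  have hsg1 : S1.var .sg = sg := (f1 _ rfl).trans hsg
  simp only [Cond.cost_lt, Exp.cost_const, Exp.cost_var, Exp.cost_add]
  refine wp_loop (fun t S' => ∃ b m s, Levels sg n s₀ S'.mem b m s ∧ S'.var .b = b ∧
    S'.var .m = m ∧ SortsSuffixes s m (fun t => S'.mem (b + m + 4 + t)) ∧
    t ≤ 20000 * (n + sg) + 100 + 20000 * m + (if b = 0 then 20000 * sg else 0)) (fun S' => S'.var .b)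
    ⟨b, 1, s, L2, by rw [hv2, b1], by rw [hv2, m1], ?_, by omega⟩ ?_
  · refine ⟨fun k hk => ?_, fun i j hij hj => by omega⟩
    obtain rfl : k = 0 := by omega
    simp only [Nat.add_zero, hS2]; omega
  rintro t3 S3 ⟨b', m', s', L3, b3, m3, A3, ht3⟩ f3
  have hsg3 : S3.var .sg = sg := (f3 _ rfl).trans (by rw [hv2]; exact hsg1)
  refine ⟨by simp; omega, fun hc => ?_, fun hc => ?_⟩
  · simp [b3] at hc
    cases L3 with
    | base h hs => omega
    | @push b'' m'' s'' r hL hm'' hh hred hs' hst =>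
      have sp'' := hL.space
      have hr'' : redLen m'' = (m'' + 2) / 3 + m'' / 3 := rfl
      have hpad : S3.mem (b'' + m'' + 4 + redLen m'') = 0 := by
        rw [hst.mem _ (by omega), hred.padded.zero _ le_rfl]
      refine (ok_levelUp b3 m3 hsg3 hh hL.stringAt hL.le hred hpad A3 (by omega) ?_ hW).wp ?_
      · split_ifs <;> omega
      rintro t4 S4 ht4 ⟨b4, m4, q4, A4⟩ -
      refine ⟨⟨b'', m'', s'', hL.congr q4, b4, m4, A4, ?_⟩, by omega⟩
      simp only [Cond.cost_lt, Exp.cost_const, Exp.cost_var] at ht4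
      rw [if_neg (by omega)] at ht3
      have rb := redLen_bounds hm''
      clear * - ht3 ht4 rb
      split_ifs at ht4 ⊢ <;> omega
  · simp [b3] at hc
    subst hc
    cases L3 with
    | base h hs =>
      refine ⟨?_, by simpa using A3⟩
      simp only [Cond.cost_lt, Exp.cost_const, Exp.cost_var]
      rw [if_pos rfl] at ht3
      omega

end

/-! ### Lyndon words and next smaller suffixes -/

section
variable {α : Type*} [LinearOrder α] {u w a b : List α}

/-- A word is smaller than another by being a prefix or by a mismatch, and the second cause survives
all continuations. -/
lemma List.prefix_or_append_lt (h : u < w) : (∃ z, w = u ++ z) ∨ ∀ a b, u ++ a < w ++ b := by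
  induction u generalizing w with
  | nil => exact Or.inl ⟨w, rfl⟩
  | cons x u ih =>
    cases w with
    | nil => exact absurd h (by simp)
    | cons y w =>
      rcases List.cons_lt_cons_iff.1 h with h | ⟨rfl, h'⟩
      · exact Or.inr fun a b => List.cons_lt_cons_iff.2 (Or.inl h)
      · rcases ih h' with ⟨z, rfl⟩ | h
        · exact Or.inl ⟨z, rfl⟩
        · exact Or.inr fun a b => List.cons_lt_cons_iff.2 (Or.inr ⟨rfl, h a b⟩)

lemma List.append_lt_append_of_length (h : u < w) (hl : w.length ≤ u.length) (a b : List α) :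
    u ++ a < w ++ b := by
  rcases prefix_or_append_lt h with ⟨z, rfl⟩ | h
  · have : z = [] := by
      rw [List.length_append] at hl
      exact List.eq_nil_of_length_eq_zero (by omega)
    simp [this] at h
  · exact h a b

lemma List.append_lt_append_iff_left : a ++ u < a ++ w ↔ u < w := by
  induction a with
  | nil => rfl
  | cons x a ih => simp [ih]

lemma List.le_append (u a : List α) : u ≤ u ++ a := by
  induction u with
  | nil => exact not_lt.1 (List.not_lt_nil a)
  | cons x u ih =>
    refine not_lt.1 fun h => not_lt.2 ih ?_
    rcases List.cons_lt_cons_iff.1 h with h | ⟨-, h⟩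
    · exact absurd h (lt_irrefl _)
    · exact h

/-- Euclid's algorithm: the shorter word is a prefix of the longer one, and cancelling it leaves a
shorter pair that still commutes. -/
lemma List.commute_power {α : Type*} {u w : List α} (n : ℕ) (h : u ++ w = w ++ u) (hn : u.length + w.length ≤ n) :
    ∃ (S : List α) (k l : ℕ), u = (List.replicate k S).flatten ∧ w = (List.replicate l S).flatten := by
  induction n generalizing u w with
  | zero =>
    refine ⟨[], 0, 0, ?_, ?_⟩ <;> exact List.eq_nil_of_length_eq_zero (by omega)
  | succ n ih =>
    wlog hl : u.length ≤ w.length generalizing u w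
    · obtain ⟨S, k, l, h1, h2⟩ := this h.symm (by omega) (by omega)
      exact ⟨S, l, k, h2, h1⟩
    rcases u.eq_nil_or_concat with rfl | hu
    · exact ⟨w, 0, 1, by simp, by simp⟩
    have hu : 0 < u.length := by
      obtain ⟨_, _, rfl⟩ := hu; simp
    have hp : u <+: w := List.prefix_of_prefix_length_le (List.prefix_append u w)
      (h ▸ List.prefix_append w u) hl
    obtain ⟨v, rfl⟩ := hp
    rw [List.append_assoc, List.append_cancel_left_eq] at h
    rw [List.length_append] at hn
    obtain ⟨S, k, l, h1, h2⟩ := ih h (by omega)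
    exact ⟨S, k, k + l, h1, by rw [List.replicate_add, List.flatten_append, ← h1, ← h2]⟩

end

section
variable {σ : ℕ} {v w : List (Fin σ)} {k : ℕ}

/-- A word that is smaller than its proper suffixes is a Lyndon word. -/
lemma isLyndonWord_of_lt_drop (hw : w ≠ []) (h : ∀ x, 0 < x → x < w.length → w < w.drop x) :
    IsLyndonWord w := by
  constructor
  · rintro ⟨S, m, hm, hS⟩
    obtain ⟨m, rfl⟩ : ∃ l, m = l + 2 := ⟨m - 2, by omega⟩
    have hS0 : S ≠ [] := by
      rintro rfl
      exact hw (by simpa using hS)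
    have hS0 := List.length_pos_iff.2 hS0
    -- The base of a proper power is both a prefix and a proper suffix, and a prefix is never larger
    -- than the word.
    have e1 : w = S ++ (List.replicate (m + 1) S).flatten := by
      rw [hS, List.replicate_succ, List.flatten_cons]
    have e2 : w = (List.replicate (m + 1) S).flatten ++ S := by
      rw [hS, show m + 2 = (m + 1) + 1 from rfl, List.replicate_add, List.flatten_append]; simp
    set V := (List.replicate (m + 1) S).flatten with hV
    have hV0 : 0 < V.length := by
      rw [hV, List.replicate_succ, List.flatten_cons, List.length_append]; omega
    have := h V.length hV0 (by rw [e2, List.length_append]; omega)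
    rw [show w.drop V.length = S by rw [e2]; simp] at this
    refine absurd this (not_lt.2 ?_)
    rw [e1]; exact List.le_append _ _
  · intro x
    rw [← List.rotate_mod]
    have hl := List.length_pos_iff.2 hw
    have hx := Nat.mod_lt x hl
    generalize x % w.length = y at hx
    rcases Nat.eq_zero_or_pos y with rfl | hy
    · simp
    · rw [List.rotate_eq_drop_append_take hx.le]
      exact (h y hy hx).le.trans (List.le_append _ _)

/-- A Lyndon word is smaller than its proper suffixes. -/
lemma IsLyndonWord.lt_drop (h : IsLyndonWord w) (hk : 0 < k) (hkw : k < w.length) :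
    w < w.drop k := by
  obtain ⟨p, u, rfl, rfl⟩ : ∃ p u, w = p ++ u ∧ k = p.length :=
    ⟨w.take k, w.drop k, (List.take_append_drop k w).symm, by simp; omega⟩
  rw [List.length_append] at hkw
  simp only [List.drop_left]
  by_contra hlt
  have hr := h.2 p.length
  rw [List.rotate_append_length_eq] at hr
  rcases (not_lt.1 hlt).eq_or_lt with e | hlt
  · have := congrArg List.length e
    rw [List.length_append] at this
    omega
  -- Here w = pu with u < w. If w = uz, comparing w with its rotations up and zu gives z ≤ p and p ≤
  -- z; so p and u commute and w is a proper power. If there is a mismatch instead, the rotation up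
  -- is smaller than w.
  rcases List.prefix_or_append_lt hlt with ⟨z, hz⟩ | hlt
  · have hl := congrArg List.length hz
    rw [List.length_append, List.length_append] at hl
    have hr' := h.2 u.length
    rw [hz, List.rotate_append_length_eq, ← hz] at hr'
    have h1 : z ≤ p := by
      rw [hz] at hr
      by_contra hc
      exact absurd (List.append_lt_append_iff_left.2 (not_le.1 hc)) (not_lt.2 hr)
    have h2 : p ≤ z := by
      by_contra hc
      exact absurd (List.append_lt_append_of_length (not_le.1 hc) (by omega) u u) (not_lt.2 hr')
    obtain rfl := le_antisymm h1 h2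
    obtain ⟨S, a, b, ha, hb⟩ := List.commute_power _ hz le_rfl
    refine h.1 ⟨S, a + b, ?_, ?_⟩
    · have ha0 : a ≠ 0 := by
        rintro rfl
        simp [ha] at hk
      have hb0 : b ≠ 0 := by
        rintro rfl
        simp [hb] at hkw
      omega
    · rw [List.replicate_add, List.flatten_append, ← ha, ← hb]
  · have := hlt p []
    rw [List.append_nil] at this
    exact absurd this (not_lt.2 hr)

/-- The longest Lyndon prefix ends before the next smaller suffix. -/
lemma isGreatest_lyndon_prefix (hk : 0 < k) (hkv : k ≤ v.length) (h : v.drop k < v)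
    (h' : ∀ x, 0 < x → x < k → v < v.drop x) :
    IsGreatest {l | l ≤ v.length ∧ IsLyndonWord (v.take l)} k := by
  constructor
  · refine ⟨hkv, isLyndonWord_of_lt_drop (by
      rw [← List.length_pos_iff, List.length_take]; omega) fun x hx hxk => ?_⟩
    replace hxk : x < k := by simp at hxk; omega
    obtain ⟨w, v', rfl, rfl⟩ : ∃ w v', v = w ++ v' ∧ k = w.length :=
      ⟨v.take k, v.drop k, (List.take_append_drop k v).symm, by simp; omega⟩
    simp only [List.drop_left, List.take_left] at h ⊢
    by_contra hc
    have hx' := h' x hx hxk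
    rw [List.drop_append_of_le_length hxk.le] at hx'
    have hlen : (w.drop x).length = w.length - x := List.length_drop
    rcases (not_lt.1 hc).eq_or_lt with e | hc
    · have := congrArg List.length e
      omega
    -- Here v = wv', and the suffix u of w is smaller than w. If w = uz, cancelling u in v < uv'
    -- gives zv' < v'. Together with v < zv', the hypothesis at |u|, and v' < v this is a cycle. A
    -- mismatch would give uv' < v directly.
    rcases List.prefix_or_append_lt hc with ⟨z, hz⟩ | hc
    · set u := w.drop x with hu
      have h2 := h' u.length (by omega) (by omega)
      rw [hz] at h2 hx' h
      rw [List.append_assoc] at h2 hx' h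
      rw [List.drop_left] at h2
      rw [List.append_lt_append_iff_left] at hx'
      exact lt_asymm (h2.trans hx') h
    · exact lt_asymm hx' (hc v' v')
  · rintro l ⟨hl, hw⟩
    by_contra hlk
    have hlk : k < l := not_le.1 hlk
    -- A longer Lyndon prefix is smaller than its own suffix at k. That suffix is shorter, so a
    -- mismatch decides, which carries over to v < `v.drop k`.
    have h1 := hw.lt_drop hk (by simp; omega)
    have h2 := List.append_lt_append_of_length h1 (by simp) (v.drop l) (v.drop l)
    rw [List.take_append_drop] at h2
    rw [← List.drop_append_of_le_length (by simp; omega), List.take_append_drop] at h2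
    exact lt_asymm h h2

end

/-! ### The order of the suffixes of a string -/

section
variable {σ : ℕ} {T : List (Fin σ)} {i j : ℕ}

lemma length_suffixAt (hi : 1 ≤ i) : (suffixAt T i).length = T.length + 1 - i := by
  rw [suffixAt, List.length_drop]; omega

lemma suffixAt_inj (hi : 1 ≤ i) (hin : i ≤ T.length + 1) (hj : 1 ≤ j) (hjn : j ≤ T.length + 1)
    (h : suffixAt T i = suffixAt T j) : i = j := by
  have := congrArg List.length h
  rw [length_suffixAt hi, length_suffixAt hj] at this
  omega

lemma suffixAt_eq_cons (hi : 1 ≤ i) (hin : i ≤ T.length) :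
    ∃ x : Fin σ, symbolAt T i = x.val ∧ suffixAt T i = x :: suffixAt T (i + 1) := by
  refine ⟨T[i - 1], ?_, ?_⟩
  · rw [symbolAt, List.getElem?_eq_getElem (by omega)]
  · rw [suffixAt, suffixAt, List.drop_eq_getElem_cons (by omega)]
    congr 2; omega

lemma suffixAt_succ_length : suffixAt T (T.length + 1) = [] := by
  simp [suffixAt]

lemma suffixAt_lt_iff (hi : 1 ≤ i) (hin : i ≤ T.length) (hj : 1 ≤ j) (hjn : j ≤ T.length) :
    suffixAt T i < suffixAt T j ↔ symbolAt T i < symbolAt T j ∨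
      symbolAt T i = symbolAt T j ∧ suffixAt T (i + 1) < suffixAt T (j + 1) := by
  obtain ⟨x, hx, ex⟩ := suffixAt_eq_cons hi hin
  obtain ⟨y, hy, ey⟩ := suffixAt_eq_cons hj hjn
  rw [ex, ey, hx, hy, List.cons_lt_cons_iff, Fin.lt_def, Fin.ext_iff]

/-- The length of the longest Lyndon factor at `i`, from the next smaller suffix `l`. -/
lemma isGreatest_lyndonLengths {l : ℕ} (hi : 1 ≤ i) (hil : i < l) (hl : l ≤ T.length + 1)
    (h : suffixAt T l < suffixAt T i) (h' : ∀ x, i < x → x < l → suffixAt T i < suffixAt T x) :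
    IsGreatest (lyndonLengths T i) (l - i) := by
  have e : ∀ x, (suffixAt T i).drop x = suffixAt T (i + x) := fun x => by
    rw [suffixAt, suffixAt, List.drop_drop]; congr 1; omega
  have := isGreatest_lyndon_prefix (v := suffixAt T i) (k := l - i) (by omega)
    (by rw [length_suffixAt hi]; omega) (by rw [e, show i + (l - i) = l by omega]; exact h)
    (fun x hx hxl => by rw [e]; exact h' _ (by omega) (by omega))
  convert this using 1
  ext x
  simp only [lyndonLengths, Set.mem_ofPred_eq, length_suffixAt hi]
  refine and_congr_left fun _ => ?_
  omega

lemma suffixRank_lt_iff (hi : 1 ≤ i) (hin : i ≤ T.length) (hj : 1 ≤ j) (hjn : j ≤ T.length) :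
    suffixRank T i < suffixRank T j ↔ suffixAt T i < suffixAt T j := by
  have key : ∀ {i j}, 1 ≤ j → j ≤ T.length → suffixAt T i < suffixAt T j →
      suffixRank T i < suffixRank T j := by
    intro i j hj hjn h
    refine Finset.card_lt_card ⟨fun x hx => ?_, fun hs => ?_⟩
    · rw [Finset.mem_filter] at hx ⊢
      exact ⟨hx.1, hx.2.trans h.le⟩
    · have := hs (Finset.mem_filter.2 ⟨Finset.mem_Icc.2 ⟨hj, hjn⟩, le_rfl⟩)
      exact absurd (Finset.mem_filter.1 this).2 (not_le.2 h)
  refine ⟨fun h => ?_, key hj hjn⟩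
  rcases lt_trichotomy (suffixAt T i) (suffixAt T j) with h' | h' | h'
  · exact h'
  · rw [suffixRank, suffixRank, h'] at h
    exact absurd h (lt_irrefl _)
  · exact absurd (key hi hin h') (lt_asymm h)

lemma suffixRank_inj (hi : 1 ≤ i) (hin : i ≤ T.length) (hj : 1 ≤ j) (hjn : j ≤ T.length)
    (h : suffixRank T i = suffixRank T j) : i = j := by
  by_contra hne
  rcases lt_trichotomy (suffixAt T i) (suffixAt T j) with h' | h' | h'
  · exact absurd ((suffixRank_lt_iff hi hin hj hjn).2 h') (by omega)
  · exact hne (suffixAt_inj hi (by omega) hj (by omega) h')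
  · exact absurd ((suffixRank_lt_iff hj hjn hi hin).2 h') (by omega)

lemma suffixRank_mem (hi : 1 ≤ i) (hin : i ≤ T.length) :
    1 ≤ suffixRank T i ∧ suffixRank T i ≤ T.length := by
  constructor
  · exact Finset.card_pos.2 ⟨i, Finset.mem_filter.2 ⟨Finset.mem_Icc.2 ⟨hi, hin⟩, le_rfl⟩⟩
  · exact (Finset.card_filter_le _ _).trans (by simp)

lemma exists_suffixRank_eq {r : ℕ} (hr : 1 ≤ r) (hrn : r ≤ T.length) :
    ∃ j, 1 ≤ j ∧ j ≤ T.length ∧ suffixRank T j = r := by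
  have := Finset.surjOn_of_injOn_of_card_le (s := Finset.Icc 1 T.length)
    (t := Finset.Icc 1 T.length) (suffixRank T)
    (fun i hi => by
      simp only [Finset.coe_Icc, Set.mem_Icc] at hi ⊢
      exact suffixRank_mem hi.1 hi.2)
    (fun i hi j hj h => by
      simp only [Finset.coe_Icc, Set.mem_Icc] at hi hj
      exact suffixRank_inj hi.1 hi.2 hj.1 hj.2 h) le_rfl
  obtain ⟨j, hj, e⟩ := this (show r ∈ _ by simp [hr, hrn])
  simp only [Finset.coe_Icc, Set.mem_Icc] at hj
  exact ⟨j, hj.1, hj.2, e⟩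

lemma isSuffixArray_of_rank {A : ℕ → ℕ} (h : ∀ j, 1 ≤ j → j ≤ T.length → A (suffixRank T j) = j) :
    IsSuffixArray T A := by
  constructor
  · intro i hi hin
    obtain ⟨j, h1, h2, rfl⟩ := exists_suffixRank_eq hi hin
    rw [h j h1 h2]; exact ⟨h1, h2⟩
  · intro i i' hi hii hin
    obtain ⟨j, h1, h2, rfl⟩ := exists_suffixRank_eq (T := T) hi (by omega)
    obtain ⟨j', h1', h2', rfl⟩ := exists_suffixRank_eq (T := T) (r := i') (by omega) hin
    rw [h j h1 h2, h j' h1' h2']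
    exact (suffixRank_lt_iff h1 h2 h1' h2').1 hii

/-- A strictly increasing map of {1, …, n} into itself is the identity; the two bounds are
inductions from the two ends. -/
lemma IsSuffixArray.rank {A : ℕ → ℕ} (h : IsSuffixArray T A) {i : ℕ} (hi : 1 ≤ i)
    (hin : i ≤ T.length) : suffixRank T (A i) = i := by
  have hm : ∀ i j, 1 ≤ i → i < j → j ≤ T.length → suffixRank T (A i) < suffixRank T (A j) := by
    intro i j hi hij hj
    obtain ⟨a, b⟩ := h.1 i hi (by omega)
    obtain ⟨a', b'⟩ := h.1 j (by omega) hj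
    exact (suffixRank_lt_iff a b a' b').2 (h.2 i j hi hij hj)
  have h1 : ∀ i, 1 ≤ i → i ≤ T.length → i ≤ suffixRank T (A i) := by
    intro i hi
    induction i, hi using Nat.le_induction with
    | base => intro hn; exact (suffixRank_mem (h.1 1 le_rfl hn).1 (h.1 1 le_rfl hn).2).1
    | succ i hi ih =>
      intro hn
      have := hm i (i + 1) hi (by omega) hn
      have := ih (by omega)
      omega
  have h2 : ∀ d i, 1 ≤ i → i + d = T.length → suffixRank T (A i) ≤ i := by
    intro d
    induction d with
    | zero =>
      intro i hi e
      have := suffixRank_mem (h.1 i hi (by omega)).1 (h.1 i hi (by omega)).2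
      omega
    | succ d ih =>
      intro i hi e
      have := hm i (i + 1) hi (by omega) (by omega)
      have := ih (i + 1) (by omega) (by omega)
      omega
  exact le_antisymm (h2 (T.length - i) i hi (by omega)) (h1 i hi hin)

lemma IsSuffixArray.apply_rank {A : ℕ → ℕ} (h : IsSuffixArray T A) (hj : 1 ≤ j) (hjn : j ≤ T.length) :
    A (suffixRank T j) = j := by
  obtain ⟨a, b⟩ := suffixRank_mem hj hjn
  obtain ⟨c, d⟩ := h.1 _ a b
  exact suffixRank_inj c d hj hjn (h.rank a b)

end

/-! ### Induced sorting of the S-type suffixes and the list of the zero entries -/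

section
variable {σ : ℕ} {T : List (Fin σ)} {i j x z N c : ℕ}

lemma symbolAt_append_left (U V : List (Fin σ)) (hi : 1 ≤ i) (hU : i ≤ U.length) :
    symbolAt (U ++ V) i = symbolAt U i := by
  rw [symbolAt, symbolAt, List.getElem?_append_left (by omega)]

lemma symbolAt_concat (U : List (Fin σ)) (e : Fin σ) :
    symbolAt (U ++ [e]) (U.length + 1) = e.val := by
  simp [symbolAt]

lemma EndsWithSentinel.length_pos (hT : EndsWithSentinel T) : 1 ≤ T.length := by
  obtain ⟨U, e, rfl, -⟩ := hT
  simp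

lemma EndsWithSentinel.lt (hT : EndsWithSentinel T) (hi : 1 ≤ i) (hin : i < T.length) :
    symbolAt T T.length < symbolAt T i := by
  obtain ⟨U, e, rfl, h⟩ := hT
  simp only [List.length_append, List.length_cons, List.length_nil] at hin
  rw [symbolAt_append_left U [e] hi (by omega)]
  simp only [List.length_append, List.length_cons, List.length_nil, Nat.zero_add, symbolAt_concat]
  rw [symbolAt, List.getElem?_eq_getElem (by omega)]
  exact h _ (List.getElem_mem _)

lemma countP_eq_card (T : List (Fin σ)) (p : ℕ → Prop) [DecidablePred p] :
    T.countP (fun x => decide (p x.val)) =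
      ((Finset.Icc 1 T.length).filter fun i => p (symbolAt T i)).card := by
  induction T using List.reverseRecOn with
  | nil => simp
  | append_singleton U e ih =>
    rw [List.countP_append, ih, List.length_append, List.length_singleton,
      ← Finset.insert_Icc_right_eq_Icc_add_one (by omega), Finset.filter_insert, symbolAt_concat]
    have h : ((Finset.Icc 1 U.length).filter fun i => p (symbolAt (U ++ [e]) i)) =
        (Finset.Icc 1 U.length).filter fun i => p (symbolAt U i) :=
      Finset.filter_congr fun i hi => by
        rw [Finset.mem_Icc] at hi
        rw [symbolAt_append_left U [e] hi.1 hi.2]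
    rw [h]
    split_ifs with hp
    · rw [Finset.card_insert_of_notMem (by simp)]
      simp [hp]
    · simp [hp]

lemma isSType_iff (hi : 1 ≤ i) (hin : i < T.length) :
    IsSType T i ↔ suffixRank T i < suffixRank T (i + 1) := by
  rw [suffixRank_lt_iff hi hin.le (by omega) hin, IsSType, or_iff_right (by omega)]

lemma suffixRank_lt_of_symbolAt_lt (hi : 1 ≤ i) (hin : i ≤ T.length) (hj : 1 ≤ j)
    (hjn : j ≤ T.length) (h : symbolAt T i < symbolAt T j) : suffixRank T i < suffixRank T j :=
  (suffixRank_lt_iff hi hin hj hjn).2 ((suffixAt_lt_iff hi hin hj hjn).2 (Or.inl h))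

lemma symbolAt_le_of_suffixRank_lt (hi : 1 ≤ i) (hin : i ≤ T.length) (hj : 1 ≤ j)
    (hjn : j ≤ T.length) (h : suffixRank T i < suffixRank T j) : symbolAt T i ≤ symbolAt T j := by
  by_contra hc
  have := suffixRank_lt_of_symbolAt_lt hj hjn hi hin (not_le.1 hc)
  omega

lemma suffixRank_succ_lt_iff (hi : 1 ≤ i) (hin : i < T.length) (hj : 1 ≤ j)
    (hjn : j < T.length) (h : symbolAt T i = symbolAt T j) :
    suffixRank T i < suffixRank T j ↔ suffixRank T (i + 1) < suffixRank T (j + 1) := by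
  rw [suffixRank_lt_iff hi hin.le hj hjn.le, suffixRank_lt_iff (by omega) hin (by omega) hjn,
    suffixAt_lt_iff hi hin.le hj hjn.le]
  simp [h]

/-- In a bucket, the S-type suffixes come after the L-type suffixes. -/
lemma suffixRank_lt_succ_of_lt (hT : EndsWithSentinel T) (hz : 1 ≤ z) (hzn : z < T.length)
    (hx : 1 ≤ x) (hxn : x < T.length) (hs : symbolAt T z = symbolAt T x)
    (hS : suffixRank T z < suffixRank T (z + 1)) (hlt : suffixRank T z < suffixRank T x) :
    suffixRank T x < suffixRank T (x + 1) := by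
  obtain ⟨d, hd⟩ : ∃ d, z + d = T.length := ⟨T.length - z, by omega⟩
  induction d generalizing z x with
  | zero => omega
  | succ d ih =>
    have h1 := (suffixRank_succ_lt_iff hz hzn hx hxn hs).1 hlt
    have h2 : symbolAt T z ≤ symbolAt T (z + 1) :=
      symbolAt_le_of_suffixRank_lt hz hzn.le (by omega) hzn hS
    have h3 : symbolAt T (z + 1) ≤ symbolAt T (x + 1) :=
      symbolAt_le_of_suffixRank_lt (by omega) hzn (by omega) hxn h1
    -- If T[x] = T[z] < T[x+1], then x is S-type at once. Otherwise the successors of z and x begin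
    -- with the same symbol again and satisfy the same hypotheses; neither is the end-marker, which
    -- is smaller than T[z].
    rcases (h2.trans h3).lt_or_eq with h | h
    · exact suffixRank_lt_of_symbolAt_lt hx hxn.le (by omega) hxn (by omega)
    · have hz' : z + 1 < T.length := by
        rcases (show z + 1 ≤ T.length from hzn).lt_or_eq with h' | h'
        · exact h'
        · have := hT.lt hz hzn
          rw [← h'] at this; omega
      have hx' : x + 1 < T.length := by
        rcases (show x + 1 ≤ T.length from hxn).lt_or_eq with h' | h'
        · exact h'
        · have := hT.lt hx hxn
          rw [← h'] at this; omega
      have h4 := (suffixRank_succ_lt_iff hz hzn (by omega) hz' (by omega)).1 hS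
      have h5 := ih (z := z + 1) (x := x + 1) (by omega) hz' (by omega) hx' (by omega) h4 h1 (by omega)
      exact (suffixRank_succ_lt_iff hx hxn (by omega) hx' (by omega)).2 h5

/-- The S-type suffixes of the `c`-bucket that are inserted before iteration `N` is begun. -/
def insertedSet (T : List (Fin σ)) (N c : ℕ) : Finset ℕ :=
  (Finset.Icc 1 T.length).filter fun x =>
    x < T.length ∧ IsSType T x ∧ symbolAt T x = c ∧ N < suffixRank T (x + 1)

lemma suffixRank_le_iff (hi : 1 ≤ i) (hin : i ≤ T.length) (hj : 1 ≤ j) (hjn : j ≤ T.length) :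
    suffixRank T i ≤ suffixRank T j ↔ suffixAt T i ≤ suffixAt T j := by
  rw [← not_lt, suffixRank_lt_iff hj hjn hi hin, not_lt]

/-- The suffixes with first symbol at most T[j] are those of rank at most that of j and those behind
j in its bucket. The latter are S-type, and they lie behind j exactly if their successors lie behind
j + 1, that is, if they have been inserted before j is. -/
lemma card_insertedSet (hT : EndsWithSentinel T) (hj : 1 ≤ j) (hjn : j < T.length)
    (hS : IsSType T j) :
    suffixRank T j + (insertedSet T (suffixRank T (j + 1)) (symbolAt T j)).card =
      T.countP fun x => decide (x.val ≤ symbolAt T j) := by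
  rw [countP_eq_card T (fun x => x ≤ symbolAt T j), suffixRank, ← Finset.card_union_of_disjoint]
  · congr 1
    ext x
    simp only [insertedSet, Finset.mem_union, Finset.mem_filter, Finset.mem_Icc]
    rw [← and_or_left]
    refine and_congr_right fun ⟨hx, hxn⟩ => ?_
    rw [← suffixRank_le_iff hx hxn hj hjn.le]
    constructor
    · rintro (h | h)
      · by_contra hc
        have := suffixRank_lt_of_symbolAt_lt hj hjn.le hx hxn (not_le.1 hc)
        omega
      · exact h.2.2.1.le
    · intro h
      by_cases hr : suffixRank T x ≤ suffixRank T j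
      · exact Or.inl hr
      · have hr := not_le.1 hr
        have e := le_antisymm h (symbolAt_le_of_suffixRank_lt hj hjn.le hx hxn hr)
        have hxn' : x < T.length := by
          rcases hxn.lt_or_eq with h' | h'
          · exact h'
          · have := hT.lt hj hjn
            rw [← h'] at this; omega
        refine Or.inr ⟨hxn', ?_, e, (suffixRank_succ_lt_iff hj hjn hx hxn' e.symm).1 hr⟩
        rw [isSType_iff hx hxn']
        exact suffixRank_lt_succ_of_lt hT hj hjn hx hxn' e.symm ((isSType_iff hj hjn).1 hS) hr
  · rw [Finset.disjoint_left]
    intro x h1 h2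
    simp only [insertedSet, Finset.mem_filter, Finset.mem_Icc] at h1 h2
    rw [← suffixRank_le_iff h1.1.1 h1.1.2 hj hjn.le] at h1
    have := (suffixRank_succ_lt_iff hj hjn h1.1.1 h2.2.1 h2.2.2.2.1.symm).2 h2.2.2.2.2
    omega

/-- The state of Step 4 when the iterations `n, …, N + 1` have been done. -/
structure Induced (T : List (Fin σ)) (N : ℕ) (S : InducingState) : Prop where
  sa : ∀ j, 1 ≤ j → j ≤ T.length →
    (¬ IsSType T j ∨ j = T.length ∨ N < suffixRank T (j + 1)) → S.sa (suffixRank T j) = j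
  bucket : ∀ c, S.bucket c + (insertedSet T N c).card = T.countP fun x => decide (x.val ≤ c)
  zero : ∀ j, 1 ≤ j → j ≤ T.length → suffixRank T j ≤ N → S.la j = 0
  done : ∀ j, 1 ≤ j → j ≤ T.length → N < suffixRank T j →
    S.la j ≠ 0 ∧ IsGreatest (lyndonLengths T j) (S.la j)
  next : ∀ j, 1 ≤ j → j ≤ T.length → suffixRank T j ≤ N → j < S.next j ∧
    (S.next j ≤ T.length ∧ suffixRank T (S.next j) ≤ N ∨ S.next j = T.length + 1) ∧
    ∀ x, j < x → x < S.next j → N < suffixRank T x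
  prev : ∀ j, 1 ≤ j → j ≤ T.length → suffixRank T j ≤ N → S.prev j < j ∧
    (1 ≤ S.prev j → suffixRank T (S.prev j) ≤ N) ∧
    ∀ x, S.prev j < x → x < j → N < suffixRank T x

/-! ### The invariant of Step 4 and its consequences -/

variable {S : InducingState}

lemma induced_start {sa₀ : ℕ → ℕ} (h : LTypesPlaced T sa₀) :
    Induced T T.length (InducingState.start T sa₀) where
  sa := fun j hj hjn hc => h j hj hjn (by
    by_cases hn : j = T.length
    · exact Or.inr hn
    · rcases hc with hc | hc | hc
      · exact Or.inl hc
      · exact Or.inr hc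
      · have := (suffixRank_mem (T := T) (i := j + 1) (by omega) (by omega)).2
        omega)
  bucket := fun c => by
    have : insertedSet T T.length c = ∅ := by
      refine Finset.filter_eq_empty_iff.2 fun x hx hc => ?_
      rw [Finset.mem_Icc] at hx
      have := (suffixRank_mem (T := T) (i := x + 1) (by omega) (by omega)).2
      omega
    rw [this]; rfl
  zero := fun j hj hjn hc => rfl
  done := fun j hj hjn hc => absurd (suffixRank_mem hj hjn).2 (by omega)
  next := fun j hj hjn hc => ⟨Nat.lt_succ_self j, by
    show (j + 1 ≤ T.length ∧ _) ∨ j + 1 = _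
    rcases hjn.lt_or_eq with h | h
    · exact Or.inl ⟨h, (suffixRank_mem (by omega) h).2⟩
    · exact Or.inr (by omega), fun x hx hx' => by
    have : x < j + 1 := hx'
    omega⟩
  prev := fun j hj hjn hc => by
    show j - 1 < j ∧ (1 ≤ j - 1 → suffixRank T (j - 1) ≤ _) ∧ ∀ x, j - 1 < x → _
    exact ⟨by omega, fun h => (suffixRank_mem h (by omega)).2, fun x hx hx' => by omega⟩

/-- The suffix of rank N is the end-marker or L-type, and then in place from the start, or it is
S-type; then its successor has rank above N and has already caused its insertion. -/
lemma Induced.read (h : Induced T N S) (hN : 1 ≤ N) (hNn : N ≤ T.length) :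
    1 ≤ S.sa N ∧ S.sa N ≤ T.length ∧ suffixRank T (S.sa N) = N := by
  obtain ⟨j, hj, hjn, rfl⟩ := exists_suffixRank_eq hN hNn
  have : S.sa (suffixRank T j) = j := by
    refine h.sa j hj hjn ?_
    by_cases h1 : j = T.length
    · exact Or.inr (Or.inl h1)
    · by_cases h2 : IsSType T j
      · exact Or.inr (Or.inr ((isSType_iff hj (by omega)).1 h2))
      · exact Or.inl h2
  rw [this]; exact ⟨hj, hjn, rfl⟩

/-- All positions skipped by the pointer have rank above N, whereas its target is the end of the
text or has rank at most N and is not j. So the target is the next smaller suffix. -/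
lemma Induced.isGreatest (h : Induced T N S) (hj : 1 ≤ j) (hjn : j ≤ T.length)
    (hr : suffixRank T j = N) : IsGreatest (lyndonLengths T j) (S.next j - j) := by
  obtain ⟨h1, h2, h3⟩ := h.next j hj hjn hr.le
  refine isGreatest_lyndonLengths hj h1 (by omega) ?_ fun x hx hxl => ?_
  · rcases h2 with h2 | h2
    · refine (suffixRank_lt_iff (by omega) h2.1 hj hjn).1 ?_
      refine lt_of_le_of_ne (hr ▸ h2.2) fun e => ?_
      have := suffixRank_inj (by omega) h2.1 hj hjn e
      omega
    · rw [h2, suffixAt_succ_length]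
      obtain ⟨x, -, e⟩ := suffixAt_eq_cons hj hjn
      rw [e]; exact List.nil_lt_cons _ _
  · have := h3 x hx hxl
    exact (suffixRank_lt_iff hj hjn (by omega) (by omega)).1 (by omega)

lemma Induced.linksZeros (h : Induced T N S) : LinksZeros T.length S.la S.next S.prev := by
  intro i hi hin h0
  have hz : ∀ x, 1 ≤ x → x ≤ T.length → S.la x = 0 → suffixRank T x ≤ N := fun x hx hxn hx0 => by
    by_contra hc
    exact (h.done x hx hxn (not_le.1 hc)).1 hx0
  have hr := hz i hi hin h0
  obtain ⟨n1, n2, n3⟩ := h.next i hi hin hr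
  obtain ⟨p1, p2, p3⟩ := h.prev i hi hin hr
  refine ⟨⟨⟨n1, ?_⟩, ?_⟩, ?_⟩
  · rcases n2 with n2 | n2
    · exact Or.inl ⟨n2.1, h.zero _ (by omega) n2.1 n2.2⟩
    · exact Or.inr n2
  · rintro l ⟨hl, hl'⟩
    by_contra hc
    have := n3 l hl (not_le.1 hc)
    rcases hl' with hl' | hl'
    · have := hz l (by omega) hl'.1 hl'.2
      omega
    · omega
  · rcases Nat.eq_zero_or_pos (S.prev i) with hp | hp
    · refine Or.inr ⟨hp, fun l hl hli hl0 => ?_⟩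
      have := p3 l (by omega) hli
      have := hz l hl (by omega) hl0
      omega
    · have hq := p2 hp
      refine Or.inl ⟨hp, p1, h.zero _ hp (by omega) hq, ?_⟩
      obtain ⟨m1, m2, m3⟩ := h.next _ hp (by omega) hq
      rcases lt_trichotomy (S.next (S.prev i)) i with hlt | heq | hgt
      · have := p3 _ m1 hlt
        omega
      · exact heq
      · have := m3 i p1 hgt
        omega

/-- When the threshold drops from N + 1 to N, the only newly visited suffix is j, so at most its
predecessor is added. -/
lemma insertedSet_succ (hj : 1 ≤ j) (hjn : j ≤ T.length) (hr : suffixRank T j = N + 1) :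
    insertedSet T N c = if (1 < j ∧ IsSType T (j - 1)) ∧ symbolAt T (j - 1) = c then
      insert (j - 1) (insertedSet T (N + 1) c) else insertedSet T (N + 1) c := by
  have key : ∀ x, 1 ≤ x → x < T.length → (N < suffixRank T (x + 1) ↔
      x + 1 = j ∨ N + 1 < suffixRank T (x + 1)) := fun x hx hxn => by
    constructor
    · intro h
      rcases (show N + 1 ≤ suffixRank T (x + 1) from h).lt_or_eq with h | h
      · exact Or.inr h
      · exact Or.inl (suffixRank_inj (by omega) hxn hj hjn (by omega))
    · rintro (rfl | h) <;> omega
  have hset : ∀ x, x ∈ insertedSet T N c ↔ x ∈ insertedSet T (N + 1) c ∨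
      (x + 1 = j ∧ 1 < j ∧ IsSType T (j - 1) ∧ symbolAt T (j - 1) = c) := fun x => by
    simp only [insertedSet, Finset.mem_filter, Finset.mem_Icc]
    constructor
    · rintro ⟨⟨h1, h2⟩, h3, h4, h5, h6⟩
      rcases (key x h1 h3).1 h6 with rfl | h6
      · exact Or.inr ⟨rfl, by omega, h4, h5⟩
      · exact Or.inl ⟨⟨h1, h2⟩, h3, h4, h5, h6⟩
    · rintro (⟨⟨h1, h2⟩, h3, h4, h5, h6⟩ | ⟨rfl, h1, h2, h3⟩)
      · exact ⟨⟨h1, h2⟩, h3, h4, h5, by omega⟩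
      · exact ⟨by omega, by omega, h2, h3, by omega⟩
  ext x
  rw [hset x]
  split_ifs with hc
  · rw [Finset.mem_insert, or_comm]
    refine or_congr_left ⟨fun h => by omega, fun h => ⟨by omega, hc.1.1, hc.1.2, hc.2⟩⟩
  · refine or_iff_left fun h => hc ⟨⟨h.2.1, h.2.2.1⟩, h.2.2.2⟩

lemma notMem_insertedSet (hr : suffixRank T j = N) (hj : 1 < j) : j - 1 ∉ insertedSet T N c := by
  intro h
  simp only [insertedSet, Finset.mem_filter, Finset.mem_Icc] at h
  have := h.2.2.2.2
  rw [show j - 1 + 1 = j by omega] at this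
  omega

/-- The cell at the tail of the bucket is the final place of the inserted suffix. -/
lemma Induced.bucket_eq (h : Induced T N S) (hT : EndsWithSentinel T) (hj : 1 < j)
    (hjn : j ≤ T.length) (hr : suffixRank T j = N) (hS : IsSType T (j - 1)) :
    S.bucket (symbolAt T (j - 1)) = suffixRank T (j - 1) := by
  have h1 := h.bucket (symbolAt T (j - 1))
  have h2 := card_insertedSet hT (j := j - 1) (by omega) (by omega) hS
  rw [show j - 1 + 1 = j by omega, hr] at h2
  omega

/-- For the list, the point is that no other pointer leads to j: if `next x = j` with `x ≠ prev j`,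
then `prev j` lies between x and j or x lies between `prev j` and j, although the positions skipped
by a pointer have rank above N + 1. Symmetrically for `prev`. For the array, distinct ranks keep the
new entry from overwriting a placed one. -/
lemma Induced.iter (h : Induced T (N + 1) S) (hT : EndsWithSentinel T) (hN : N + 1 ≤ T.length) :
    Induced T N (S.iter T (N + 1)) := by
  obtain ⟨hj, hjn, hr⟩ := h.read (by omega) hN
  generalize ej : S.sa (N + 1) = j at hj hjn hr
  have hne : ∀ x, 1 ≤ x → x ≤ T.length → suffixRank T x = N + 1 → x = j := fun x hx hxn e =>
    suffixRank_inj hx hxn hj hjn (by omega)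
  have hgt : ∀ x, 1 ≤ x → x ≤ T.length → x ≠ j → N < suffixRank T x → N + 1 < suffixRank T x :=
    fun x hx hxn hxj hlt => by
      rcases (show N + 1 ≤ suffixRank T x from hlt).lt_or_eq with h | h
      · exact h
      · exact absurd (hne x hx hxn h.symm) hxj
  obtain ⟨n1, n2, n3⟩ := h.next j hj hjn (by omega)
  obtain ⟨p1, p2, p3⟩ := h.prev j hj hjn (by omega)
  constructor
  · intro x hx hxn hc
    simp only [InducingState.iter, ej]
    by_cases hI : 1 < j ∧ IsSType T (j - 1)
    · rw [if_pos hI, h.bucket_eq hT hI.1 hjn hr hI.2]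
      by_cases hxj : x = j - 1
      · rw [hxj, Function.update_self]
      · rw [Function.update_of_ne fun e => hxj (suffixRank_inj hx hxn (by omega) (by omega) e)]
        refine h.sa x hx hxn ?_
        rcases hc with hc | hc | hc
        · exact Or.inl hc
        · exact Or.inr (Or.inl hc)
        · by_cases hxn' : x = T.length
          · exact Or.inr (Or.inl hxn')
          · exact Or.inr (Or.inr (hgt _ (by omega) (by omega) (by omega) hc))
    · rw [if_neg hI]
      refine h.sa x hx hxn ?_
      rcases hc with hc | hc | hc
      · exact Or.inl hc
      · exact Or.inr (Or.inl hc)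
      · by_cases hxn' : x = T.length
        · exact Or.inr (Or.inl hxn')
        · by_cases hxj : x + 1 = j
          · subst hxj
            exact Or.inl fun hs => hI ⟨by omega, hs⟩
          · exact Or.inr (Or.inr (hgt _ (by omega) (by omega) hxj hc))
  · intro c
    have hb := h.bucket c
    rw [insertedSet_succ hj hjn hr]
    simp only [InducingState.iter, ej]
    by_cases hI : 1 < j ∧ IsSType T (j - 1)
    · rw [if_pos hI]
      by_cases hcc : symbolAt T (j - 1) = c
      · have hbe := h.bucket_eq hT hI.1 hjn hr hI.2
        -- The decrement of the pointer is a truncated subtraction; it is exact because the pointer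
        -- is a rank, hence at least 1.
        have := (suffixRank_mem (T := T) (i := j - 1) (by omega) (by omega)).1
        rw [if_pos ⟨hI, hcc⟩, Finset.card_insert_of_notMem (notMem_insertedSet hr hI.1), ← hcc,
          Function.update_self]
        rw [← hcc] at hb
        omega
      · rw [if_neg fun h => hcc h.2, Function.update_of_ne fun e => hcc e.symm]
        exact hb
    · rw [if_neg hI, if_neg fun h => hI h.1]
      exact hb
  · intro x hx hxn hc
    have : x ≠ j := by rintro rfl; omega
    simp only [InducingState.iter, ej, Function.update_of_ne this]
    exact h.zero x hx hxn (by omega)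
  · intro x hx hxn hc
    simp only [InducingState.iter, ej]
    by_cases hxj : x = j
    · subst hxj
      rw [Function.update_self]
      exact ⟨by omega, h.isGreatest hj hjn hr⟩
    · rw [Function.update_of_ne hxj]
      exact h.done x hx hxn (hgt x hx hxn hxj hc)
  · intro x hx hxn hc
    obtain ⟨a1, a2, a3⟩ := h.next x hx hxn (by omega)
    have hxj : x ≠ j := by rintro rfl; omega
    simp only [InducingState.iter, ej]
    by_cases hxp : x = S.prev j
    · have e : (if 0 < S.prev j then Function.update S.next (S.prev j) (S.next j) else S.next) x
          = S.next j := by rw [if_pos (by omega), hxp, Function.update_self]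
      rw [e]
      refine ⟨by omega, ?_, fun y hy hyn => ?_⟩
      · rcases n2 with n2 | n2
        · refine Or.inl ⟨n2.1, ?_⟩
          by_contra hcc
          have := hne (S.next j) (by omega) n2.1 (by omega)
          omega
        · exact Or.inr n2
      · rcases lt_trichotomy y j with hyj | rfl | hyj
        · exact (Nat.lt_succ_self N).trans (p3 y (by omega) hyj)
        · omega
        · exact (Nat.lt_succ_self N).trans (n3 y hyj hyn)
    · have e : (if 0 < S.prev j then Function.update S.next (S.prev j) (S.next j) else S.next) x
          = S.next x := by
        split_ifs
        · rw [Function.update_of_ne hxp]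
        · rfl
      rw [e]
      refine ⟨a1, ?_, fun y hy hyn => (Nat.lt_succ_self N).trans (a3 y hy hyn)⟩
      rcases a2 with a2 | a2
      · refine Or.inl ⟨a2.1, ?_⟩
        by_contra hcc
        have hnj := hne (S.next x) (by omega) a2.1 (by omega)
        rcases lt_trichotomy x (S.prev j) with hlt | heq | hgt'
        · have := a3 (S.prev j) hlt (by omega)
          have := p2 (by omega)
          omega
        · exact hxp heq
        · have := p3 x hgt' (by omega)
          omega
      · exact Or.inr a2
  · intro x hx hxn hc
    obtain ⟨a1, a2, a3⟩ := h.prev x hx hxn (by omega)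
    have hxj : x ≠ j := by rintro rfl; omega
    simp only [InducingState.iter, ej]
    by_cases hxp : x = S.next j
    · have e : (if S.next j < T.length + 1 then Function.update S.prev (S.next j) (S.prev j)
          else S.prev) x = S.prev j := by rw [if_pos (by omega), hxp, Function.update_self]
      rw [e]
      refine ⟨by omega, fun hp => ?_, fun y hy hyn => ?_⟩
      · by_contra hcc
        have := p2 hp
        have := hne (S.prev j) hp (by omega) (by omega)
        omega
      · rcases lt_trichotomy y j with hyj | rfl | hyj
        · exact (Nat.lt_succ_self N).trans (p3 y (by omega) hyj)
        · omega
        · exact (Nat.lt_succ_self N).trans (n3 y hyj (by omega))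
    · have e : (if S.next j < T.length + 1 then Function.update S.prev (S.next j) (S.prev j)
          else S.prev) x = S.prev x := by
        split_ifs
        · rw [Function.update_of_ne hxp]
        · rfl
      rw [e]
      refine ⟨a1, fun hp => ?_, fun y hy hyn => (Nat.lt_succ_self N).trans (a3 y hy hyn)⟩
      by_contra hcc
      have := a2 hp
      have hnj := hne (S.prev x) hp (by omega) (by omega)
      rcases lt_trichotomy x (S.next j) with hlt | heq | hgt'
      · have := n3 x (by omega) hlt
        omega
      · exact hxp heq
      · have := a3 (S.next j) (by omega) hgt'
        omega

lemma induced_stepFour (hT : EndsWithSentinel T) {sa₀ : ℕ → ℕ} (h : LTypesPlaced T sa₀) {m : ℕ}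
    (hm : m ≤ T.length) : Induced T (T.length - m) (stepFour T sa₀ m) := by
  induction m with
  | zero => exact induced_start h
  | succ m ih =>
    have ih := ih (by omega)
    rw [show T.length - m = T.length - (m + 1) + 1 by omega] at ih
    have := ih.iter hT (by omega)
    rwa [show T.length - (m + 1) + 1 = T.length - m by omega] at this

lemma Induced.isSuffixArray (h : Induced T 0 S) : IsSuffixArray T S.sa := by
  refine isSuffixArray_of_rank fun j hj hjn => h.sa j hj hjn ?_
  by_cases hn : j = T.length
  · exact Or.inr (Or.inl hn)
  · exact Or.inr (Or.inr (suffixRank_mem (by omega) (by omega)).1)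

lemma Induced.isLyndonArray (h : Induced T 0 S) : IsLyndonArray T S.la :=
  fun i hi hin => (h.done i hi hin (suffixRank_mem hi hin).1).2

theorem stepFour_spec (hT : EndsWithSentinel T) {sa₀ : ℕ → ℕ} (h : LTypesPlaced T sa₀) :
    (∀ m, m ≤ T.length → LinksZeros T.length (stepFour T sa₀ m).la (stepFour T sa₀ m).next
        (stepFour T sa₀ m).prev) ∧
      (∀ m, m < T.length →
        suffixRank T ((stepFour T sa₀ m).sa (T.length - m)) = T.length - m ∧
        (stepFour T sa₀ m).la ((stepFour T sa₀ m).sa (T.length - m)) = 0 ∧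
        IsGreatest (lyndonLengths T ((stepFour T sa₀ m).sa (T.length - m)))
          ((stepFour T sa₀ m).next ((stepFour T sa₀ m).sa (T.length - m)) -
            (stepFour T sa₀ m).sa (T.length - m))) ∧
      IsSuffixArray T (stepFour T sa₀ T.length).sa ∧
      IsLyndonArray T (stepFour T sa₀ T.length).la := by
  refine ⟨fun m hm => (induced_stepFour hT h hm).linksZeros, fun m hm => ?_, ?_, ?_⟩
  · have hI := induced_stepFour hT h hm.le
    obtain ⟨h1, h2, h3⟩ := hI.read (by omega) (by omega)
    exact ⟨h3, hI.zero _ h1 h2 h3.le, hI.isGreatest h1 h2 h3⟩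
  · have := induced_stepFour hT h le_rfl
    rw [Nat.sub_self] at this
    exact this.isSuffixArray
  · have := induced_stepFour hT h le_rfl
    rw [Nat.sub_self] at this
    exact this.isLyndonArray

end

/-! ### Step 4 as a structured program -/

section
variable {σ : ℕ} {T : List (Fin σ)} {i j x z N c : ℕ} {X : InducingState}

/-- The test for the type of the suffix at `j - 1`. -/
lemma Induced.isSType_iff_bucket (h : Induced T N X) (hT : EndsWithSentinel T) (hj : 1 < j)
    (hjn : j ≤ T.length) (hr : suffixRank T j = N) :
    IsSType T (j - 1) ↔ symbolAt T (j - 1) < symbolAt T j ∨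
      symbolAt T (j - 1) = symbolAt T j ∧ X.bucket (symbolAt T (j - 1)) < N := by
  obtain ⟨y, rfl⟩ : ∃ y, j = y + 1 := ⟨j - 1, by omega⟩
  simp only [Nat.add_sub_cancel]
  rw [isSType_iff (by omega) (by omega)]
  constructor
  · intro hS
    rcases (symbolAt_le_of_suffixRank_lt (by omega) (by omega) (by omega) hjn hS).lt_or_eq with h1 | h1
    · exact Or.inl h1
    -- For S-type the tail of the bucket is the final place of j - 1 itself, which lies before that
    -- of j.
    · refine Or.inr ⟨h1, ?_⟩
      have := h.bucket_eq hT hj hjn hr ((isSType_iff (by omega) (by omega)).2 hS)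
      rw [Nat.add_sub_cancel] at this
      omega
  · rintro (h1 | ⟨h1, h2⟩)
    · exact suffixRank_lt_of_symbolAt_lt (by omega) (by omega) (by omega) hjn h1
    -- For L-type, the suffixes not behind j - 1 are disjoint from those inserted into its bucket,
    -- which are S-type. So the tail of the bucket is at or behind the rank of j - 1, which exceeds
    -- N.
    · by_contra hc
      have hlt : suffixRank T (y + 1) < suffixRank T y := by
        refine lt_of_le_of_ne (not_lt.1 hc) fun e => ?_
        have := suffixRank_inj (by omega) hjn (by omega) (by omega) e
        omega
      have hb := h.bucket (symbolAt T y)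
      rw [countP_eq_card T (fun x => x ≤ symbolAt T y)] at hb
      have hle : suffixRank T y + (insertedSet T N (symbolAt T y)).card ≤
          ((Finset.Icc 1 T.length).filter fun i => symbolAt T i ≤ symbolAt T y).card := by
        rw [suffixRank, ← Finset.card_union_of_disjoint]
        · refine Finset.card_le_card fun x hx => ?_
          simp only [insertedSet, Finset.mem_union, Finset.mem_filter, Finset.mem_Icc] at hx ⊢
          rcases hx with ⟨hx, h3⟩ | h3
          · refine ⟨hx, ?_⟩
            rw [← suffixRank_le_iff hx.1 hx.2 (by omega) (by omega)] at h3
            by_contra hc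
            have := suffixRank_lt_of_symbolAt_lt (by omega) (by omega) hx.1 hx.2 (not_le.1 hc)
            omega
          · exact ⟨h3.1, h3.2.2.2.1.le⟩
        · rw [Finset.disjoint_left]
          intro x hx1 hx2
          simp only [insertedSet, Finset.mem_filter, Finset.mem_Icc] at hx1 hx2
          rw [← suffixRank_le_iff hx1.1.1 hx1.1.2 (by omega) (by omega)] at hx1
          obtain ⟨-, hxn, hxS, hxs, -⟩ := hx2
          rw [isSType_iff hx1.1.1 hxn] at hxS
          rcases hx1.2.lt_or_eq with hlt' | heq
          · have := suffixRank_lt_succ_of_lt hT hx1.1.1 hxn (by omega) (by omega) hxs hxS hlt'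
            omega
          · have := suffixRank_inj hx1.1.1 hx1.1.2 (by omega) (by omega) heq
            subst this
            omega
      omega

end

/-- The flat memory `M` holds the data of Step 4. -/
structure Stored (n σ s : ℕ) (M : ℕ → ℕ) (X : InducingState) : Prop where
  sa : ∀ i < n, M (s + n + i) = X.sa (i + 1)
  la : ∀ i < n, M (s + i) = X.la (i + 1)
  next : ∀ i < n, M (1 + i) = X.next (i + 1)
  prev : ∀ i < n, M (n + 1 + i) = X.prev (i + 1)
  bucket : ∀ c < σ, M (n + n + 1 + c) = X.bucket c

/-! ### Single updates in the memory layout of Step 4 -/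

section
variable {n σ s : ℕ} {M : ℕ → ℕ} {X : InducingState} {a j v : ℕ}

/-- Arrays are counted from 1 and their segments of the flat memory from 0, hence `a + 1`. -/
lemma Stored.setSa (h : Stored n σ s M X) (hs : n + n + 1 + σ ≤ s) (hj : 1 ≤ j) (hjn : j ≤ n)
    (ha : a + 1 = s + n + j) : Stored n σ s (Function.update M a v)
      { X with sa := Function.update X.sa j v } := by
  constructor
  · intro i hi
    have := h.sa i hi
    simp only [Function.update_apply]
    split_ifs <;> omega
  · intro i hi
    rw [Function.update_of_ne (by omega)]; exact h.la i hi
  · intro i hi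
    rw [Function.update_of_ne (by omega)]; exact h.next i hi
  · intro i hi
    rw [Function.update_of_ne (by omega)]; exact h.prev i hi
  · intro i hi
    rw [Function.update_of_ne (by omega)]; exact h.bucket i hi

lemma Stored.setLa (h : Stored n σ s M X) (hs : n + n + 1 + σ ≤ s) (hj : 1 ≤ j) (hjn : j ≤ n)
    (ha : a + 1 = s + j) : Stored n σ s (Function.update M a v)
      { X with la := Function.update X.la j v } := by
  constructor
  · intro i hi
    rw [Function.update_of_ne (by omega)]; exact h.sa i hi
  · intro i hi
    have := h.la i hi
    simp only [Function.update_apply]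
    split_ifs <;> omega
  · intro i hi
    rw [Function.update_of_ne (by omega)]; exact h.next i hi
  · intro i hi
    rw [Function.update_of_ne (by omega)]; exact h.prev i hi
  · intro i hi
    rw [Function.update_of_ne (by omega)]; exact h.bucket i hi

lemma Stored.setNext (h : Stored n σ s M X) (hs : n + n + 1 + σ ≤ s) (hj : 1 ≤ j) (hjn : j ≤ n) :
    Stored n σ s (Function.update M j v) { X with next := Function.update X.next j v } := by
  constructor
  · intro i hi
    rw [Function.update_of_ne (by omega)]; exact h.sa i hi
  · intro i hi
    rw [Function.update_of_ne (by omega)]; exact h.la i hi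
  · intro i hi
    have := h.next i hi
    simp only [Function.update_apply]
    split_ifs <;> omega
  · intro i hi
    rw [Function.update_of_ne (by omega)]; exact h.prev i hi
  · intro i hi
    rw [Function.update_of_ne (by omega)]; exact h.bucket i hi

lemma Stored.setPrev (h : Stored n σ s M X) (hs : n + n + 1 + σ ≤ s) (hj : 1 ≤ j) (hjn : j ≤ n) :
    Stored n σ s (Function.update M (n + j) v) { X with prev := Function.update X.prev j v } := by
  constructor
  · intro i hi
    rw [Function.update_of_ne (by omega)]; exact h.sa i hi
  · intro i hi
    rw [Function.update_of_ne (by omega)]; exact h.la i hi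
  · intro i hi
    rw [Function.update_of_ne (by omega)]; exact h.next i hi
  · intro i hi
    have := h.prev i hi
    simp only [Function.update_apply]
    split_ifs <;> omega
  · intro i hi
    rw [Function.update_of_ne (by omega)]; exact h.bucket i hi

lemma Stored.setBucket (h : Stored n σ s M X) (hs : n + n + 1 + σ ≤ s) (hj : j < σ) :
    Stored n σ s (Function.update M (n + n + 1 + j) v)
      { X with bucket := Function.update X.bucket j v } := by
  constructor
  · intro i hi
    rw [Function.update_of_ne (by omega)]; exact h.sa i hi
  · intro i hi
    rw [Function.update_of_ne (by omega)]; exact h.la i hi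
  · intro i hi
    rw [Function.update_of_ne (by omega)]; exact h.next i hi
  · intro i hi
    rw [Function.update_of_ne (by omega)]; exact h.prev i hi
  · intro i hi
    have := h.bucket i hi
    simp only [Function.update_apply]
    split_ifs <;> omega

end

/-- The pointer updates of an iteration of Step 4. -/
def unlink : Stmt :=
  .j ::= M[Exp.var .s + Exp.var .n + Exp.var .i - lit(1)] ;;
  .nx ::= M[Exp.var .j] ;;
  .pv ::= M[Exp.var .n + Exp.var .j] ;;
  Exp.var .s + Exp.var .j - lit(1) ::=ₘ Exp.var .nx - Exp.var .j ;;
  .ite (.lt lit(0) (Exp.var .pv)) (Exp.var .pv ::=ₘ Exp.var .nx) .skip ;;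
  .ite (.lt (Exp.var .nx) (Exp.var .n + lit(1))) (Exp.var .n + Exp.var .nx ::=ₘ Exp.var .pv) .skip

/-- The insertion of the suffix at `j - 1` into its bucket. -/
def induce : Stmt :=
  .c ::= .txt (Exp.var .j - lit(1)) ;;
  .a ::= .txt (Exp.var .j) ;;
  .q ::= Exp.var .n + Exp.var .n + lit(1) + Exp.var .c ;;
  .x ::= M[Exp.var .q] ;;
  .fl ::= lit(0) ;;
  .ite (.lt (Exp.var .c) (Exp.var .a)) (.fl ::= lit(1))
    (.ite (.eq (Exp.var .c) (Exp.var .a))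
      (.ite (.lt (Exp.var .x) (Exp.var .i)) (.fl ::= lit(1)) .skip) .skip) ;;
  .ite (.eq (Exp.var .fl) lit(1))
    (Exp.var .s + Exp.var .n + Exp.var .x - lit(1) ::=ₘ Exp.var .j - lit(1) ;;
      Exp.var .q ::=ₘ Exp.var .x - lit(1)) .skip

/-- One iteration of Step 4. -/
def stepFourBody : Stmt :=
  unlink ;; .ite (.lt lit(1) (Exp.var .j)) induce .skip ;; .i ::= Exp.var .i - lit(1)

/-! ### Correctness of one iteration of Step 4 -/

section
variable {E : Env} {S : St} {N j : ℕ} {X : InducingState}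

/-- `X` after the pointer updates for `j`. -/
def InducingState.unlink (n j : ℕ) (X : InducingState) : InducingState :=
  { X with
    la := Function.update X.la j (X.next j - j)
    next := if 0 < X.prev j then Function.update X.next (X.prev j) (X.next j) else X.next
    prev := if X.next j < n + 1 then Function.update X.prev (X.next j) (X.prev j) else X.prev }

lemma ok_unlink (hn : S.var .n = E.text.length) (hs : S.var .s = E.workCells) (hi : S.var .i = N)
    (hX : Stored E.text.length E.σ E.workCells S.mem X) (hN : 1 ≤ N) (hNn : N ≤ E.text.length)
    (hj : X.sa N = j) (h1 : 1 ≤ j) (hjn : j ≤ E.text.length) (hnx : 1 ≤ X.next j)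
    (hpv : X.prev j ≤ E.text.length)
    (hsp : E.text.length + E.text.length + 1 + E.σ ≤ E.workCells)
    (hW : 4 * E.size + 10 ≤ E.wordBound) :
    Ok E unlink S 100 fun S' => S'.var .j = j ∧
      Stored E.text.length E.σ E.workCells S'.mem (X.unlink E.text.length j) := by
  have hsz : E.size = E.workCells + 2 * E.text.length := rfl
  have e1 : S.mem (E.workCells + E.text.length + N - 1) = j := by
    have := hX.sa (N - 1) (by omega)
    rw [show N - 1 + 1 = N by omega, hj] at this
    rw [← this]; congr 1; omega
  have e2 : S.mem j = X.next j := by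
    have := hX.next (j - 1) (by omega)
    rwa [show j - 1 + 1 = j by omega, show 1 + (j - 1) = j by omega] at this
  have e3 : S.mem (E.text.length + j) = X.prev j := by
    have := hX.prev (j - 1) (by omega)
    rwa [show j - 1 + 1 = j by omega, show E.text.length + 1 + (j - 1) = E.text.length + j by omega]
      at this
  rw [Ok, unlink]
  simp only [wp_seq, wp_assign, wp_put, wp_ite, wp_skip]
  simp only [St.set_var, St.set_mem, St.write_var, St.write_mem, Exp.val_add, Exp.val_sub,
    Exp.val_var, Exp.val_const, Exp.val_mem, Exp.ok_add, Exp.ok_sub, Exp.ok_mem, Exp.ok_var,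
    Exp.ok_const, Cond.ok_lt, Cond.val_lt, reduceCtorEq, if_true, if_false, hn, hs, hi, e1, e2, e3,
    true_and, and_true]
  refine ⟨by omega, by omega, by omega, by omega, by omega,
    fun h0 => ⟨by omega, by omega, fun h2 => ⟨by omega, by simp, ?_⟩, fun h2 => ⟨by simp, ?_⟩⟩,
    fun h0 => ⟨by omega, fun h2 => ⟨by omega, by simp, ?_⟩, fun h2 => ⟨by simp, ?_⟩⟩⟩
  all_goals simp only [InducingState.unlink, h0, h2, if_true, if_false]
  · exact ((hX.setLa hsp h1 hjn (by omega)).setNext hsp (by omega) (by omega)).setPrev hsp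
      (by omega) (by omega)
  · exact (hX.setLa hsp h1 hjn (by omega)).setNext hsp (by omega) (by omega)
  · exact (hX.setLa hsp h1 hjn (by omega)).setPrev hsp (by omega) (by omega)
  · exact hX.setLa hsp h1 hjn (by omega)

/-- `X` after the insertion of the suffix at `j - 1` into the `c`-bucket. -/
def InducingState.insert (c j : ℕ) (X : InducingState) : InducingState :=
  { X with
    sa := Function.update X.sa (X.bucket c) (j - 1)
    bucket := Function.update X.bucket c (X.bucket c - 1) }

/-- `P` will be the S-type predicate. The program sees only two symbols and a bucket pointer; `hP`
links the two. -/
lemma ok_induce {P : Prop} [Decidable P] {c : ℕ} (hn : S.var .n = E.text.length)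
    (hs : S.var .s = E.workCells) (hi : S.var .i = N) (hvj : S.var .j = j)
    (hX : Stored E.text.length E.σ E.workCells S.mem X) (h1 : 1 < j) (hjn : j ≤ E.text.length)
    (hc : symbolAt E.text (j - 1) = c)
    (hP : P ↔ c < symbolAt E.text j ∨ c = symbolAt E.text j ∧ X.bucket c < N)
    (hb : P → 1 ≤ X.bucket c ∧ X.bucket c ≤ E.text.length)
    (hsp : E.text.length + E.text.length + 1 + E.σ ≤ E.workCells)
    (hW : 4 * E.size + 10 ≤ E.wordBound) :
    Ok E induce S 150 fun S' => Stored E.text.length E.σ E.workCells S'.mem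
      (if P then X.insert c j else X) := by
  have hsz : E.size = E.workCells + 2 * E.text.length := rfl
  have hcs : c < E.σ := hc ▸ symbolAt_lt _ _ (by omega) (by omega)
  have e1 := hX.bucket c hcs
  have hPd : P → Stored E.text.length E.σ E.workCells
      (Function.update (Function.update S.mem (E.workCells + E.text.length + X.bucket c - 1) (j - 1))
        (E.text.length + E.text.length + 1 + c) (X.bucket c - 1)) (X.insert c j) := fun hp =>
    (hX.setSa hsp (hb hp).1 (hb hp).2 (by omega)).setBucket hsp hcs
  rw [Ok, induce]
  simp only [wp_seq, wp_assign, wp_put, wp_ite, wp_skip]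
  simp only [St.set_var, St.set_mem, St.write_var, St.write_mem, Exp.val_add, Exp.val_sub,
    Exp.val_var, Exp.val_const, Exp.val_mem, Exp.val_txt, Exp.ok_add, Exp.ok_sub, Exp.ok_mem,
    Exp.ok_var, Exp.ok_txt, Exp.ok_const, Cond.ok_lt, Cond.val_lt, Cond.ok_eq, Cond.val_eq,
    reduceCtorEq, if_true, if_false, hn, hs, hi, hvj, hc, e1, true_and, and_true]
  simp only [true_implies, not_true, false_implies, not_false_iff, and_true]
  refine ⟨by omega, by omega, by omega, by omega, by omega, fun h2 => ?_,
    fun h2 => ⟨fun h3 => ⟨fun h4 => ?_, fun h4 => ?_⟩, fun h3 => ?_⟩⟩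
  · have hp : P := hP.2 (Or.inl h2)
    have := hb hp
    rw [if_pos hp]
    exact ⟨by omega, by omega, by omega, by omega, by simp, hPd hp⟩
  · have hp : P := hP.2 (Or.inr ⟨h3, h4⟩)
    have := hb hp
    rw [if_pos hp]
    exact ⟨by omega, by omega, by omega, by omega, by simp, hPd hp⟩
  · rw [if_neg fun hp => (hP.1 hp).elim h2 fun h => h4 h.2]
    exact ⟨by omega, by simp, by simp, hX⟩
  · rw [if_neg fun hp => (hP.1 hp).elim h2 fun h => h3 h.1]
    exact ⟨by omega, by simp, by simp, hX⟩

/-- Deletion touches only `la`, `next` and `prev`, insertion only `sa` and `bucket`, so the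
simultaneous update equals the two in sequence. -/
lemma InducingState.iter_eq {σ : ℕ} (T : List (Fin σ)) [Decidable (1 < X.sa N ∧ IsSType T (X.sa N - 1))] :
    X.iter T N = if 1 < X.sa N ∧ IsSType T (X.sa N - 1) then
      (X.unlink T.length (X.sa N)).insert (symbolAt T (X.sa N - 1)) (X.sa N)
    else X.unlink T.length (X.sa N) := by
  by_cases h : 1 < X.sa N ∧ IsSType T (X.sa N - 1)
  · simp only [InducingState.iter, InducingState.unlink, InducingState.insert, if_pos h]
  · simp only [InducingState.iter, InducingState.unlink, if_neg h]

/-- The variables that hold the length of the text, the alphabet size and the memory size. -/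
structure Sizes (E : Env) (S : St) : Prop where
  n : S.var .n = E.text.length
  sg : S.var .sg = E.σ
  s : S.var .s = E.workCells

lemma ok_stepFourBody (hv : Sizes E S) (hi : S.var .i = N + 1)
    (hX : Stored E.text.length E.σ E.workCells S.mem X) (hI : Induced E.text (N + 1) X)
    (hT : EndsWithSentinel E.text) (hN : N + 1 ≤ E.text.length)
    (hsp : E.text.length + E.text.length + 1 + E.σ ≤ E.workCells)
    (hW : 4 * E.size + 10 ≤ E.wordBound) :
    Ok E stepFourBody S 300 fun S' => S'.var .i = N ∧
      Stored E.text.length E.σ E.workCells S'.mem (X.iter E.text (N + 1)) := by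
  classical
  obtain ⟨hj, hjn, hr⟩ := hI.read (by omega) hN
  obtain ⟨n1, -, -⟩ := hI.next _ hj hjn (by omega)
  obtain ⟨p1, -, -⟩ := hI.prev _ hj hjn (by omega)
  rw [InducingState.iter_eq]
  generalize ej : X.sa (N + 1) = j at hj hjn hr n1 p1 ⊢
  have hlast : ∀ (u : ℕ) (S3 : St) (Y : InducingState), S3.var .i = N + 1 → u ≤ 290 →
      Stored E.text.length E.σ E.workCells S3.mem Y →
      WP E (.i ::= Exp.var .i - lit(1)) (fun u S' => u ≤ 300 ∧ S'.var .i = N ∧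
        Stored E.text.length E.σ E.workCells S'.mem Y) S3 u := by
    intro u S3 Y h1 h2 h3
    refine wp_assign.2 ⟨by simp; omega, by simp; omega, by simp [h1], by simpa using h3⟩
  rw [Ok, stepFourBody]
  simp only [wp_seq]
  refine (ok_unlink hv.n hv.s hi hX (by omega) hN ej hj hjn (by omega) (by omega) hsp hW).wp ?_
  rintro u1 S1 hu1 ⟨hvj, hX1⟩ hf1
  refine wp_ite.2 ⟨by simp; omega, fun h1 => ?_, fun h1 => ?_⟩
  · simp only [Cond.val_lt, Exp.val_const, Exp.val_var, hvj] at h1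
    have hb : IsSType E.text (j - 1) → 1 ≤ (X.unlink E.text.length j).bucket (symbolAt E.text (j - 1)) ∧
        (X.unlink E.text.length j).bucket (symbolAt E.text (j - 1)) ≤ E.text.length := fun h => by
      show 1 ≤ X.bucket _ ∧ X.bucket _ ≤ _
      rw [hI.bucket_eq hT h1 hjn hr h]
      exact suffixRank_mem (by omega) (by omega)
    refine (ok_induce (P := IsSType E.text (j - 1)) ((hf1 _ rfl).trans hv.n) ((hf1 _ rfl).trans hv.s)
      ((hf1 _ rfl).trans hi) hvj hX1 h1 hjn rfl (hI.isSType_iff_bucket hT h1 hjn hr) hb hsp hW).wp ?_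
    rintro u2 S2 hu2 hX2 hf2
    have e : ∀ p : Prop, (1 < j ∧ p) ↔ p := fun p => and_iff_right h1
    simp only [e]
    simp only [Cond.cost_lt, Exp.cost_const, Exp.cost_var] at hu2
    exact hlast _ _ _ ((hf2 _ rfl).trans ((hf1 _ rfl).trans hi)) (by omega) hX2
  · simp only [Cond.val_lt, Exp.val_const, Exp.val_var, hvj] at h1
    rw [if_neg fun h => h1 h.1, wp_skip]
    exact hlast _ _ _ ((hf1 _ rfl).trans hi) (by simp; omega) hX1

end

/-! ### The preparation of Step 4 -/

/-- The symbols of a string, increased by one, with padding by zeros. -/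
def numSeq {σ : ℕ} (T : List (Fin σ)) (i : ℕ) : ℕ := if i < T.length then symbolAt T (i + 1) + 1 else 0

section
variable {σ : ℕ} {T : List (Fin σ)}

lemma padded_numSeq (T : List (Fin σ)) : Padded (numSeq T) T.length :=
  ⟨fun i hi => by simp [numSeq, hi], fun i hi => by simp [numSeq, hi]⟩

lemma numSeq_le (T : List (Fin σ)) (i : ℕ) : numSeq T i ≤ σ := by
  rw [numSeq]
  split_ifs with h
  · exact symbolAt_lt T (i + 1) (by omega) (by omega)
  · omega

/-- Symbols are shifted to be positive, so padding by zeros makes a proper prefix smaller, in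
agreement with the order of lists. -/
lemma suffixAt_lt_of_sufLt {i j : ℕ} (hi : i ≤ T.length) (hj : j ≤ T.length)
    (h : SufLt (numSeq T) i j) : suffixAt T (i + 1) < suffixAt T (j + 1) := by
  obtain ⟨k, h⟩ := h
  induction k generalizing i j with
  | zero =>
    have h := h.2
    simp only [Nat.add_zero] at h
    have hj' : j < T.length := by
      by_contra hc
      simp [numSeq, hc] at h
    rcases hi.lt_or_eq with hi' | rfl
    · refine (suffixAt_lt_iff (by omega) hi' (by omega) hj').2 (Or.inl ?_)
      simpa [numSeq, hi', hj'] using h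
    · rw [suffixAt_succ_length]
      obtain ⟨x, -, e⟩ := suffixAt_eq_cons (T := T) (i := j + 1) (by omega) hj'
      rw [e]; exact List.nil_lt_cons _ _
  | succ k ih =>
    obtain ⟨h1, h2⟩ := h
    have hj' : j + (k + 1) < T.length := by
      by_contra hc
      simp [numSeq, hc] at h2
    rcases hi.lt_or_eq with hi' | rfl
    · refine (suffixAt_lt_iff (by omega) hi' (by omega) (by omega)).2 (Or.inr ⟨?_, ?_⟩)
      · have := h1 0 (by omega)
        simpa [numSeq, hi', show j < T.length by omega] using this
      · refine ih (by omega) (by omega) ⟨fun l hl => ?_, ?_⟩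
        · have := h1 (l + 1) (by omega)
          rwa [show i + 1 + l = i + (l + 1) by omega, show j + 1 + l = j + (l + 1) by omega]
        · rwa [show i + 1 + k = i + (k + 1) by omega, show j + 1 + k = j + (k + 1) by omega]
    · rw [suffixAt_succ_length]
      obtain ⟨x, -, e⟩ := suffixAt_eq_cons (T := T) (i := j + 1) (by omega) (by omega)
      rw [e]; exact List.nil_lt_cons _ _

lemma SortsSuffixes.isSuffixArray {A B : ℕ → ℕ} (h : SortsSuffixes (numSeq T) T.length A)
    (hB : ∀ i < T.length, B (i + 1) = A i + 1) : IsSuffixArray T B := by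
  constructor
  · intro i hi hin
    obtain ⟨i, rfl⟩ : ∃ y, i = y + 1 := ⟨i - 1, by omega⟩
    have := h.lt i hin
    rw [hB i hin]; omega
  · intro i j hi hij hj
    obtain ⟨i, rfl⟩ : ∃ y, i = y + 1 := ⟨i - 1, by omega⟩
    obtain ⟨j, rfl⟩ : ∃ y, j = y + 1 := ⟨j - 1, by omega⟩
    rw [hB i (by omega), hB j hj]
    exact suffixAt_lt_of_sufLt (h.lt i (by omega)).le (h.lt j hj).le (h.sorted i j (by omega) hj)

/-- A finished suffix array is more than Step 4 asks for. This is what allows any linear-time suffix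
sorting as preparation. -/
lemma IsSuffixArray.lTypesPlaced {A : ℕ → ℕ} (h : IsSuffixArray T A) : LTypesPlaced T A :=
  fun _ hj hjn _ => h.apply_rank hj hjn

/-- The number of occurrences of symbols with a given property among the first `k`. -/
def countSym (T : List (Fin σ)) (k : ℕ) (p : ℕ → Prop) [DecidablePred p] : ℕ :=
  ((Finset.Icc 1 k).filter fun i => p (symbolAt T i)).card

lemma countSym_succ (k : ℕ) (p : ℕ → Prop) [DecidablePred p] :
    countSym T (k + 1) p = countSym T k p + if p (symbolAt T (k + 1)) then 1 else 0 := by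
  rw [countSym, ← Finset.insert_Icc_right_eq_Icc_add_one (by omega), Finset.filter_insert]
  split_ifs with h
  · rw [Finset.card_insert_of_notMem (by simp)]; rfl
  · rfl

lemma countSym_le (k : ℕ) (p : ℕ → Prop) [DecidablePred p] : countSym T k p ≤ k :=
  (Finset.card_filter_le _ _).trans (by simp)

lemma countSym_lt_succ (k c : ℕ) :
    countSym T k (· < c) + countSym T k (· = c) = countSym T k (· < c + 1) := by
  induction k with
  | zero => simp [countSym]
  | succ k ih =>
    rw [countSym_succ, countSym_succ, countSym_succ, ← ih]
    split_ifs <;> omega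

end

def copyText : Stmt :=
  .b ::= lit(0) ;; .m ::= Exp.var .n ;; .K ::= Exp.var .sg ;;
  .forTo .i .n (Exp.var .i ::=ₘ .txt (Exp.var .i + lit(1)) + lit(1)) ;;
  Exp.var .n ::=ₘ lit(0) ;; Exp.var .n + lit(1) ::=ₘ lit(0) ;; Exp.var .n + lit(2) ::=ₘ lit(0)

/-- The sorted suffixes stand behind the copy of the text, at n + 4. They have to leave before
`initArrays` overwrites that region; positions become numbered from 1. -/
def copySorted : Stmt :=
  .forTo .i .n (Exp.var .s + Exp.var .n + Exp.var .i ::=ₘ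
    M[Exp.var .n + lit(4) + Exp.var .i] + lit(1))

def initArrays : Stmt :=
  .forTo .i .n (Exp.var .s + Exp.var .i ::=ₘ lit(0) ;;
    Exp.var .i + lit(1) ::=ₘ Exp.var .i + lit(2) ;;
    Exp.var .n + lit(1) + Exp.var .i ::=ₘ Exp.var .i)

def clearBuckets : Stmt :=
  .forTo .i .sg (Exp.var .n + Exp.var .n + lit(1) + Exp.var .i ::=ₘ lit(0))

def countBuckets : Stmt :=
  .forTo .i .n (.c ::= .txt (Exp.var .i + lit(1)) ;;
    .q ::= Exp.var .n + Exp.var .n + lit(1) + Exp.var .c ;;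
    Exp.var .q ::=ₘ M[Exp.var .q] + lit(1))

/-- The sums include the current symbol: the number of symbols at most c is the last position of the
c-bucket. -/
def sumBuckets : Stmt :=
  .y ::= lit(0) ;;
  .forTo .i .sg (.q ::= Exp.var .n + Exp.var .n + lit(1) + Exp.var .i ;;
    .y ::= Exp.var .y + M[Exp.var .q] ;;
    Exp.var .q ::=ₘ Exp.var .y)

/-- Everything before Step 4. -/
def prepare : Stmt :=
  copyText ;; suffixSort ;; copySorted ;; initArrays ;; clearBuckets ;; countBuckets ;;
  sumBuckets ;; .i ::= Exp.var .n

section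
variable {E : Env} {S : St}

lemma Sizes.of_frame {c : Stmt} {S' : St} (h : Sizes E S) (hf : Frame c S S')
    (hn : c.writes .n = false) (hsg : c.writes .sg = false) (hs : c.writes .s = false) : Sizes E S' :=
  ⟨(hf _ hn).trans h.n, (hf _ hsg).trans h.sg, (hf _ hs).trans h.s⟩

lemma ok_copyText (hv : Sizes E S) (hsp : E.text.length + 10 ≤ E.workCells)
    (hW : 4 * E.size + 10 ≤ E.wordBound) (hσ : E.σ + 10 ≤ E.wordBound) :
    Ok E copyText S (50 * E.text.length + 50) fun S' => S'.var .b = 0 ∧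
      S'.var .m = E.text.length ∧ S'.var .K = E.σ ∧
      StringAt S'.mem 0 E.text.length (numSeq E.text) := by
  have hsz : E.size = E.workCells + 2 * E.text.length := rfl
  rw [Ok, copyText]
  simp only [wp_seq]
  refine wp_assign.2 ⟨by simp; omega, wp_assign.2 ⟨by simp, wp_assign.2 ⟨by simp, ?_⟩⟩⟩
  refine (ok_forTo (N := E.text.length) (B := 21) (I := fun k S' =>
    ∀ i < k, S'.mem i = numSeq E.text i) (by simp [hv.n]) (by omega) rfl rfl (by decide)
    (by simp) ?_).wp ?_
  · rintro k S1 hk h1 hi -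
    have := symbolAt_lt E.text (k + 1) (by omega) (by omega)
    refine wp_put.2 ⟨by simp [hi]; omega, by simp, fun i hik => ?_⟩
    simp only [hi, St.set_mem, St.write_mem, Exp.val_add, Exp.val_var, Exp.val_txt, Exp.val_const,
      Function.update_apply]
    split_ifs with hc
    · subst hc; simp [numSeq, hk]
    · exact h1 i (by omega)
  rintro u S1 hu ⟨h1, -⟩ hf
  have en : S1.var .n = E.text.length := (hf _ rfl).trans (by simp [hv.n])
  simp only [wp_put]
  simp only [St.write_var, St.write_mem, Exp.val_add, Exp.val_var,
    Exp.val_const, Exp.ok_add, Exp.ok_var, Exp.ok_const, Exp.cost_var, Exp.cost_const,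
    Exp.cost_add, en, true_and] at hu ⊢
  refine ⟨by omega, by omega, by omega, by omega, ?_, ?_, ?_, padded_numSeq _, fun i hi => ?_⟩
  · exact (hf _ rfl).trans (by simp)
  · exact (hf _ rfl).trans (by simp [hv.n])
  · exact (hf _ rfl).trans (by simp [hv.sg])
  · simp only [Function.update_apply, Nat.zero_add]
    split_ifs with h2 h3 h4
    · simp [numSeq, h2]
    · simp [numSeq, h3]
    · simp [numSeq, h4]
    · exact h1 i (by omega)

lemma ok_copySorted (hv : Sizes E S) (hsp : 2 * E.text.length + 10 ≤ E.workCells)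
    (hW : 4 * E.size + 10 ≤ E.wordBound)
    (hm : ∀ i < E.text.length, S.mem (E.text.length + 4 + i) < E.text.length) :
    Ok E copySorted S (50 * E.text.length + 50) fun S' => ∀ i < E.text.length,
      S'.mem (E.workCells + E.text.length + i) = S.mem (E.text.length + 4 + i) + 1 := by
  have hsz : E.size = E.workCells + 2 * E.text.length := rfl
  rw [copySorted]
  refine (ok_forTo (N := E.text.length) (B := 41) (I := fun k S' =>
    (∀ x < E.workCells + E.text.length, S'.mem x = S.mem x) ∧
    ∀ i < k, S'.mem (E.workCells + E.text.length + i) = S.mem (E.text.length + 4 + i) + 1)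
    hv.n (by omega) rfl rfl (by decide) (by simp) ?_).mono (by omega) fun S' h _ => h.1.2
  rintro k S1 hk ⟨h1, h2⟩ hi hf
  have en : S1.var .n = _ := (hf _ rfl).trans hv.n
  have es : S1.var .s = _ := (hf _ rfl).trans hv.s
  have e := h1 (E.text.length + 4 + k) (by omega)
  have := hm k hk
  refine wp_put.2 ⟨by simp [en, es, hi, e]; omega, by simp, fun x hx => ?_, fun i hik => ?_⟩
  · simp only [hi, en, es, St.set_mem, St.write_mem, Exp.val_add, Exp.val_var]
    rw [Function.update_of_ne (by omega)]; exact h1 x hx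
  · simp only [hi, en, es, St.set_mem, St.write_mem, Exp.val_add, Exp.val_var, Exp.val_mem,
      Exp.val_const, Function.update_apply, Nat.add_left_cancel_iff, e]
    split_ifs with hc
    · rw [hc]
    · exact h2 i (by omega)

lemma ok_initArrays (hv : Sizes E S) (hsp : 2 * E.text.length + 10 ≤ E.workCells)
    (hW : 4 * E.size + 10 ≤ E.wordBound) :
    Ok E initArrays S (80 * E.text.length + 50) fun S' =>
      (∀ x, E.workCells + E.text.length ≤ x → S'.mem x = S.mem x) ∧ ∀ i < E.text.length,
        S'.mem (E.workCells + i) = 0 ∧ S'.mem (1 + i) = i + 2 ∧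
        S'.mem (E.text.length + 1 + i) = i := by
  have hsz : E.size = E.workCells + 2 * E.text.length := rfl
  rw [initArrays]
  refine (ok_forTo (N := E.text.length) (B := 71) (I := fun k S' =>
    (∀ x, E.workCells + E.text.length ≤ x → S'.mem x = S.mem x) ∧ ∀ i < k,
        S'.mem (E.workCells + i) = 0 ∧ S'.mem (1 + i) = i + 2 ∧
        S'.mem (E.text.length + 1 + i) = i)
    hv.n (by omega) rfl rfl (by decide) (by simp) ?_).mono (by omega) fun S' h _ => h.1
  rintro k S1 hk ⟨h1, h2⟩ hi hf
  have en : S1.var .n = _ := (hf _ rfl).trans hv.n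
  have es : S1.var .s = _ := (hf _ rfl).trans hv.s
  simp only [wp_seq, wp_put]
  simp only [St.set_mem, St.write_var, St.write_mem, Exp.val_add, Exp.val_var,
    Exp.val_const, Exp.ok_add, Exp.ok_var, Exp.ok_const, Exp.cost_var, Exp.cost_const,
    Exp.cost_add, en, es, hi, true_and]
  refine ⟨by omega, by omega, by omega, by omega, fun x hx => ?_, fun i hik => ⟨?_, ?_, ?_⟩⟩
  · rw [Function.update_of_ne (by omega), Function.update_of_ne (by omega),
      Function.update_of_ne (by omega)]
    exact h1 x hx
  all_goals
    have := h2 i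
    simp only [Function.update_apply]
    split_ifs <;> omega

/-- The buckets lie at `2 n + 1`; the rest of the memory is unchanged. -/
def BucketFrame (E : Env) (S S' : St) : Prop :=
  ∀ x, (x < E.text.length + E.text.length + 1 ∨
    E.text.length + E.text.length + 1 + E.σ ≤ x) → S'.mem x = S.mem x

lemma ok_clearBuckets (hv : Sizes E S)
    (hsp : E.text.length + E.text.length + 1 + E.σ ≤ E.workCells)
    (hW : 4 * E.size + 10 ≤ E.wordBound) :
    Ok E clearBuckets S (50 * E.σ + 50) fun S' => BucketFrame E S S' ∧
      ∀ c < E.σ, S'.mem (E.text.length + E.text.length + 1 + c) = 0 := by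
  have hsz : E.size = E.workCells + 2 * E.text.length := rfl
  rw [clearBuckets]
  refine (ok_forTo (N := E.σ) (B := 41) (I := fun k S' => BucketFrame E S S' ∧
      ∀ c < k, S'.mem (E.text.length + E.text.length + 1 + c) = 0)
    hv.sg (by omega) rfl rfl (by decide) ⟨fun x _ => rfl, by simp⟩ ?_).mono (by omega) fun S' h _ => h.1
  rintro k S1 hk ⟨h1, h2⟩ hi hf
  have en : S1.var .n = _ := (hf _ rfl).trans hv.n
  refine wp_put.2 ⟨by simp [en, hi]; omega, by simp, fun x hx => ?_, fun i hik => ?_⟩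
  · simp only [hi, en, St.set_mem, St.write_mem, Exp.val_add, Exp.val_var, Exp.val_const]
    rw [Function.update_of_ne (by omega)]; exact h1 x hx
  · have := h2 i
    simp only [hi, en, St.set_mem, St.write_mem, Exp.val_add, Exp.val_var, Exp.val_const,
      Function.update_apply]
    split_ifs <;> omega

lemma ok_countBuckets (hv : Sizes E S)
    (hsp : E.text.length + E.text.length + 1 + E.σ ≤ E.workCells)
    (hW : 4 * E.size + 10 ≤ E.wordBound)
    (h0 : ∀ c < E.σ, S.mem (E.text.length + E.text.length + 1 + c) = 0) :
    Ok E countBuckets S (60 * E.text.length + 50) fun S' => BucketFrame E S S' ∧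
      ∀ c < E.σ, S'.mem (E.text.length + E.text.length + 1 + c) =
        countSym E.text E.text.length (· = c) := by
  have hsz : E.size = E.workCells + 2 * E.text.length := rfl
  rw [countBuckets]
  refine (ok_forTo (N := E.text.length) (B := 51) (I := fun k S' => BucketFrame E S S' ∧
      ∀ c < E.σ, S'.mem (E.text.length + E.text.length + 1 + c) = countSym E.text k (· = c))
    hv.n (by omega) rfl rfl (by decide) ⟨fun x _ => rfl, fun c hc => ?_⟩ ?_).mono (by omega)
    fun S' h _ => h.1
  · simp [countSym, h0 c hc]
  rintro k S1 hk ⟨h1, h2⟩ hi hf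
  have en : S1.var .n = _ := (hf _ rfl).trans hv.n
  have hs := symbolAt_lt E.text (k + 1) (by omega) (by omega)
  have e := h2 _ hs
  have := countSym_le (T := E.text) k (· = symbolAt E.text (k + 1))
  simp only [wp_seq, wp_put, wp_assign]
  simp only [St.set_var, St.set_mem, St.write_mem, Exp.val_add, Exp.val_var,
    Exp.val_const, Exp.val_txt, Exp.val_mem, Exp.ok_add, Exp.ok_var, Exp.ok_const, Exp.ok_txt,
    Exp.ok_mem, Exp.cost_var, Exp.cost_const, Exp.cost_mem, Exp.cost_txt,
    Exp.cost_add, en, hi, e, true_and, reduceCtorEq, if_true, if_false]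
  refine ⟨by omega, by omega, by omega, by omega, fun x hx => ?_, fun c hc => ?_⟩
  · show Function.update _ _ _ x = _
    rw [Function.update_of_ne (by omega)]
    exact h1 x hx
  · rw [countSym_succ]
    by_cases hcc : symbolAt E.text (k + 1) = c
    · rw [if_pos hcc, hcc, Function.update_self]
    · rw [if_neg hcc, Function.update_of_ne (by omega), h2 c hc, Nat.add_zero]

lemma ok_sumBuckets (hv : Sizes E S)
    (hsp : E.text.length + E.text.length + 1 + E.σ ≤ E.workCells)
    (hW : 4 * E.size + 10 ≤ E.wordBound)
    (h0 : ∀ c < E.σ, S.mem (E.text.length + E.text.length + 1 + c) =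
      countSym E.text E.text.length (· = c)) :
    Ok E sumBuckets S (60 * E.σ + 50) fun S' => BucketFrame E S S' ∧
      ∀ c < E.σ, S'.mem (E.text.length + E.text.length + 1 + c) =
        countSym E.text E.text.length (· < c + 1) := by
  have hsz : E.size = E.workCells + 2 * E.text.length := rfl
  rw [Ok, sumBuckets]
  refine wp_seq.2 (wp_assign.2 ⟨by simp; omega, ?_⟩)
  refine (ok_forTo (E := E) (S := S.set .y 0) (N := E.σ) (B := 51) (I := fun k S' => BucketFrame E S S' ∧
      S'.var .y = countSym E.text E.text.length (· < k) ∧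
      (∀ c < E.σ, k ≤ c → S'.mem (E.text.length + E.text.length + 1 + c) =
        countSym E.text E.text.length (· = c)) ∧
      ∀ c < k, S'.mem (E.text.length + E.text.length + 1 + c) =
        countSym E.text E.text.length (· < c + 1))
    (by simp [hv.sg]) (by omega) rfl rfl (by decide)
    ⟨fun x _ => rfl, by simp [countSym], fun c hc _ => h0 c hc, by simp⟩ ?_).wp ?_
  · rintro k S1 hk ⟨h1, h2, h3, h4⟩ hi hf
    have en : S1.var .n = E.text.length := (hf _ rfl).trans (by simp [hv.n])
    have e := h3 k hk le_rfl
    have e' := countSym_lt_succ (T := E.text) E.text.length k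
    have := countSym_le (T := E.text) E.text.length (· < k + 1)
    simp only [wp_seq, wp_put, wp_assign]
    simp only [St.set_var, St.set_mem, St.write_var, St.write_mem, Exp.val_add, Exp.val_var,
      Exp.val_const, Exp.val_mem, Exp.ok_add, Exp.ok_var, Exp.ok_const,
      Exp.ok_mem, Exp.cost_var, Exp.cost_const, Exp.cost_mem,
      Exp.cost_add, en, hi, e, e', h2, true_and, reduceCtorEq, if_true, if_false]
    refine ⟨by omega, by omega, by omega, by omega, fun x hx => ?_, fun c hc hkc => ?_,
      fun c hc => ?_⟩
    · show Function.update _ _ _ x = _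
      rw [Function.update_of_ne (by omega)]
      exact h1 x hx
    · rw [Function.update_of_ne (by omega)]
      exact h3 c hc (by omega)
    · by_cases hcc : c = k
      · rw [hcc, Function.update_self]
      · rw [Function.update_of_ne (by omega)]
        exact h4 c (by omega)
  · rintro u S1 hu ⟨⟨h1, -, -, h4⟩, -⟩ -
    simp only [Exp.cost_const] at hu
    exact ⟨by omega, h1, h4⟩

/-- With the two output arrays the flat memory has at least 4n + σ + 200 cells, as `suffixSort`
requires. The arrays serve as scratch space until `copySorted` and `initArrays` fill them. -/
lemma ok_prepare (hv : Sizes E S) (hn : 1 ≤ E.text.length)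
    (hsp : 2 * E.text.length + E.σ + 200 ≤ E.workCells) (hW : 4 * E.size + 10 ≤ E.wordBound) :
    Ok E prepare S (60000 * (E.text.length + E.σ + 1)) fun S' => Sizes E S' ∧
      S'.var .i = E.text.length ∧ ∃ sa₀, IsSuffixArray E.text sa₀ ∧
        Stored E.text.length E.σ E.workCells S'.mem (InducingState.start E.text sa₀) := by
  have hsz : E.size = E.workCells + 2 * E.text.length := rfl
  rw [Ok, prepare]
  simp only [wp_seq]
  refine (ok_copyText hv (by omega) hW (by omega)).wp ?_
  rintro u1 S1 hu1 ⟨hb, hm, hK, hs⟩ hf1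
  have v1 := hv.of_frame hf1 rfl rfl rfl
  refine (ok_suffixSort hn hb hm hK v1.sg hs (numSeq_le _) (by omega) hW).wp ?_
  rintro u2 S2 hu2 hA hf2
  have v2 := v1.of_frame hf2 rfl rfl rfl
  refine (ok_copySorted v2 (by omega) hW hA.lt).wp ?_
  rintro u3 S3 hu3 h3 hf3
  have v3 := v2.of_frame hf3 rfl rfl rfl
  refine (ok_initArrays v3 (by omega) hW).wp ?_
  rintro u4 S4 hu4 ⟨q4, h4⟩ hf4
  have v4 := v3.of_frame hf4 rfl rfl rfl
  refine (ok_clearBuckets v4 (by omega) hW).wp ?_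
  rintro u5 S5 hu5 ⟨q5, h5⟩ hf5
  have v5 := v4.of_frame hf5 rfl rfl rfl
  refine (ok_countBuckets v5 (by omega) hW h5).wp ?_
  rintro u6 S6 hu6 ⟨q6, h6⟩ hf6
  have v6 := v5.of_frame hf6 rfl rfl rfl
  refine (ok_sumBuckets v6 (by omega) hW h6).wp ?_
  rintro u7 S7 hu7 ⟨q7, h7⟩ hf7
  have v7 := v6.of_frame hf7 rfl rfl rfl
  refine wp_assign.2 ⟨by simp, by simp; omega, ⟨by simpa using v7.n, by simpa using v7.sg,
    by simpa using v7.s⟩, by simp [v7.n], fun i => S2.mem (E.text.length + 4 + (i - 1)) + 1,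
    hA.isSuffixArray fun i _ => rfl, ?_⟩
  have q : BucketFrame E S4 S7 := fun x hx => (q7 x hx).trans ((q6 x hx).trans (q5 x hx))
  constructor
  · intro i hi
    show S7.mem _ = S2.mem _ + 1
    rw [q _ (Or.inr (by omega)), q4 _ (by omega), h3 i hi]; rfl
  · intro i hi
    show S7.mem _ = 0
    rw [q _ (Or.inr (by omega)), (h4 i hi).1]
  · intro i hi
    show S7.mem _ = i + 1 + 1
    rw [q _ (Or.inl (by omega)), (h4 i hi).2.1]
  · intro i hi
    show S7.mem _ = i + 1 - 1
    rw [q _ (Or.inl (by omega)), (h4 i hi).2.2]; rfl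
  · intro c hc
    show S7.mem _ = E.text.countP fun x => decide (x.val ≤ c)
    rw [h7 c hc, countP_eq_card E.text (· ≤ c), countSym]
    simp only [Nat.lt_succ_iff]

end

/-! ### The program -/

/-- Set the constant registers and the variables that hold the sizes. -/
def prologue : List (Instr 64) :=
  [.const 3 1, .arith .add 2 0 0, .arith .add 2 2 1, .const 54 200, .arith .add 2 2 54,
    .arith .add Var.n.idx 0 63, .arith .add Var.sg.idx 1 63, .arith .add Var.s.idx 2 63]

/-- Where the main loop stands. -/
def loopPc (p : Stmt) : ℕ := 8 + (p.comp 8).length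

/-- The program: the prologue, the preparation `p`, and the loop `l`. -/
def mainCode (p l : Stmt) : List (Instr 64) :=
  prologue ++ (p.comp 8 ++ (l.comp (loopPc p) ++ [.halt]))

lemma codeAt_mainCode (p l : Stmt) : CodeAt (mainCode p l) 0 prologue ∧
    CodeAt (mainCode p l) 8 (p.comp 8) ∧ CodeAt (mainCode p l) (loopPc p) (l.comp (loopPc p)) ∧
    (mainCode p l)[loopPc p + (l.comp (loopPc p)).length]? = some .halt := by
  have h : CodeAt (mainCode p l) 0 (mainCode p l) := by
    have := codeAt_self [] (mainCode p l) []
    rwa [List.nil_append, List.append_nil] at this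
  conv at h => arg 3; rw [mainCode]
  rw [codeAt_append, codeAt_append, codeAt_append] at h
  exact ⟨h.1, h.2.1, h.2.2.1, h.2.2.2.1⟩

instance Cond.decidableFits (b : Cond) : Decidable b.fits := by
  cases b <;> exact inferInstanceAs (Decidable (_ ∧ _))

def Stmt.decidableFits : (c : Stmt) → Decidable c.fits
  | .skip => isTrue trivial
  | .assign _ e => inferInstanceAs (Decidable (_ ≤ _))
  | .put a e => inferInstanceAs (Decidable (_ ∧ _))
  | .seq c d => @instDecidableAnd _ _ c.decidableFits d.decidableFits
  | .ite b c d =>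
      @instDecidableAnd _ _ _ (@instDecidableAnd _ _ c.decidableFits d.decidableFits)
  | .loop b c => @instDecidableAnd _ _ _ c.decidableFits

instance (c : Stmt) : Decidable c.fits := c.decidableFits

set_option maxRecDepth 4000 in
lemma prepare_fits : prepare.fits := by decide

/-- The condition of the loop of Step 4. -/
abbrev loopCond : Cond := .lt lit(0) (Exp.var .i)

lemma stepFourLoop_fits : (Stmt.loop loopCond stepFourBody).fits := by decide

section
variable {E : Env} {p l c : Stmt}

/-- The state of affairs after the prologue. -/
lemma reach_prologue (hs : E.workCells = 2 * E.text.length + E.σ + 200)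
    (hW : 4 * E.size + 10 ≤ E.wordBound) :
    ∃ (C : Config 64) (S : St), Reach (prog (mainCode p l)) E ((prog (mainCode p l)).init E) 8 C ∧ C.pc = 8 ∧
      Represents E C S ∧ Sizes E S := by
  have hsz : E.size = E.workCells + 2 * E.text.length := rfl
  obtain ⟨i0, i1, i2, i3, i4, i5, i6, i7, -⟩ := (codeAt_mainCode p l).1
  set W := E.wordBound with hWd
  have key : ∀ (C : Config 64) (k v : ℕ) (I : Instr 64) (d : Fin 64), (∀ r, C.reg r < W) →
      C.pc = k → (mainCode p l)[k]? = some I → I.exec E C = C.setReg E d v → v < W →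
      ∃ D : Config 64, Reach (prog (mainCode p l)) E C 1 D ∧ D.pc = k + 1 ∧
        D.reg = Function.update C.reg d v ∧ (∀ r, D.reg r < W) ∧ D.sa = C.sa ∧ D.la = C.la ∧
        D.work = C.work := by
    intro C k v I d hC hk hI hx hv
    subst hk
    refine ⟨{ C with reg := Function.update C.reg d v, pc := C.pc + 1 },
      Reach.single hI (by rw [hx, Config.setReg, if_pos hv]), rfl, rfl, fun r => ?_, rfl,
      rfl, rfl⟩
    by_cases hr : r = d
    · subst hr; simpa using hv
    · simpa [Function.update_of_ne hr] using hC r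
  have en : Var.n.idx = 4 := rfl
  have eg : Var.sg.idx = 5 := rfl
  have es : Var.s.idx = 6 := rfl
  rw [en] at i5
  rw [eg] at i6
  rw [es] at i7
  obtain ⟨C0, hC0⟩ : ∃ C, C = (prog (mainCode p l)).init E := ⟨_, rfl⟩
  have g0 : C0.reg 0 = E.text.length := by rw [hC0]; rfl
  have g1 : C0.reg 1 = E.σ := by rw [hC0]; rfl
  have g63 : C0.reg 63 = 0 := by rw [hC0]; rfl
  have b0 : ∀ r, C0.reg r < W := by
    intro r
    rw [hC0]
    simp only [Program.init]
    split_ifs <;> omega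
  rw [← hC0]
  obtain ⟨C1, r1, p1, e1, b1, s1, l1, w1⟩ := key C0 0 1 _ 3 b0 (by rw [hC0]; rfl) i0 rfl (by omega)
  obtain ⟨C2, r2, p2, e2, b2, s2, l2, w2⟩ := key C1 _ (E.text.length + E.text.length) _ 2 b1 p1 i1
    (by simp [Instr.exec, ArithOp.eval, e1, g0]) (by omega)
  obtain ⟨C3, r3, p3, e3, b3, s3, l3, w3⟩ := key C2 _ (E.text.length + E.text.length + E.σ) _ 2 b2 p2
    i2 (by simp [Instr.exec, ArithOp.eval, e1, e2, g1]) (by omega)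
  obtain ⟨C4, r4, p4, e4, b4, s4, l4, w4⟩ := key C3 _ 200 _ 54 b3 p3 i3 rfl (by omega)
  obtain ⟨C5, r5, p5, e5, b5, s5, l5, w5⟩ := key C4 _ E.workCells _ 2 b4 p4 i4
    (by simp [Instr.exec, ArithOp.eval, e3, e4, hs, two_mul]) (by omega)
  obtain ⟨C6, r6, p6, e6, b6, s6, l6, w6⟩ := key C5 _ E.text.length _ 4 b5 p5 i5
    (by simp [Instr.exec, ArithOp.eval, e1, e2, e3, e4, e5, g0, g63]) (by omega)
  obtain ⟨C7, r7, p7, e7, b7, s7, l7, w7⟩ := key C6 _ E.σ _ 5 b6 p6 i6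
    (by simp [Instr.exec, ArithOp.eval, e1, e2, e3, e4, e5, e6, g1, g63]) (by omega)
  obtain ⟨C8, r8, p8, e8, b8, s8, l8, w8⟩ := key C7 _ E.workCells _ 6 b7 p7 i7
    (by simp [Instr.exec, ArithOp.eval, e1, e2, e3, e4, e5, e6, e7, g63]) (by omega)
  refine ⟨C8, ⟨fun x => C8.reg x.idx, fun _ => 0⟩,
    ((((((r1.trans r2).trans r3).trans r4).trans r5).trans r6).trans r7).trans r8, p8,
    ⟨?_, ?_, ?_, ?_, fun x => rfl, b8, fun a _ => ?_, fun i _ => ?_, fun i _ => ?_, fun a _ => ?_,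
      by omega⟩, ?_, ?_, ?_⟩
  · simp [e1, e2, e3, e4, e5, e6, e7, e8, g0]
  · simp [e5, e6, e7, e8]
  · simp [e1, e2, e3, e4, e5, e6, e7, e8]
  · simp [e1, e2, e3, e4, e5, e6, e7, e8, g63]
  · rw [w8, w7, w6, w5, w4, w3, w2, w1, hC0]; rfl
  · rw [l8, l7, l6, l5, l4, l3, l2, l1, hC0]; rfl
  · rw [s8, s7, s6, s5, s4, s3, s2, s1, hC0]; rfl
  · show 0 < W
    omega
  · simp [en, e6, e7, e8]
  · simp [eg, e7, e8]
  · simp [es, e8]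

/-- One pass of the loop. -/
lemma reach_loop {C : Config 64} {S S' : St} (hf : (Stmt.loop loopCond c).fits)
    (h : Represents E C S) (hpc : C.pc = loopPc p)
    (hi : 0 < S.var .i) (hW : 0 < E.wordBound) {t : ℕ} (hr : Run E c S t S') :
    ∃ C', Reach (prog (mainCode p (.loop loopCond c))) E C (t + 4) C' ∧ Represents E C' S' ∧
      C'.pc = loopPc p := by
  obtain ⟨ca, cj, cjj, cc⟩ := codeAt_append.1 (codeAt_mainCode p (.loop loopCond c)).2.2.1
  obtain ⟨cc, cl, -⟩ := codeAt_append.1 cc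
  obtain ⟨C1, r1, h1, p1⟩ := (Cond.comp_correct _ h hpc hf.1 ⟨hW, trivial⟩ ca cj).1
    (by simpa using hi)
  obtain ⟨C2, r2, h2, p2⟩ := hr.comp_correct h1 p1 hf.2 cc
  refine ⟨{ C2 with pc := loopPc p }, ((r1.trans r2).trans (Reach.single (by rw [p2]; exact cl)
    rfl)).mono ?_, h2.pc _, rfl⟩
  simp only [Cond.cost_lt, Exp.cost_const, Exp.cost_var]
  omega

/-- The end of the loop. -/
lemma reach_halt {C : Config 64} {S : St} (hf : (Stmt.loop loopCond c).fits)
    (h : Represents E C S) (hpc : C.pc = loopPc p)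
    (hi : S.var .i = 0) (hW : 0 < E.wordBound) :
    ∃ C', Reach (prog (mainCode p (.loop loopCond c))) E C 4 C' ∧ Represents E C' S ∧
      (prog (mainCode p (.loop loopCond c))).HaltedAt C' := by
  obtain ⟨hL, hh⟩ := (codeAt_mainCode p (.loop loopCond c)).2.2
  have hr : Run E (.loop loopCond c) S loopCond.cost S :=
    .loopFalse ⟨hW, trivial⟩ (by simp [loopCond, hi])
  obtain ⟨C1, r1, h1, p1⟩ := hr.comp_correct h hpc hf hL
  exact ⟨C1, r1, h1, by rw [Program.HaltedAt, p1]; exact hh⟩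

end

/-! ### The theorem -/

/-- Times of the milestones of a run. -/
lemma exists_milestones (P : ℕ → ℕ → Prop) (n c t₀ : ℕ) (h0 : P 0 t₀)
    (h : ∀ m < n, ∀ t, P m t → ∃ u, t ≤ u ∧ u ≤ t + c ∧ P (m + 1) u) :
    ∃ τ : ℕ → ℕ, τ n ≤ t₀ + n * c ∧ (∀ m < n, τ m ≤ τ (m + 1) ∧ τ (m + 1) ≤ τ m + c) ∧ ∀ m ≤ n, P m (τ m) := by
  have h' : ∀ m t, ∃ u, m < n → P m t → t ≤ u ∧ u ≤ t + c ∧ P (m + 1) u := fun m t => by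
    by_cases hc : m < n ∧ P m t
    · obtain ⟨u, hu⟩ := h m hc.1 t hc.2
      exact ⟨u, fun _ _ => hu⟩
    · exact ⟨0, fun h1 h2 => absurd ⟨h1, h2⟩ hc⟩
  choose f hf using h'
  have hP : ∀ m ≤ n, P m (Nat.rec t₀ f m) := by
    intro m
    induction m with
    | zero => exact fun _ => h0
    | succ m ih => exact fun hm => (hf m _ hm (ih (by omega))).2.2
  refine ⟨fun m => Nat.rec t₀ f m, ?_, fun m hm => ?_, hP⟩
  · have key : ∀ m ≤ n, (Nat.rec t₀ f m : ℕ) ≤ t₀ + m * c := by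
      intro m
      induction m with
      | zero => simp
      | succ m ih =>
        intro hm
        have h1 := ih (by omega)
        have h2 := (hf m _ hm (hP m (by omega))).2.1
        rw [Nat.add_mul]
        exact h2.trans (by omega)
    exact key n le_rfl
  · have := hf m _ hm (hP m hm.le)
    exact ⟨this.1, this.2.1⟩

lemma IsSuffixArray.congr {σ : ℕ} {T : List (Fin σ)} {A B : ℕ → ℕ} (h : IsSuffixArray T A)
    (hB : ∀ i, 1 ≤ i → i ≤ T.length → B i = A i) : IsSuffixArray T B :=
  ⟨fun i hi hin => by rw [hB i hi hin]; exact h.1 i hi hin, fun i j hi hij hj => by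
    rw [hB i hi (by omega), hB j (by omega) hj]; exact h.2 i j hi hij hj⟩

lemma IsLyndonArray.congr {σ : ℕ} {T : List (Fin σ)} {A B : ℕ → ℕ} (h : IsLyndonArray T A)
    (hB : ∀ i, 1 ≤ i → i ≤ T.length → B i = A i) : IsLyndonArray T B :=
  fun i hi hin => by rw [hB i hi hin]; exact h i hi hin

lemma Represents.stores {E : Env} {C : Config 64} {S : St} {X : InducingState}
    (h : Represents E C S) (hX : Stored E.text.length E.σ E.workCells S.mem X)
    (hsp : 2 * E.text.length < E.workCells) : C.Stores E.text.length 0 E.text.length X := by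
  intro i hi hin
  obtain ⟨i, rfl⟩ : ∃ y, i = y + 1 := ⟨i - 1, by omega⟩
  refine ⟨(h.sa i hin).trans (hX.sa i hin), (h.la i hin).trans (hX.la i hin), ?_, ?_⟩
  · rw [h.work _ (by omega), ← hX.next i hin]; congr 1; omega
  · rw [h.work _ (by omega), ← hX.prev i hin]; congr 1; omega

/-- The program for the suffix array and the Lyndon array. -/
def mainProgram : Program := prog (mainCode prepare (.loop loopCond stepFourBody))

/-- The loop of Step 4 is followed pass by pass with `reach_loop`, not summarised by `wp_loop`,
because the configurations between the iterations are part of the claim. The bound 304 is 300 for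
the body and 4 for the test and the jump back. -/
theorem mainProgram_spec {E : Env} (hT : EndsWithSentinel E.text)
    (hs : E.workCells = 2 * E.text.length + E.σ + 200) (hW : 4 * E.size + 10 ≤ E.wordBound) :
    ∃ (t : ℕ) (C : Config 64) (sa₀ τ : ℕ → ℕ),
      t ≤ 61000 * (E.text.length + E.σ + 1) ∧ mainProgram.run E t = some C ∧
      mainProgram.HaltedAt C ∧ IsSuffixArray E.text C.sa ∧ IsLyndonArray E.text C.la ∧
      LTypesPlaced E.text sa₀ ∧
      (∀ m, m < E.text.length → τ m ≤ τ (m + 1) ∧ τ (m + 1) ≤ τ m + 304) ∧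
      τ E.text.length ≤ t ∧
      ∀ m, m ≤ E.text.length → ∃ D : Config 64, mainProgram.run E (τ m) = some D ∧
        D.Stores E.text.length 0 E.text.length (stepFour E.text sa₀ m) := by
  have hsz : E.size = E.workCells + 2 * E.text.length := rfl
  set l : Stmt := .loop loopCond stepFourBody with hl
  obtain ⟨C1, S1, r1, p1, h1, v1⟩ := reach_prologue (p := prepare) (l := l) hs hW
  obtain ⟨t2, S2, hr2, ht2, v2, i2, sa₀, hsa, hX2⟩ :=
    ok_prepare v1 hT.length_pos (by omega) hW
  obtain ⟨C2, r2, h2, p2⟩ := hr2.comp_correct h1 p1 prepare_fits (codeAt_mainCode prepare l).2.1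
  obtain ⟨t₀, ht₀, e₀⟩ := r1.trans r2
  have hpl := hsa.lTypesPlaced
  obtain ⟨τ, hτn, hτ, hP⟩ := exists_milestones (fun m t => ∃ (D : Config 64) (S : St),
      stepN (prog (mainCode prepare l)) E t ((prog (mainCode prepare l)).init E) = some D ∧
      Represents E D S ∧ D.pc = loopPc prepare ∧ Sizes E S ∧ S.var .i = E.text.length - m ∧
      Stored E.text.length E.σ E.workCells S.mem (stepFour E.text sa₀ m))
    E.text.length 304 t₀ ⟨C2, S2, e₀, h2, p2, v2, i2, hX2⟩ (by
      rintro m hm t ⟨D, S, hD, hrep, hpc, hv, hi, hX⟩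
      have hI := induced_stepFour hT hpl hm.le
      obtain ⟨N, hN⟩ : ∃ N, E.text.length - m = N + 1 := ⟨E.text.length - m - 1, by omega⟩
      rw [hN] at hi hI
      obtain ⟨u, S', hr, hu, hi', hX'⟩ := ok_stepFourBody hv hi hX hI hT (by omega) (by omega) hW
      obtain ⟨D', ⟨w, hw, ew⟩, hrep', hpc'⟩ :=
        reach_loop (p := prepare) stepFourLoop_fits hrep hpc (by omega) (by omega) hr
      refine ⟨t + w, by omega, by omega, D', S', ?_, hrep', hpc',
        hv.of_frame hr.frame rfl rfl rfl, by omega, ?_⟩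
      · rw [stepN_add, hD]; exact ew
      · rw [stepFour, hN]; exact hX')
  obtain ⟨D, S, hD, hrep, hpc, hv, hi, hX⟩ := hP _ le_rfl
  obtain ⟨C, ⟨w, hw, ew⟩, hC, hhalt⟩ :=
    reach_halt (p := prepare) stepFourLoop_fits hrep hpc (by omega) (by omega)
  have hst := hC.stores hX (by omega)
  have hspec := stepFour_spec hT hpl
  refine ⟨τ E.text.length + w, C, sa₀, τ, ?_, ?_, hhalt, hspec.2.2.1.congr fun i hi hin =>
    (hst i hi hin).1, hspec.2.2.2.congr fun i hi hin => (hst i hi hin).2.1, hpl, hτ, by omega,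
    fun m hm => ?_⟩
  · omega
  · rw [Program.run_eq_stepN, stepN_add]
    show (stepN (prog (mainCode prepare l)) E _ ((prog (mainCode prepare l)).init E)).bind _ = _
    rw [hD]; exact ew
  · obtain ⟨D, S, hD, hrep, -, -, -, hX⟩ := hP m hm
    exact ⟨D, by rw [Program.run_eq_stepN]; exact hD, hrep.stores hX (by omega)⟩

theorem mainTheorem3 :
    -- One program computes both arrays for all strings, within the stated resources.
    (∃ (P : Program) (c d k : ℕ), ∀ (σ : ℕ) (T : List (Fin σ)), EndsWithSentinel T →
      ∃ (s t : ℕ) (C : Config P.regs),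
        P.regs + s ≤ 2 * T.length + σ + d ∧
        t ≤ c * max T.length σ ∧
        P.run ⟨σ, T, s, k * (T.length + σ)⟩ t = some C ∧
        P.HaltedAt C ∧
        IsSuffixArray T C.sa ∧
        IsLyndonArray T C.la ∧
        -- The run contains Step 4 with the two pointer arrays, at most `c` steps per iteration.
        ∃ (sa₀ : ℕ → ℕ) (p q : ℕ) (τ : ℕ → ℕ),
          LTypesPlaced T sa₀ ∧
          p + T.length ≤ q ∧ q + T.length < s ∧
          (∀ m, m < T.length → τ m ≤ τ (m + 1) ∧ τ (m + 1) ≤ τ m + c) ∧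
          τ T.length ≤ t ∧
          ∀ m, m ≤ T.length → ∃ D : Config P.regs,
            P.run ⟨σ, T, s, k * (T.length + σ)⟩ (τ m) = some D ∧
            D.Stores T.length p q (stepFour T sa₀ m)) ∧
    -- Step 4: the linked list of the zero entries is maintained, `LA[j] = NEXT[j] - j` is the right
    -- value for the suffix `j` that is read, and both arrays are complete at the end.
    (∀ (σ : ℕ) (T : List (Fin σ)), EndsWithSentinel T →
      ∀ sa₀ : ℕ → ℕ, LTypesPlaced T sa₀ →
        (∀ m, m ≤ T.length →
          LinksZeros T.length (stepFour T sa₀ m).la (stepFour T sa₀ m).next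
            (stepFour T sa₀ m).prev) ∧
        (∀ m, m < T.length →
          suffixRank T ((stepFour T sa₀ m).sa (T.length - m)) = T.length - m ∧
          (stepFour T sa₀ m).la ((stepFour T sa₀ m).sa (T.length - m)) = 0 ∧
          IsGreatest (lyndonLengths T ((stepFour T sa₀ m).sa (T.length - m)))
            ((stepFour T sa₀ m).next ((stepFour T sa₀ m).sa (T.length - m)) -
              (stepFour T sa₀ m).sa (T.length - m))) ∧
        IsSuffixArray T (stepFour T sa₀ T.length).sa ∧
        IsLyndonArray T (stepFour T sa₀ T.length).la) := by

  -- 64 registers and 200 spare cells make 264. As n and σ are at least 1, 61000 (n + σ + 1) is at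
  -- most 183000 times their maximum, and words below 1000 (n + σ) cover four times the 4n + σ + 200
  -- cells of the flat memory.
  refine ⟨⟨mainProgram, 200000, 264, 1000, fun σ T hT => ?_⟩, fun σ T hT sa₀ h => stepFour_spec hT h⟩
  have hn := hT.length_pos
  have hσ : 1 ≤ σ := by
    have := symbolAt_lt T 1 le_rfl hn
    omega
  obtain ⟨t, C, sa₀, τ, ht, hC, hhalt, hsa, hla, hpl, hτ, hτt, hst⟩ := mainProgram_spec
    (E := ⟨σ, T, 2 * T.length + σ + 200, 1000 * (T.length + σ)⟩) hT rfl
    (by simp only [Env.size]; omega)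
  refine ⟨2 * T.length + σ + 200, t, C, ?_, ?_, hC, hhalt, hsa, hla, sa₀, 0, T.length, τ, hpl,
    by omega, by omega, fun m hm => ⟨(hτ m hm).1, (hτ m hm).2.trans (by omega)⟩, hτt, hst⟩
  · show 64 + _ ≤ _
    omega
  · have h1 := le_max_left T.length σ
    have h2 := le_max_right T.length σ
    simp only at ht
    omega
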